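/- Let $R$ be a commutative ring and $(A,L)$ a Lie–Rinehart algebra over $R$ (so $A$ is a commutative $R$-algebra, and $L$ is an $R$-Lie algebra and an $A$-module acting on $A$ by derivations, $(\alpha,a)\mapsto\alpha(a)$, with $(a\alpha)(b)=a\,\alpha(b)$ and $[\alpha,a\beta]=a[\alpha,\beta]+\alpha(a)\beta$). Let $\mathcal A=\bigoplus_{p\in\mathbb Z}\mathcal A^p$ be a graded commutative $A$-algebra with an $L$-action by derivations of degree zero, $A$-linear in $L$, such that $A\to\mathcal A$ is a morphism of left $(A,L)$-modules. Let $\Lambda_{\mathcal A}\mathcal L=\mathcal A\otimes_A\Lambda_AL$, bigraded by $(\Lambda_{\mathcal A}\mathcal L)^{p,q}=\mathcal A^p\otimes_A\Lambda^q_AL$, with total degree $|\cdot|=p+q$, product $(a\otimes u)(b\otimes v)=(-1)^{|u||b|}ab\otimes u\wedge v$, and the crossed product Gerstenhaber bracket: for $u=\alpha_1\wedge\dots\wedge\alpha_\ell$, $v=\alpha_{\ell+1}\wedge\dots\wedge\alpha_n$ and homogeneous $a,b\in\mathcal A$, $$[a\otimes u,b\otimes v]=(-1)^{(\ell-1)|b|}\Big(ab\otimes[u,v]+\sum_{j\le\ell}(-1)^{\ell-j}a\,\alpha_j(b)\otimes\alpha_1\wedge\dots\widehat{\alpha_j}\dots\wedge\alpha_n+\sum_{j>\ell}(-1)^{j-\ell}\alpha_j(a)\,b\otimes\alpha_1\wedge\dots\widehat{\alpha_j}\dots\wedge\alpha_n\Big),$$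 where $[u,v]=(-1)^\ell\sum_{j\le\ell<k}(-1)^{j+k}[\alpha_j,\alpha_k]\wedge\alpha_1\wedge\dots\widehat{\alpha_j}\dots\widehat{\alpha_k}\dots\wedge\alpha_n$ . An exact generator is an $R$-linear operator $\partial$ on $\Lambda_{\mathcal A}\mathcal L$ of bidegree $(0,-1)$ with $\partial\partial=0$ and $$[x,y]=(-1)^{|x|}\big(\partial(xy)-(\partial x)y-(-1)^{|x|}x(\partial y)\big)\quad\text{for all (bi)homogeneous }x,y.$$ Given such a $\partial$, let $\mathcal A_\partial$ be $\mathcal A$ with the graded right $(A,L)$-module structure $a\circ\alpha=a(\partial\alpha)-\alpha(a)$, $a\in\mathcal A$, $\alpha\in L$, that is, the corresponding graded right module over the universal algebra $U(A,L)$. Let $K(A,L)=(U(A,L)\otimes_A\Lambda_AL,d)$ be the Rinehart complex, $$d(u\otimes\alpha_1\wedge\dots\wedge\alpha_n)=\sum_i(-1)^{i-1}u\alpha_i\otimes\alpha_1\wedge\dots\widehat{\alpha_i}\dots\wedge\alpha_n+\sum_{j<k}(-1)^{j+k}u\otimes[\alpha_j,\alpha_k]\wedge\alpha_1\wedge\dots\widehat{\alpha_j}\dots\widehat{\alpha_k}\dots\wedge\alpha_n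 .$$ **Theorem.** Let $\partial$ be an exact generator of the bigraded crossed product Gerstenhaber algebra $\Lambda_{\mathcal A}\mathcal L$. 1. The maps $\mathcal A\otimes_A\Lambda^n_AL\to\mathcal A_\partial\otimes_{U(A,L)}K_n(A,L)$, $a\otimes w\mapsto a\otimes(1\otimes w)$, form an isomorphism of chain complexes of $R$-modules from $(\Lambda_{\mathcal A}\mathcal L,\partial)$ onto $\mathcal A_\partial\otimes_{U(A,L)}K(A,L)$, the tensor product of the graded right module $\mathcal A_\partial$ (with zero differential) and the complex $K(A,L)$, whose differential is $a\otimes k\mapsto(-1)^{|a|}a\otimes dk$. The same holds in each degree $p$ of $\mathcal A$: it identifies $(\mathcal A^p\otimes_A\Lambda_AL,\partial)$ with $(\mathcal A^p_\partial\otimes_{U(A,L)}K(A,L),(-1)^p\,\mathrm{id}\otimes d)$. 2. If $L$ is projective as an $A$-module, then for all $n\ge 0$ there are isomorphisms of $R$-modules $$H_n(\Lambda_{\mathcal A}\mathcal L,\partial)\cong H_n(L,\mathcal A_\partial)=\mathrm{Tor}_n^{U(A,L)}(\mathcal A_\partial,A),$$ and, for each $p\in\mathbb Z$, $H_n(\mathcal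 A^p\otimes_A\Lambda_AL,\partial)\cong\mathrm{Tor}_n^{U(A,L)}(\mathcal A^p_\partial,A)$. -/

import Mathlib

universe u

open scoped TensorProduct

set_option linter.unusedSectionVars false
set_option linter.unusedSimpArgs false

noncomputable section

namespace LRBV

open CategoryTheory

section RLevel
variable (R A L : Type u) [CommRing R] [CommRing A] [Algebra R A] [LieRing L] [LieAlgebra R L]

/-- `foldr'` input for `lieExt`. -/
def lieExtAux : L →ₗ[R] (ExteriorAlgebra R L × (L →ₗ[R] ExteriorAlgebra R L)) →ₗ[R]
    (L →ₗ[R] ExteriorAlgebra R L) :=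
  LinearMap.mk₂ R
    (fun m p =>
      { toFun := fun α => ExteriorAlgebra.ι R ⁅α, m⁆ * p.1 + ExteriorAlgebra.ι R m * p.2 α
        map_add' := by intro x y; simp [add_mul, mul_add]; abel
        map_smul' := by intro r x; simp })
    (by intro m m' p; ext α; simp [add_mul]; abel)
    (by intro r m p; ext α; simp)
    (by intro m p p'; ext α; simp [mul_add]; abel)
    (by intro r m p; ext α; simp)

/-- The Lie derivative `lieExt (α₁ ∧ ⋯ ∧ αₙ) α = ∑ᵢ α₁ ∧ ⋯ ∧ [α, αᵢ] ∧ ⋯ ∧ αₙ` on `⋀_R L`. -/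
def lieExt : ExteriorAlgebra R L →ₗ[R] L →ₗ[R] ExteriorAlgebra R L :=
  CliffordAlgebra.foldr' 0 (lieExtAux R L)
    (by
      intro m x fx
      ext α
      have h := ExteriorAlgebra.ι_add_mul_swap (R := R) m ⁅α, m⁆
      have h2 := ExteriorAlgebra.ι_sq_zero (R := R) m
      simp only [lieExtAux, LinearMap.mk₂_apply, LinearMap.coe_mk, AddHom.coe_mk, mul_add,
        ← mul_assoc, LinearMap.zero_apply, zero_smul, _root_.zero_apply, h2, zero_mul,
        add_zero]
      rw [← add_mul, add_comm, h, zero_mul])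
    0

variable {R L}
theorem lieExt_one (α : L) : lieExt R L 1 α = 0 := by
  have := CliffordAlgebra.foldr'_algebraMap (Q := (0 : QuadraticForm R L)) (lieExtAux R L) (by
      intro m x fx
      ext α
      have h := ExteriorAlgebra.ι_add_mul_swap (R := R) m ⁅α, m⁆
      have h2 := ExteriorAlgebra.ι_sq_zero (R := R) m
      simp only [lieExtAux, LinearMap.mk₂_apply, LinearMap.coe_mk, AddHom.coe_mk, mul_add,
        ← mul_assoc, LinearMap.zero_apply, zero_smul, _root_.zero_apply, h2, zero_mul,
        add_zero]
      rw [← add_mul, add_comm, h, zero_mul]) 0 1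
  rw [map_one] at this
  rw [lieExt, this]; simp

theorem lieExt_ι_mul (m : L) (x : ExteriorAlgebra R L) (α : L) :
    lieExt R L (ExteriorAlgebra.ι R m * x) α =
      ExteriorAlgebra.ι R ⁅α, m⁆ * x + ExteriorAlgebra.ι R m * lieExt R L x α := by
  rw [lieExt, CliffordAlgebra.foldr'_ι_mul]; rfl

end RLevel

section Descent
variable {R A L : Type u} [CommRing R] [CommRing A] [Algebra R A] [AddCommGroup L] [Module R L]
  [Module A L] [IsScalarTower R A L]

variable (R A L) in
/-- The canonical homomorphism `⋀_R L → ⋀_A L` of `R`-algebras. -/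
def extProj : ExteriorAlgebra R L →ₐ[R] ExteriorAlgebra A L :=
  ExteriorAlgebra.lift R ⟨(ExteriorAlgebra.ι A).restrictScalars R, fun m =>
    ExteriorAlgebra.ι_sq_zero m⟩

@[simp] theorem extProj_ι (m : L) :
    extProj R A L (ExteriorAlgebra.ι R m) = ExteriorAlgebra.ι A m :=
  ExteriorAlgebra.lift_ι_apply _ _ _ _

theorem extProj_ιMulti {n : ℕ} (v : Fin n → L) :
    extProj R A L (ExteriorAlgebra.ιMulti R n v) = ExteriorAlgebra.ιMulti A n v := by
  simp [ExteriorAlgebra.ιMulti_apply, map_list_prod, List.map_ofFn, Function.comp_def]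

theorem exists_ιMulti_update {n : ℕ} (v : Fin n → L) (i : Fin n) :
    ∃ x y : ExteriorAlgebra R L, ∀ m : L,
      ExteriorAlgebra.ιMulti R n (Function.update v i m) = x * ExteriorAlgebra.ι R m * y := by
  induction n with
  | zero => exact i.elim0
  | succ n ih =>
    refine Fin.cases ?_ (fun i => ?_) i
    · refine ⟨1, ExteriorAlgebra.ιMulti R n (Fin.tail v), fun m => ?_⟩
      rw [ExteriorAlgebra.ιMulti_succ_apply]
      have : Matrix.vecTail (Function.update v 0 m) = Fin.tail v := by
        ext j; simp [Matrix.vecTail, Fin.tail]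
      rw [this]; simp
    · obtain ⟨x, y, h⟩ := ih (Fin.tail v) i
      refine ⟨ExteriorAlgebra.ι R (v 0) * x, y, fun m => ?_⟩
      rw [ExteriorAlgebra.ιMulti_succ_apply]
      have : Matrix.vecTail (Function.update v i.succ m) = Function.update (Fin.tail v) i m := by
        ext j; simp [Matrix.vecTail, Fin.tail, Function.update_apply]
      rw [this, h]
      simp [mul_assoc, (Fin.succ_ne_zero i).symm]

variable {N P : Type u} [AddCommGroup N] [Module R N] [Module A N] [IsScalarTower R A N]
  [AddCommGroup P] [Module R P]

variable (R N P) in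
/-- `Hom_R(N, P)`, with the `A`-module structure `(c f)(n) = f(c n)`. -/
@[ext] structure PreHom : Type u where
  hom : N →ₗ[R] P

instance : Zero (PreHom R N P) := ⟨⟨0⟩⟩
instance : Add (PreHom R N P) := ⟨fun f g => ⟨f.hom + g.hom⟩⟩
instance : Neg (PreHom R N P) := ⟨fun f => ⟨-f.hom⟩⟩
instance : AddCommGroup (PreHom R N P) where
  add_assoc _ _ _ := PreHom.ext (add_assoc _ _ _)
  zero_add _ := PreHom.ext (zero_add _)
  add_zero _ := PreHom.ext (add_zero _)
  add_comm _ _ := PreHom.ext (add_comm _ _)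
  neg_add_cancel _ := PreHom.ext (neg_add_cancel _)
  nsmul := nsmulRec
  zsmul := zsmulRec
instance : Module A (PreHom R N P) where
  smul c f := ⟨f.hom ∘ₗ (c • LinearMap.id)⟩
  one_smul f := by
    apply PreHom.ext; apply LinearMap.ext; intro n
    change f.hom ((1 : A) • n) = f.hom n
    rw [one_smul]
  mul_smul c d f := by
    apply PreHom.ext; apply LinearMap.ext; intro n
    change f.hom ((c * d) • n) = f.hom (d • c • n)
    rw [smul_smul, mul_comm]
  smul_zero c := rfl
  smul_add c f g := rfl
  add_smul c d f := by
    apply PreHom.ext; apply LinearMap.ext; intro n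
    change f.hom ((c + d) • n) = f.hom (c • n) + f.hom (d • n)
    rw [add_smul, map_add]
  zero_smul f := by
    apply PreHom.ext; apply LinearMap.ext; intro n
    change f.hom ((0 : A) • n) = 0
    rw [zero_smul, map_zero]

/-- The balancing condition under which a map on `N ⊗_R ⋀_R L` descends to `N ⊗_A ⋀_A L`. -/
def Balanced (A : Type u) [CommRing A] [Module A L] [Module A N]
    (G : ExteriorAlgebra R L →ₗ[R] N →ₗ[R] P) : Prop :=
  ∀ (x y : ExteriorAlgebra R L) (m : L) (c : A) (n : N),
    G (x * ExteriorAlgebra.ι R (c • m) * y) n = G (x * ExteriorAlgebra.ι R m * y) (c • n)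

/-- The map `w ↦ (n ↦ G w n)` on `⋀_A L`, for balanced `G`. -/
def descendAux (G : ExteriorAlgebra R L →ₗ[R] N →ₗ[R] P) (hG : Balanced A G) :
    ExteriorAlgebra A L →ₗ[A] PreHom R N P :=
  ExteriorAlgebra.liftAlternating fun k =>
    { toFun := fun v => ⟨G (ExteriorAlgebra.ιMulti R k v)⟩
      map_update_add' := by
        intro inst v i x y
        rw [Subsingleton.elim inst (instDecidableEqFin k)]
        apply PreHom.ext
        change G _ = G _ + G _
        rw [AlternatingMap.map_update_add, map_add]
      map_update_smul' := by
        intro inst v i c x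
        rw [Subsingleton.elim inst (instDecidableEqFin k)]
        obtain ⟨a, b, h⟩ := exists_ιMulti_update (R := R) v i
        apply PreHom.ext; apply LinearMap.ext; intro n
        change G _ n = G _ (c • n)
        rw [h, h, hG]
      map_eq_zero_of_eq' := by
        intro v i j hv hij
        rw [AlternatingMap.map_eq_zero_of_eq _ v hv hij, map_zero]; rfl }

/-- The induced map on `N ⊗_A ⋀_A L`, sending `n ⊗ w` to `G w n`. -/
def descend (G : ExteriorAlgebra R L →ₗ[R] N →ₗ[R] P) (hG : Balanced A G) :
    N ⊗[A] ExteriorAlgebra A L →ₗ[R] P :=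
  let F : N ⊗[A] ExteriorAlgebra A L →+ P :=
    TensorProduct.liftAddHom
      (AddMonoidHom.mk' (fun n => AddMonoidHom.mk'
          (fun w => (descendAux G hG w).hom n)
          (fun w w' => by rw [map_add]; rfl))
        (fun n n' => by
          ext w; exact (descendAux G hG w).hom.map_add n n'))
      (fun c n w => by
        change _ = (descendAux G hG (c • w)).hom n
        rw [(descendAux G hG).map_smul]; rfl)
  { F with
    map_smul' := by
      intro r t
      change F (r • t) = r • F t
      induction t with
      | zero => simp
      | add x y hx hy => rw [smul_add, map_add, hx, hy, map_add, smul_add]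
      | tmul n w =>
        rw [TensorProduct.smul_tmul']
        exact (descendAux G hG w).hom.map_smul r n }

theorem ιMulti_induction {p : ExteriorAlgebra R L → Prop}
    (h0 : p 0) (hadd : ∀ x y, p x → p y → p (x + y)) (hsmul : ∀ (r : R) x, p x → p (r • x))
    (h : ∀ k (v : Fin k → L), p (ExteriorAlgebra.ιMulti R k v)) (x) : p x := by
  have hx : x ∈ Submodule.span R
      (Set.range fun x : Σ n, (Fin n → L) => ExteriorAlgebra.ιMulti R x.1 x.2) := by
    rw [ExteriorAlgebra.ιMulti_span]; trivial
  induction hx using Submodule.span_induction with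
  | mem x h' => obtain ⟨⟨k, v⟩, rfl⟩ := h'; exact h k v
  | zero => exact h0
  | add x y _ _ hx hy => exact hadd _ _ hx hy
  | smul r x _ hx => exact hsmul _ _ hx

theorem descend_tmul (G : ExteriorAlgebra R L →ₗ[R] N →ₗ[R] P) (hG : Balanced A G) (n : N)
    (x : ExteriorAlgebra R L) : descend G hG (n ⊗ₜ extProj R A L x) = G x n := by
  induction x using ιMulti_induction with
  | h0 => simp
  | hadd x y hx hy => rw [map_add, TensorProduct.tmul_add, map_add, hx, hy, map_add]; rfl
  | hsmul r x hx =>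
    rw [map_smul, TensorProduct.tmul_smul, map_smul, hx, map_smul]; rfl
  | h k v =>
    rw [extProj_ιMulti]
    change (descendAux G hG _).hom n = _
    rw [descendAux, ExteriorAlgebra.liftAlternating_apply_ιMulti]
    rfl

theorem tmul_induction {p : N ⊗[A] ExteriorAlgebra A L → Prop} (h0 : p 0)
    (hadd : ∀ s t, p s → p t → p (s + t))
    (h : ∀ (n : N) (x : ExteriorAlgebra R L), p (n ⊗ₜ extProj R A L x)) (t) : p t := by
  induction t with
  | zero => exact h0
  | add s t hs ht => exact hadd s t hs ht
  | tmul n w =>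
    have key : ∀ n : N, p (n ⊗ₜ w) := by
      induction w using ιMulti_induction with
      | h0 => intro n; rw [TensorProduct.tmul_zero]; exact h0
      | hadd x y hx hy => intro n; rw [TensorProduct.tmul_add]; exact hadd _ _ (hx n) (hy n)
      | hsmul r x hx => intro n; rw [← TensorProduct.smul_tmul]; exact hx _
      | h k v => intro n; rw [← extProj_ιMulti (R := R)]; exact h n _
    exact key n

end Descent

section CE
variable {R L N : Type u} [CommRing R] [LieRing L] [LieAlgebra R L]
  [AddCommGroup N] [Module R N]

theorem extR_induction {p : ExteriorAlgebra R L → Prop} (h0 : p 0)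
    (h1 : p 1) (hadd : ∀ x y, p x → p y → p (x + y)) (hsmul : ∀ (r : R) x, p x → p (r • x))
    (hι : ∀ m x, p x → p (ExteriorAlgebra.ι R m * x)) (x) : p x := by
  induction x using CliffordAlgebra.left_induction with
  | algebraMap r => rw [Algebra.algebraMap_eq_smul_one]; exact hsmul _ _ h1
  | add x y hx hy => exact hadd _ _ hx hy
  | ι_mul x m hx => exact hι _ _ hx

theorem lieExt_lie (x : ExteriorAlgebra R L) (α β : L) :
    lieExt R L x ⁅α, β⁆ = lieExt R L (lieExt R L x β) α - lieExt R L (lieExt R L x α) β := by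
  induction x using extR_induction with
  | h0 => simp
  | h1 => simp [lieExt_one]
  | hadd x y hx hy => simp only [map_add, LinearMap.add_apply, hx, hy]; abel
  | hsmul r x hx => simp only [map_smul, LinearMap.smul_apply, hx, smul_sub]
  | hι m x hx =>
    simp only [lieExt_ι_mul, map_add, LinearMap.add_apply, hx, mul_sub]
    rw [lie_lie, map_sub, sub_mul]
    abel

/-- Left multiplication by `m ∈ L` on the second factor of `N ⊗_R ⋀_R L`. -/
def ceMul (R N : Type u) {L : Type u} [CommRing R] [AddCommGroup L] [Module R L]
    [AddCommGroup N] [Module R N] :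
    L →ₗ[R] N ⊗[R] ExteriorAlgebra R L →ₗ[R] N ⊗[R] ExteriorAlgebra R L :=
  LinearMap.lTensorHom N ∘ₗ LinearMap.mul R _ ∘ₗ ExteriorAlgebra.ι R

@[simp] theorem ceMul_tmul (m : L) (n : N) (x : ExteriorAlgebra R L) :
    ceMul R N m (n ⊗ₜ x) = n ⊗ₜ (ExteriorAlgebra.ι R m * x) := rfl

/-- Input of the recursion defining `ceDiff`. -/
def ceAux (r : L →ₗ[R] N →ₗ[R] N) :
    L →ₗ[R] (ExteriorAlgebra R L × (N →ₗ[R] N ⊗[R] ExteriorAlgebra R L)) →ₗ[R]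
      (N →ₗ[R] N ⊗[R] ExteriorAlgebra R L) :=
  LinearMap.mk₂ R
    (fun m p => (TensorProduct.mk R N _).flip p.1 ∘ₗ r m
      - (TensorProduct.mk R N _).flip (lieExt R L p.1 m) - ceMul R N m ∘ₗ p.2)
    (by intro m m' p; ext n; simp [TensorProduct.add_tmul, TensorProduct.tmul_add]; abel)
    (by intro c m p; ext n
        simp [smul_sub, TensorProduct.smul_tmul])
    (by intro m p p'; ext n; simp [TensorProduct.tmul_add]; abel)
    (by intro c m p; ext n; simp [smul_sub])

theorem ceAux_ceAux (r : L →ₗ[R] N →ₗ[R] N) (m : L) (x : ExteriorAlgebra R L)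
    (T : N →ₗ[R] N ⊗[R] ExteriorAlgebra R L) :
    ceAux r m (ExteriorAlgebra.ι R m * x, ceAux r m (x, T)) = 0 := by
  have h2 := ExteriorAlgebra.ι_sq_zero (R := R) m
  have h3 : ∀ t, ceMul R N m (ceMul R N m t) = 0 := by
    intro t
    induction t with
    | zero => simp
    | add s t hs ht => simp [hs, ht]
    | tmul n x => simp [← mul_assoc, h2]
  ext n
  simp [ceAux, lieExt_ι_mul, h3]

/-- The Chevalley--Eilenberg operator of a right module `N` (`r α n = n α`) over the Lie
algebra `L`, given by `d(n ⊗ 1) = 0` and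
`d(n ⊗ α ∧ x) = nα ⊗ x - n ⊗ L_α x - α ∧ d(n ⊗ x)`. -/
def ceDiff (r : L →ₗ[R] N →ₗ[R] N) :
    ExteriorAlgebra R L →ₗ[R] N →ₗ[R] N ⊗[R] ExteriorAlgebra R L :=
  CliffordAlgebra.foldr' 0 (ceAux r)
    (by intro m x T; simpa using ceAux_ceAux r m x T) 0

theorem ceDiff_one (r : L →ₗ[R] N →ₗ[R] N) (n : N) : ceDiff r 1 n = 0 := by
  have := CliffordAlgebra.foldr'_algebraMap (Q := (0 : QuadraticForm R L)) (ceAux r)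
    (by intro m x T; simpa using ceAux_ceAux r m x T) 0 1
  rw [map_one] at this
  rw [ceDiff, this]; simp

theorem ceDiff_ι_mul (r : L →ₗ[R] N →ₗ[R] N) (m : L) (x : ExteriorAlgebra R L) (n : N) :
    ceDiff r (ExteriorAlgebra.ι R m * x) n =
      r m n ⊗ₜ x - n ⊗ₜ lieExt R L x m - ceMul R N m (ceDiff r x n) := by
  rw [ceDiff, CliffordAlgebra.foldr'_ι_mul]; rfl

/-- `ceDiff` as an endomorphism. -/
def ceTot (r : L →ₗ[R] N →ₗ[R] N) :
    N ⊗[R] ExteriorAlgebra R L →ₗ[R] N ⊗[R] ExteriorAlgebra R L :=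
  TensorProduct.lift (ceDiff r).flip

@[simp] theorem ceTot_tmul (r : L →ₗ[R] N →ₗ[R] N) (n : N) (x : ExteriorAlgebra R L) :
    ceTot r (n ⊗ₜ x) = ceDiff r x n := rfl

/-- The Lie derivative `n ⊗ x ↦ n α ⊗ x - n ⊗ L_α x`. -/
def ceLie (r : L →ₗ[R] N →ₗ[R] N) (α : L) :
    N ⊗[R] ExteriorAlgebra R L →ₗ[R] N ⊗[R] ExteriorAlgebra R L :=
  (r α).rTensor _ - ((lieExt R L).flip α).lTensor N

@[simp] theorem ceLie_tmul (r : L →ₗ[R] N →ₗ[R] N) (α : L) (n : N) (x : ExteriorAlgebra R L) :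
    ceLie r α (n ⊗ₜ x) = r α n ⊗ₜ x - n ⊗ₜ lieExt R L x α := rfl

theorem ceTot_ceMul (r : L →ₗ[R] N →ₗ[R] N) (m : L) (t : N ⊗[R] ExteriorAlgebra R L) :
    ceTot r (ceMul R N m t) = ceLie r m t - ceMul R N m (ceTot r t) := by
  induction t with
  | zero => simp
  | add s t hs ht => simp only [map_add, hs, ht]; abel
  | tmul n x => simp [ceDiff_ι_mul]

theorem ceLie_ceMul (r : L →ₗ[R] N →ₗ[R] N) (α m : L) (t : N ⊗[R] ExteriorAlgebra R L) :
    ceLie r α (ceMul R N m t) = ceMul R N m (ceLie r α t) - ceMul R N ⁅α, m⁆ t := by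
  induction t with
  | zero => simp
  | add s t hs ht => simp only [map_add, hs, ht]; abel
  | tmul n x => simp [lieExt_ι_mul, TensorProduct.tmul_add]; abel

theorem ceLie_lie (r : L →ₗ[R] N →ₗ[R] N) 
    (hr : ∀ α β n, r ⁅α, β⁆ n = r β (r α n) - r α (r β n)) (α β : L)
    (t : N ⊗[R] ExteriorAlgebra R L) :
    ceLie r ⁅α, β⁆ t = ceLie r β (ceLie r α t) - ceLie r α (ceLie r β t) := by
  induction t with
  | zero => simp
  | add s t hs ht => simp only [map_add, hs, ht]; abel
  | tmul n x =>
    simp only [ceLie_tmul, map_sub, hr, lieExt_lie, TensorProduct.sub_tmul, TensorProduct.tmul_sub]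
    abel

theorem ceTot_ceLie (r : L →ₗ[R] N →ₗ[R] N)
    (hr : ∀ α β n, r ⁅α, β⁆ n = r β (r α n) - r α (r β n)) (α : L) (n : N)
    (x : ExteriorAlgebra R L) :
    ceTot r (ceLie r α (n ⊗ₜ x)) = ceLie r α (ceTot r (n ⊗ₜ x)) := by
  induction x using extR_induction with
  | h0 => simp
  | h1 => simp [ceDiff_one, lieExt_one]
  | hadd x y hx hy => simp only [TensorProduct.tmul_add, map_add, hx, hy]
  | hsmul c x hx => simp only [TensorProduct.tmul_smul, map_smul, hx]
  | hι m x hx =>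
    rw [← ceMul_tmul, ceLie_ceMul, map_sub, ceTot_ceMul, ceTot_ceMul, ceTot_ceMul, hx, map_sub,
      ceLie_ceMul, ceLie_lie r hr]
    abel

theorem ceTot_ceTot (r : L →ₗ[R] N →ₗ[R] N)
    (hr : ∀ α β n, r ⁅α, β⁆ n = r β (r α n) - r α (r β n)) (t : N ⊗[R] ExteriorAlgebra R L) :
    ceTot r (ceTot r t) = 0 := by
  induction t with
  | zero => simp
  | add s t hs ht => simp [hs, ht]
  | tmul n x =>
    induction x using extR_induction with
    | h0 => simp
    | h1 => simp [ceDiff_one]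
    | hadd x y hx hy => simp only [TensorProduct.tmul_add, map_add, hx, hy, add_zero]
    | hsmul c x hx => simp only [TensorProduct.tmul_smul, map_smul, hx, smul_zero]
    | hι m x hx =>
      rw [← ceMul_tmul, ceTot_ceMul, map_sub, ceTot_ceMul, ceTot_ceLie r hr, hx]
      simp

end CE

section Rinehart
variable {R A L : Type u} [CommRing R] [CommRing A] [Algebra R A] [LieRing L] [LieAlgebra R L]
  [Module A L] [LieRingModule L A] [LieRinehartRing A L] [LieRinehartAlgebra R A L]

variable (L) in
/-- The differential `dc : L → A`, `β ↦ β(c)`. -/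
def dForm (c : A) : Module.Dual A L where
  toFun β := ⁅β, c⁆
  map_add' := by intro x y; simp
  map_smul' := by intro a x; simp

theorem extProj_lieExt_smul (x y : ExteriorAlgebra R L) (m : L) (c : A) (α : L) :
    extProj R A L (lieExt R L (x * ExteriorAlgebra.ι R (c • m) * y) α) =
      c • extProj R A L (lieExt R L (x * ExteriorAlgebra.ι R m * y) α) +
      ⁅α, c⁆ • extProj R A L (x * ExteriorAlgebra.ι R m * y) := by
  induction x using extR_induction with
  | h0 => simp
  | h1 => 
    simp only [one_mul, lieExt_ι_mul, map_add, map_mul, extProj_ι, LieRinehartRing.leibniz_smul_right,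
      map_smul, add_mul, smul_add, smul_mul_assoc]
    abel
  | hadd x y hx hy => simp only [add_mul, map_add, LinearMap.add_apply, hx, hy, smul_add]; abel
  | hsmul r x hx =>
    simp only [smul_mul_assoc, map_smul, LinearMap.smul_apply, hx, smul_add, smul_comm r]
  | hι k x hx =>
    have e : ∀ z, ExteriorAlgebra.ι R k * x * z * y = ExteriorAlgebra.ι R k * (x * z * y) := by
      intro z; simp only [mul_assoc]
    simp only [e, lieExt_ι_mul, map_add, map_mul (extProj R A L) (ExteriorAlgebra.ι R _), hx, mul_add, mul_smul_comm, smul_add]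
    simp only [map_mul, extProj_ι, map_smul, mul_smul_comm, smul_mul_assoc]
    abel

theorem extProj_lieExt_smul' (y : ExteriorAlgebra R L) (c : A) (α : L) :
    extProj R A L (lieExt R L y (c • α)) =
      c • extProj R A L (lieExt R L y α) -
        ExteriorAlgebra.ι A α * CliffordAlgebra.contractLeft (dForm L c) (extProj R A L y) := by
  induction y using extR_induction with
  | h0 => simp
  | h1 => simp [lieExt_one]
  | hadd x y hx hy => simp only [map_add, LinearMap.add_apply, hx, hy, smul_add, mul_add]; abel
  | hsmul r x hx =>
    have : ∀ z : ExteriorAlgebra A L, r • z = algebraMap R A r • z := fun z => by simp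
    simp only [map_smul, LinearMap.smul_apply, hx, smul_sub, this, mul_smul_comm, smul_comm c]
  | hι k x hx =>
    have h := eq_neg_of_add_eq_zero_left (ExteriorAlgebra.ι_add_mul_swap (R := A) k α)
    have hl : ⁅c • α, k⁆ = c • ⁅α, k⁆ - ⁅k, c⁆ • α := by
      rw [← lie_skew, LieRinehartRing.leibniz_smul_right, ← lie_skew α k, smul_neg]; abel
    simp only [lieExt_ι_mul, map_add, map_mul, extProj_ι, hx, hl, map_sub, map_smul,
      CliffordAlgebra.contractLeft_ι_mul, mul_sub, smul_add, sub_mul, smul_mul_assoc,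
      mul_smul_comm, ← mul_assoc, h, neg_mul]
    simp only [dForm, LinearMap.coe_mk, AddHom.coe_mk]
    abel

variable {N : Type u} [AddCommGroup N] [Module R N] [Module A N] [IsScalarTower R A N]

variable (R A L N) in
/-- The canonical map `N ⊗_R ⋀_R L → N ⊗_A ⋀_A L`. -/
def tensProj : N ⊗[R] ExteriorAlgebra R L →ₗ[R] N ⊗[A] ExteriorAlgebra A L :=
  TensorProduct.lift (LinearMap.mk₂ R (fun n x => n ⊗ₜ extProj R A L x)
    (by intros; rw [TensorProduct.add_tmul]) (by intros; rfl)
    (by intros; rw [map_add, TensorProduct.tmul_add])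
    (by intros; rw [map_smul, TensorProduct.tmul_smul]))

@[simp] theorem tensProj_tmul (n : N) (x : ExteriorAlgebra R L) :
    tensProj R A L N (n ⊗ₜ x) = n ⊗ₜ extProj R A L x := rfl

variable (A N) in
/-- Left multiplication by `m ∈ L` on the second factor of `N ⊗_A ⋀_A L`. -/
def wedgeL (m : L) : N ⊗[A] ExteriorAlgebra A L →ₗ[A] N ⊗[A] ExteriorAlgebra A L :=
  (LinearMap.mulLeft A (ExteriorAlgebra.ι A m)).lTensor N

@[simp] theorem wedgeL_tmul (m : L) (n : N) (x : ExteriorAlgebra A L) :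
    wedgeL A N m (n ⊗ₜ x) = n ⊗ₜ (ExteriorAlgebra.ι A m * x) := rfl

theorem tensProj_ceMul (m : L) (t : N ⊗[R] ExteriorAlgebra R L) :
    tensProj R A L N (ceMul R N m t) = wedgeL A N m (tensProj R A L N t) := by
  induction t with
  | zero => simp
  | add s t hs ht => simp [hs, ht]
  | tmul n x => simp

theorem tensProj_ceDiff_smul (r : L →ₗ[R] N →ₗ[R] N)
    (h1 : ∀ α (c : A) n, r α (c • n) = c • r α n - ⁅α, c⁆ • n)
    (y : ExteriorAlgebra R L) (c : A) (n : N) :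
    tensProj R A L N (ceDiff r y (c • n)) = c • tensProj R A L N (ceDiff r y n) -
      n ⊗ₜ CliffordAlgebra.contractLeft (dForm L c) (extProj R A L y) := by
  induction y using extR_induction with
  | h0 => simp
  | h1 => simp [ceDiff_one]
  | hadd x y hx hy =>
    simp only [map_add, LinearMap.add_apply, hx, hy, smul_add, TensorProduct.tmul_add]; abel
  | hsmul r x hx =>
    have : ∀ z : ExteriorAlgebra A L, r • z = algebraMap R A r • z := fun z => by simp
    simp only [map_smul, LinearMap.smul_apply, hx, smul_sub, TensorProduct.tmul_smul, smul_comm c,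
      this]
    simp
  | hι k x hx =>
    simp only [ceDiff_ι_mul, map_sub, tensProj_tmul, h1, tensProj_ceMul, hx, map_mul, extProj_ι,
      CliffordAlgebra.contractLeft_ι_mul, TensorProduct.sub_tmul, TensorProduct.tmul_sub, map_smul,
      smul_sub, wedgeL_tmul, TensorProduct.smul_tmul', TensorProduct.tmul_smul]
    simp only [dForm, LinearMap.coe_mk, AddHom.coe_mk]
    abel

theorem balanced_ceDiff (r : L →ₗ[R] N →ₗ[R] N)
    (h1 : ∀ α (c : A) n, r α (c • n) = c • r α n - ⁅α, c⁆ • n)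
    (h2 : ∀ α (c : A) n, r (c • α) n = r α (c • n)) :
    Balanced A ((tensProj R A L N).compRight R ∘ₗ ceDiff r) := by
  intro x y m c n
  simp only [LinearMap.comp_apply, LinearMap.compRight_apply]
  induction x using extR_induction generalizing n with
  | h0 => simp
  | h1 =>
    simp only [one_mul, ceDiff_ι_mul, map_sub, tensProj_tmul, tensProj_ceMul,
      extProj_lieExt_smul', tensProj_ceDiff_smul r h1, h2, TensorProduct.tmul_sub,
      TensorProduct.tmul_smul, wedgeL_tmul, TensorProduct.smul_tmul', map_smul]
    have : wedgeL A N (c • m) (tensProj R A L N (ceDiff r y n)) =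
        c • wedgeL A N m (tensProj R A L N (ceDiff r y n)) := by
      generalize tensProj R A L N (ceDiff r y n) = t
      induction t with
      | zero => simp
      | add s t hs ht => simp [hs, ht]
      | tmul n x => simp
    rw [this]
    abel
  | hadd x y hx hy => simp only [add_mul, map_add, LinearMap.add_apply, hx, hy]
  | hsmul r x hx => simp only [smul_mul_assoc, map_smul, LinearMap.smul_apply, hx]
  | hι k x hx =>
    have e : ∀ z, ExteriorAlgebra.ι R k * x * z * y = ExteriorAlgebra.ι R k * (x * z * y) := by
      intro z; simp only [mul_assoc]
    simp only [e, ceDiff_ι_mul, map_sub, tensProj_tmul, tensProj_ceMul, hx, extProj_lieExt_smul,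
      h1, TensorProduct.sub_tmul, TensorProduct.tmul_add]
    simp only [map_mul, extProj_ι, map_smul, mul_smul_comm, smul_mul_assoc,
      TensorProduct.tmul_smul, TensorProduct.smul_tmul']
    abel

/-- The operator on `N ⊗_A ⋀_A L` induced by a right `(A, L)`-connection `r` on `N`. -/
def connDiff (r : L →ₗ[R] N →ₗ[R] N)
    (h1 : ∀ α (c : A) n, r α (c • n) = c • r α n - ⁅α, c⁆ • n)
    (h2 : ∀ α (c : A) n, r (c • α) n = r α (c • n)) :
    N ⊗[A] ExteriorAlgebra A L →ₗ[R] N ⊗[A] ExteriorAlgebra A L :=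
  descend _ (balanced_ceDiff r h1 h2)

end Rinehart

/-- An `A`-algebra `B` with an action of `L` by derivations, such that the action is `A`-linear in
`L` and the structure map `A → B` is a homomorphism of left `(A, L)`-modules. -/
class LAlgebra (A L B : Type u) [CommRing A] [LieRing L] [Module A L] [LieRingModule L A]
    [Ring B] [Algebra A B] [LieRingModule L B] : Prop where
  lie_mul : ∀ (α : L) (x y : B), ⁅α, x * y⁆ = ⁅α, x⁆ * y + x * ⁅α, y⁆
  lie_algebraMap : ∀ (α : L) (a : A), ⁅α, algebraMap A B a⁆ = algebraMap A B ⁅α, a⁆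
  smul_lie : ∀ (a : A) (α : L) (x : B), ⁅a • α, x⁆ = a • ⁅α, x⁆

section Bracket
variable {R A L B : Type u} [CommRing R] [CommRing A] [Algebra R A] [LieRing L] [LieAlgebra R L]
  [Module A L] [LieRingModule L A] [LieRinehartRing A L] [LieRinehartAlgebra R A L]
  [Ring B] [Algebra A B] [Algebra R B] [IsScalarTower R A B] [LieRingModule L B] [LieModule R L B]
  [LAlgebra A L B]

theorem lie_smul_B (α : L) (c : A) (b : B) : ⁅α, c • b⁆ = ⁅α, c⁆ • b + c • ⁅α, b⁆ := by
  rw [Algebra.smul_def, LAlgebra.lie_mul (A := A), LAlgebra.lie_algebraMap, ← Algebra.smul_def,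
    ← Algebra.smul_def]

/-- Input for `lieE`. -/
def lieEAux (R A : Type u) {L : Type u} (B : Type u) [CommRing R] [CommRing A] [Algebra R A] [LieRing L] [LieAlgebra R L]
  [Module A L] [LieRingModule L A] [LieRinehartRing A L] [LieRinehartAlgebra R A L]
  [Ring B] [Algebra A B] [Algebra R B] [IsScalarTower R A B] [LieRingModule L B] [LieModule R L B]
   (α : L) :
    ExteriorAlgebra R L →ₗ[R] B →ₗ[R] B ⊗[A] ExteriorAlgebra A L :=
  LinearMap.mk₂ R
    (fun x b => ⁅α, b⁆ ⊗ₜ extProj R A L x + b ⊗ₜ extProj R A L (lieExt R L x α))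
    (by intro x y b; simp only [map_add, LinearMap.add_apply, TensorProduct.tmul_add]; abel)
    (by intro r x b
        simp only [map_smul, LinearMap.smul_apply, TensorProduct.tmul_smul, smul_add])
    (by intro x b b'; simp only [lie_add, TensorProduct.add_tmul]; abel)
    (by intro r x b
        simp only [lie_smul, ← TensorProduct.smul_tmul', smul_add])

theorem balanced_lieEAux (α : L) : Balanced A (lieEAux R A B α) := by
  intro x y m c b
  simp only [lieEAux, LinearMap.mk₂_apply, extProj_lieExt_smul, lie_smul_B]
  simp only [map_mul, extProj_ι, map_smul, mul_smul_comm, smul_mul_assoc, TensorProduct.tmul_add,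
    TensorProduct.add_tmul, TensorProduct.tmul_smul, TensorProduct.smul_tmul']
  abel

variable (R A L B) in
/-- The derivation of `B ⊗_A ⋀_A L` induced by `α ∈ L` -/
def lieE : L →ₗ[R] B ⊗[A] ExteriorAlgebra A L →ₗ[R] B ⊗[A] ExteriorAlgebra A L where
  toFun α := descend _ (balanced_lieEAux α)
  map_add' α β := by
    refine LinearMap.ext fun t => ?_
    refine tmul_induction (R := R) (p := fun t => _ = _) (by simp)
      (fun s t hs ht => by rw [map_add, map_add, hs, ht]) (fun b x => ?_) t
    ·
      rw [LinearMap.add_apply, descend_tmul, descend_tmul, descend_tmul]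
      simp only [lieEAux, LinearMap.mk₂_apply, add_lie, map_add, TensorProduct.add_tmul,
        TensorProduct.tmul_add]
      abel
  map_smul' r α := by
    refine LinearMap.ext fun t => ?_
    refine tmul_induction (R := R) (p := fun t => _ = _) (by simp)
      (fun s t hs ht => by rw [map_add, map_add, hs, ht]) (fun b x => ?_) t
    ·
      rw [LinearMap.smul_apply, descend_tmul, descend_tmul]
      simp only [lieEAux, LinearMap.mk₂_apply, smul_lie, map_smul, TensorProduct.smul_tmul',
        TensorProduct.tmul_smul, RingHom.id_apply, smul_add]

theorem lieE_tmul (α : L) (b : B) (x : ExteriorAlgebra R L) :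
    lieE R A L B α (b ⊗ₜ extProj R A L x) =
      ⁅α, b⁆ ⊗ₜ extProj R A L x + b ⊗ₜ extProj R A L (lieExt R L x α) :=
  descend_tmul _ _ _ _

/-- Input for `contrForm`. -/
def contrAux (R A L B : Type u) [CommRing R] [CommRing A] [Algebra R A] [LieRing L] [LieAlgebra R L]
  [Module A L] [LieRingModule L A] [LieRinehartRing A L] [LieRinehartAlgebra R A L]
  [Ring B] [Algebra A B] [Algebra R B] [IsScalarTower R A B] [LieRingModule L B] [LieModule R L B]
  [LAlgebra A L B] :
    L →ₗ[A] (ExteriorAlgebra A L × (B →ₗ[R] B ⊗[A] ExteriorAlgebra A L)) →ₗ[A]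
      (B →ₗ[R] B ⊗[A] ExteriorAlgebra A L) :=
  LinearMap.mk₂ A
    (fun m p =>
      { toFun := fun a => ⁅m, a⁆ ⊗ₜ p.1 - wedgeL A B m (p.2 a)
        map_add' := by
          intro a a'; simp only [lie_add, TensorProduct.add_tmul, map_add]; abel
        map_smul' := by
          intro r a
          have : ∀ z : B ⊗[A] ExteriorAlgebra A L, r • z = algebraMap R A r • z := fun z => by simp
          simp only [lie_smul, map_smul, ← TensorProduct.smul_tmul', smul_sub, this,
            RingHom.id_apply] })
    (by
      intro m m' p; ext a
      have : ∀ t, wedgeL A B (m + m') t = wedgeL A B m t + wedgeL A B m' t := by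
        intro t
        induction t with
        | zero => simp
        | add s t hs ht => simp only [map_add, hs, ht]; abel
        | tmul n x => simp [add_mul, TensorProduct.tmul_add]
      simp [add_lie, TensorProduct.add_tmul, this]; abel)
    (by
      intro c m p; ext a
      have : ∀ t, wedgeL A B (c • m) t = c • wedgeL A B m t := by
        intro t
        induction t with
        | zero => simp
        | add s t hs ht => simp only [map_add, hs, ht, smul_add]
        | tmul n x => simp
      simp [LAlgebra.smul_lie, TensorProduct.smul_tmul', this, smul_sub])
    (by intro m p p'; ext a; simp [TensorProduct.tmul_add]; abel)
    (by intro c m p; ext a; simp [smul_sub])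

theorem contrAux_contrAux (m : L) (x : ExteriorAlgebra A L)
    (T : B →ₗ[R] B ⊗[A] ExteriorAlgebra A L) :
    contrAux R A L B m (ExteriorAlgebra.ι A m * x, contrAux R A L B m (x, T)) = 0 := by
  have h2 := ExteriorAlgebra.ι_sq_zero (R := A) m
  have h3 : ∀ t, wedgeL A B m (wedgeL A B m t) = 0 := by
    intro t
    induction t with
    | zero => simp
    | add s t hs ht => simp [hs, ht]
    | tmul n x => simp [← mul_assoc, h2]
  ext a
  simp [contrAux, h3]

variable (R A L B) in
/-- `contrForm (α₁ ∧ ⋯ ∧ αₙ) a = ∑ₖ (-1)^(k-1) αₖ(a) ⊗ (α₁ ∧ ⋯ α̂ₖ ⋯ ∧ αₙ)`. -/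
def contrForm : ExteriorAlgebra A L →ₗ[A] B →ₗ[R] B ⊗[A] ExteriorAlgebra A L :=
  CliffordAlgebra.foldr' 0 (contrAux R A L B)
    (by intro m x T; simpa using contrAux_contrAux m x T) 0

theorem contrForm_one (a : B) : contrForm R A L B 1 a = 0 := by
  have := CliffordAlgebra.foldr'_algebraMap (Q := (0 : QuadraticForm A L)) (contrAux R A L B)
    (by intro m x T; simpa using contrAux_contrAux m x T) 0 1
  rw [map_one] at this
  rw [contrForm, this]; simp

theorem contrForm_ι_mul (m : L) (x : ExteriorAlgebra A L) (a : B) :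
    contrForm R A L B (ExteriorAlgebra.ι A m * x) a =
      ⁅m, a⁆ ⊗ₜ x - wedgeL A B m (contrForm R A L B x a) := by
  rw [contrForm, CliffordAlgebra.foldr'_ι_mul]; rfl

/-- `[a, b ⊗ v]` without signs: `brFunAt a (b ⊗ v) = ∑ₖ (-1)^k βₖ(a) b ⊗ (β₁ ∧ ⋯ β̂ₖ ⋯ ∧ βₘ)` for `v = β₁ ∧ ⋯ ∧ βₘ`. -/
def brFunAt (R A L : Type u) {B : Type u} [CommRing R] [CommRing A] [Algebra R A] [LieRing L]
    [LieAlgebra R L] [Module A L] [LieRingModule L A] [LieRinehartRing A L]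
    [LieRinehartAlgebra R A L] [Ring B] [Algebra A B] [Algebra R B] [IsScalarTower R A B]
    [LieRingModule L B] [LieModule R L B] [LAlgebra A L B] (a : B) :
    B ⊗[A] ExteriorAlgebra A L →ₗ[A] B ⊗[A] ExteriorAlgebra A L :=
  TensorProduct.lift (LinearMap.mk₂ A
    (fun b v => -(contrForm R A L B v a * b ⊗ₜ[A] (1 : ExteriorAlgebra A L)))
    (by intro b b' v; rw [TensorProduct.add_tmul, mul_add, neg_add])
    (by intro c b v; rw [← TensorProduct.smul_tmul', mul_smul_comm, smul_neg])
    (by intro b v v'; rw [map_add, LinearMap.add_apply, add_mul, neg_add])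
    (by intro c b v; rw [map_smul, LinearMap.smul_apply, smul_mul_assoc, smul_neg]))

theorem brFunAt_tmul (a b : B) (v : ExteriorAlgebra A L) :
    brFunAt R A L a (b ⊗ₜ v) = -(contrForm R A L B v a * b ⊗ₜ 1) := rfl

variable (R A L B) in
/-- `brFunAt`, linear in both arguments. -/
def brFun : B →ₗ[R] B ⊗[A] ExteriorAlgebra A L →ₗ[R] B ⊗[A] ExteriorAlgebra A L where
  toFun a := (brFunAt R A L a).restrictScalars R
  map_add' a a' := by
    refine LinearMap.ext fun t => ?_
    induction t with
    | zero => simp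
    | add s t hs ht => rw [map_add, map_add, hs, ht]
    | tmul b v =>
      simp only [LinearMap.restrictScalars_apply, LinearMap.add_apply, brFunAt_tmul, map_add,
        add_mul, neg_add]
  map_smul' r a := by
    refine LinearMap.ext fun t => ?_
    induction t with
    | zero => simp
    | add s t hs ht => rw [map_add, map_add, hs, ht]
    | tmul b v =>
      simp only [LinearMap.restrictScalars_apply, LinearMap.smul_apply, brFunAt_tmul, map_smul,
        smul_mul_assoc, smul_neg, RingHom.id_apply]

theorem brFun_tmul (a b : B) (v : ExteriorAlgebra A L) :
    brFun R A L B a (b ⊗ₜ v) = -(contrForm R A L B v a * b ⊗ₜ 1) := rfl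

/-- Input for `brExt`. -/
def brExtAux (R A L B : Type u) [CommRing R] [CommRing A] [Algebra R A] [LieRing L] [LieAlgebra R L]
  [Module A L] [LieRingModule L A] [LieRinehartRing A L] [LieRinehartAlgebra R A L]
  [Ring B] [Algebra A B] [Algebra R B] [IsScalarTower R A B] [LieRingModule L B] [LieModule R L B]
  [LAlgebra A L B] :
    L →ₗ[R] (ExteriorAlgebra R L × Module.End R (B ⊗[A] ExteriorAlgebra A L)) →ₗ[R]
      Module.End R (B ⊗[A] ExteriorAlgebra A L) :=
  LinearMap.mk₂ R
    (fun m p => LinearMap.mulLeft R (1 ⊗ₜ ExteriorAlgebra.ι A m) * p.2 +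
      LinearMap.mulLeft R (1 ⊗ₜ extProj R A L (CliffordAlgebra.involute p.1)) * lieE R A L B m)
    (by intro m m' p; ext1 t; simp [TensorProduct.tmul_add, add_mul, mul_add]; abel)
    (by intro c m p; ext1 t; simp [TensorProduct.tmul_smul])
    (by intro m p p'; ext1 t; simp [TensorProduct.tmul_add, add_mul, mul_add]; abel)
    (by intro c m p; ext1 t; simp [TensorProduct.tmul_smul])

theorem brExtAux_brExtAux (m : L) (x : ExteriorAlgebra R L)
    (T : Module.End R (B ⊗[A] ExteriorAlgebra A L)) :
    brExtAux R A L B m (ExteriorAlgebra.ι R m * x, brExtAux R A L B m (x, T)) = 0 := by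
  have h2 := ExteriorAlgebra.ι_sq_zero (R := A) m
  ext1 t
  simp only [brExtAux, LinearMap.mk₂_apply, map_mul, CliffordAlgebra.involute_ι, extProj_ι,
    map_neg, neg_mul, TensorProduct.tmul_neg, mul_add, LinearMap.add_apply, Module.End.mul_apply,
    LinearMap.mulLeft_apply, ← mul_assoc, Algebra.TensorProduct.tmul_mul_tmul, h2, mul_one,
    TensorProduct.tmul_zero, zero_mul, zero_add, LinearMap.zero_apply]
  exact add_neg_cancel _

variable (R A L B) in
/-- The operator `[u, ·]` for `u = α₁ ∧ ⋯ ∧ αₗ`, without the signs coming from the degrees of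
elements of `B`: `brExt 1 = 0` and `brExt (α ∧ x) = α ∧ brExt x + (-1)^|x| x ∧ lieE α`. -/
def brExt : ExteriorAlgebra R L →ₗ[R] Module.End R (B ⊗[A] ExteriorAlgebra A L) :=
  CliffordAlgebra.foldr' 0 (brExtAux R A L B)
    (by intro m x T; simpa using brExtAux_brExtAux m x T) 0

theorem brExt_one : brExt R A L B 1 = 0 := by
  have := CliffordAlgebra.foldr'_algebraMap (Q := (0 : QuadraticForm R L)) (brExtAux R A L B)
    (by intro m x T; simpa using brExtAux_brExtAux m x T) 0 1
  rw [map_one] at this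
  rw [brExt, this]; simp

theorem brExt_ι_mul (m : L) (x : ExteriorAlgebra R L) (t : B ⊗[A] ExteriorAlgebra A L) :
    brExt R A L B (ExteriorAlgebra.ι R m * x) t =
      (1 ⊗ₜ ExteriorAlgebra.ι A m) * brExt R A L B x t +
        (1 ⊗ₜ extProj R A L (CliffordAlgebra.involute x)) * lieE R A L B m t := by
  rw [brExt, CliffordAlgebra.foldr'_ι_mul]; rfl

theorem contrForm_smul (v : ExteriorAlgebra A L) (c : A) (a : B) :
    contrForm R A L B v (c • a) = c • contrForm R A L B v a +
      a ⊗ₜ CliffordAlgebra.contractLeft (dForm L c) v := by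
  induction v using CliffordAlgebra.left_induction with
  | algebraMap r => rw [Algebra.algebraMap_eq_smul_one]; simp [contrForm_one]
  | add x y hx hy =>
    simp only [map_add, LinearMap.add_apply, hx, hy, smul_add, TensorProduct.tmul_add]; abel
  | ι_mul x m hx =>
    simp only [contrForm_ι_mul, hx, lie_smul_B, map_add, map_smul, wedgeL_tmul,
      CliffordAlgebra.contractLeft_ι_mul, TensorProduct.add_tmul, TensorProduct.tmul_sub,
      TensorProduct.tmul_smul, smul_sub, TensorProduct.smul_tmul']
    simp only [dForm, LinearMap.coe_mk, AddHom.coe_mk]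
    abel

theorem brFun_smul (c : A) (a : B) (t : B ⊗[A] ExteriorAlgebra A L) :
    brFun R A L B (c • a) t = c • brFun R A L B a t +
      (a ⊗ₜ 1) * brFun R A L B (algebraMap A B c) t := by
  induction t with
  | zero => simp
  | add s t hs ht => simp only [map_add, hs, ht, smul_add, mul_add]; abel
  | tmul b v =>
    have h : contrForm R A L B v (algebraMap A B c) =
        1 ⊗ₜ CliffordAlgebra.contractLeft (dForm L c) v := by
      have h1 : contrForm R A L B v 1 = 0 := by
        have hl : ∀ m : L, ⁅m, (1 : B)⁆ = 0 := by
          intro m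
          have := LAlgebra.lie_mul (A := A) m (1 : B) 1
          simpa using this
        induction v using CliffordAlgebra.left_induction with
        | algebraMap r => rw [Algebra.algebraMap_eq_smul_one]; simp [contrForm_one]
        | add x y hx hy => simp only [map_add, LinearMap.add_apply, hx, hy, add_zero]
        | ι_mul x m hx => simp [contrForm_ι_mul, hx, hl]
      rw [Algebra.algebraMap_eq_smul_one, contrForm_smul, h1]; simp
    simp only [brFun_tmul, contrForm_smul, h, add_mul, mul_neg, ← mul_assoc, neg_add, smul_neg,
      smul_mul_assoc, Algebra.TensorProduct.tmul_mul_tmul, one_mul, mul_one]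

theorem extProj_involute_mul (x : ExteriorAlgebra R L) (α : L) :
    extProj R A L (CliffordAlgebra.involute x) * ExteriorAlgebra.ι A α =
      ExteriorAlgebra.ι A α * extProj R A L x := by
  induction x using extR_induction with
  | h0 => simp
  | h1 => simp
  | hadd x y hx hy => simp only [map_add, add_mul, mul_add, hx, hy]
  | hsmul r x hx => simp only [map_smul, smul_mul_assoc, mul_smul_comm, hx]
  | hι m x hx =>
    have h := eq_neg_of_add_eq_zero_left (ExteriorAlgebra.ι_add_mul_swap (R := A) m α)
    simp only [map_mul, CliffordAlgebra.involute_ι, map_neg, extProj_ι, neg_mul, mul_assoc, hx]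
    rw [← mul_assoc, h, neg_mul, neg_neg, mul_assoc]

theorem lieE_smul (c : A) (α : L) (t : B ⊗[A] ExteriorAlgebra A L) :
    lieE R A L B (c • α) t = c • lieE R A L B α t +
      (1 ⊗ₜ ExteriorAlgebra.ι A α) * brFun R A L B (algebraMap A B c) t := by
  refine tmul_induction (R := R) (p := fun t => lieE R A L B (c • α) t = c • lieE R A L B α t +
      (1 ⊗ₜ ExteriorAlgebra.ι A α) * brFun R A L B (algebraMap A B c) t) (by simp)
    (fun s t hs ht => by simp only [map_add, hs, ht, smul_add, mul_add]; abel) (fun b x => ?_) t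
  have h1 : ∀ v : ExteriorAlgebra A L, contrForm R A L B v 1 = 0 := by
    intro v
    have hl : ∀ m : L, ⁅m, (1 : B)⁆ = 0 := by
      intro m
      have := LAlgebra.lie_mul (A := A) m (1 : B) 1
      simpa using this
    induction v using CliffordAlgebra.left_induction with
    | algebraMap r => rw [Algebra.algebraMap_eq_smul_one]; simp [contrForm_one]
    | add x y hx hy => simp only [map_add, LinearMap.add_apply, hx, hy, add_zero]
    | ι_mul x m hx => simp [contrForm_ι_mul, hx, hl]
  rw [lieE_tmul, lieE_tmul, brFun_tmul, Algebra.algebraMap_eq_smul_one, contrForm_smul, h1,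
    extProj_lieExt_smul', LAlgebra.smul_lie]
  simp only [smul_zero, zero_add, mul_neg, Algebra.TensorProduct.tmul_mul_tmul, one_mul, mul_one,
    TensorProduct.tmul_sub, TensorProduct.tmul_smul, smul_add, TensorProduct.smul_tmul']
  abel

theorem brExt_smul (x y : ExteriorAlgebra R L) (m : L) (c : A) (t : B ⊗[A] ExteriorAlgebra A L) :
    brExt R A L B (x * ExteriorAlgebra.ι R (c • m) * y) t =
      c • brExt R A L B (x * ExteriorAlgebra.ι R m * y) t +
      (1 ⊗ₜ extProj R A L (x * ExteriorAlgebra.ι R m * y)) *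
        brFun R A L B (algebraMap A B c) t := by
  induction x using extR_induction with
  | h0 => simp
  | h1 =>
    simp only [one_mul, brExt_ι_mul, lieE_smul, map_smul, mul_add, ← mul_assoc, smul_add,
      Algebra.TensorProduct.tmul_mul_tmul, extProj_involute_mul, map_mul, extProj_ι,
      TensorProduct.tmul_smul, smul_mul_assoc, mul_smul_comm]
    abel
  | hadd x y hx hy =>
    simp only [add_mul, map_add, LinearMap.add_apply, hx, hy, smul_add, TensorProduct.tmul_add]
    abel
  | hsmul r x hx =>
    simp only [smul_mul_assoc, map_smul, LinearMap.smul_apply, hx, smul_add, smul_comm r,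
      TensorProduct.tmul_smul]
  | hι k x hx =>
    have e : ∀ z, ExteriorAlgebra.ι R k * x * z * y = ExteriorAlgebra.ι R k * (x * z * y) := by
      intro z; simp only [mul_assoc]
    simp only [e, brExt_ι_mul, hx, mul_add, map_mul (extProj R A L) (ExteriorAlgebra.ι R _),
      extProj_ι, ← mul_assoc (_ ⊗ₜ _ : B ⊗[A] ExteriorAlgebra A L),
      Algebra.TensorProduct.tmul_mul_tmul, one_mul, mul_smul_comm, smul_add]
    simp only [map_mul, CliffordAlgebra.involute_ι, map_neg, extProj_ι, map_smul, mul_smul_comm,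
      smul_mul_assoc, TensorProduct.tmul_smul, mul_neg, neg_mul, TensorProduct.tmul_neg, smul_neg]
    abel

/-- `brAux (α₁ ∧ ⋯ ∧ αₗ) a = [a ⊗ α₁ ∧ ⋯ ∧ αₗ, ·]`, without the signs coming from the degrees of
elements of `B`. -/
def brAux (R A L B : Type u) [CommRing R] [CommRing A] [Algebra R A] [LieRing L] [LieAlgebra R L]
    [Module A L] [LieRingModule L A] [LieRinehartRing A L] [LieRinehartAlgebra R A L]
    [Ring B] [Algebra A B] [Algebra R B] [IsScalarTower R A B] [LieRingModule L B]
    [LieModule R L B] [LAlgebra A L B] :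
    ExteriorAlgebra R L →ₗ[R] B →ₗ[R] Module.End R (B ⊗[A] ExteriorAlgebra A L) :=
  LinearMap.mk₂ R
    (fun x a => LinearMap.mulLeft R (a ⊗ₜ 1) * brExt R A L B x +
      LinearMap.mulLeft R (1 ⊗ₜ extProj R A L x) * brFun R A L B a)
    (by intro x y a; ext1 t; simp [TensorProduct.tmul_add, add_mul, mul_add]; abel)
    (by intro c x a; ext1 t; simp [TensorProduct.tmul_smul])
    (by intro x a a'; ext1 t; simp [TensorProduct.add_tmul, add_mul, mul_add]; abel)
    (by intro c x a; ext1 t; simp [← TensorProduct.smul_tmul'])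

theorem balanced_brAux : Balanced A (brAux R A L B) := by
  intro x y m c a
  ext1 t
  simp only [brAux, LinearMap.mk₂_apply, LinearMap.add_apply, Module.End.mul_apply,
    LinearMap.mulLeft_apply, brExt_smul, brFun_smul, mul_add, ← mul_assoc,
    Algebra.TensorProduct.tmul_mul_tmul, one_mul, mul_one, mul_smul_comm,
    ← TensorProduct.smul_tmul', smul_mul_assoc]
  simp only [map_mul, extProj_ι, map_smul, mul_smul_comm, smul_mul_assoc, TensorProduct.tmul_smul]
  abel

variable (R A L B) in
/-- The bracket `[x, y]` without the signs coming from the degrees of elements of `B`: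
`brUnsigned (a ⊗ u) (b ⊗ v)` is `a b ⊗ [u, v] + ∑ⱼ (-1)^(l-j) a αⱼ(b) ⊗ (α₁ ⋯ α̂ⱼ ⋯ αₗ) ∧ v +
∑ₖ (-1)^k βₖ(a) b ⊗ u ∧ (β₁ ⋯ β̂ₖ ⋯ βₘ)` for `u = α₁ ∧ ⋯ ∧ αₗ` and `v = β₁ ∧ ⋯ ∧ βₘ`. -/
def brUnsigned : B ⊗[A] ExteriorAlgebra A L →ₗ[R] Module.End R (B ⊗[A] ExteriorAlgebra A L) :=
  descend _ balanced_brAux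

end Bracket

section Generator
variable {R A L B : Type u} [CommRing R] [CommRing A] [Algebra R A] [LieRing L] [LieAlgebra R L]
  [Module A L] [LieRingModule L A] [LieRinehartRing A L] [LieRinehartAlgebra R A L]
  [Ring B] [Algebra A B] [Algebra R B] [IsScalarTower R A B] [LieRingModule L B] [LieModule R L B]
  [LAlgebra A L B]

/-- The grading `𝒢` makes the `A`-algebra `B` with its `L`-action into a graded commutative algebra
on which `L` acts by operators of degree zero. -/
structure IsGradedLAlgebra (L : Type u) [LieRing L] [LieRingModule L B]
    (𝒢 : ℤ → Submodule A B) : Prop where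
  mul_comm : ∀ (p q : ℤ) (x y : B), x ∈ 𝒢 p → y ∈ 𝒢 q → x * y = (p * q).negOnePow • (y * x)
  lie_mem : ∀ (p : ℤ) (α : L) (x : B), x ∈ 𝒢 p → ⁅α, x⁆ ∈ 𝒢 p

/-- The operator on `B` that multiplies the elements of degree `p` by the integer `f p`. -/
def gradeScale (𝒢 : ℤ → Submodule A B) [GradedAlgebra 𝒢] (f : ℤ → ℤ) : B →ₗ[A] B :=
  DirectSum.toModule A ℤ B (fun p => f p • (𝒢 p).subtype) ∘ₗ
    (DirectSum.decomposeLinearEquiv 𝒢).toLinearMap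

theorem gradeScale_of_mem (𝒢 : ℤ → Submodule A B) [GradedAlgebra 𝒢] (f : ℤ → ℤ) {p : ℤ} {x : B}
    (hx : x ∈ 𝒢 p) : gradeScale 𝒢 f x = f p • x := by
  simp only [gradeScale, LinearMap.comp_apply, LinearEquiv.coe_coe,
    DirectSum.decomposeLinearEquiv_apply]
  rw [DirectSum.decompose_of_mem 𝒢 hx]
  exact DirectSum.toModule_lof A p _

/-- The projection of `B ⊗ ⋀ L` onto the part where the degree in `B` is even. -/
def evenPart (L : Type u) [LieRing L] [Module A L] (𝒢 : ℤ → Submodule A B) [GradedAlgebra 𝒢] :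
    B ⊗[A] ExteriorAlgebra A L →ₗ[A] B ⊗[A] ExteriorAlgebra A L :=
  (gradeScale 𝒢 (fun p => if Even p then 1 else 0)).rTensor _

/-- The projection of `B ⊗ ⋀ L` onto the part where the degree in `B` is odd. -/
def oddPart (L : Type u) [LieRing L] [Module A L] (𝒢 : ℤ → Submodule A B) [GradedAlgebra 𝒢] :
    B ⊗[A] ExteriorAlgebra A L →ₗ[A] B ⊗[A] ExteriorAlgebra A L :=
  (gradeScale 𝒢 (fun p => if Even p then 0 else 1)).rTensor _

/-- `b ⊗ u ↦ (-1)^|u| b ⊗ u`. -/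
def extSign (A L B : Type u) [CommRing A] [LieRing L] [Module A L] [Ring B] [Algebra A B] :
    B ⊗[A] ExteriorAlgebra A L →ₗ[A] B ⊗[A] ExteriorAlgebra A L :=
  (CliffordAlgebra.involute (Q := (0 : QuadraticForm A L))).toLinearMap.lTensor B

/-- The product of the bigraded algebra `B ⊗_A ⋀_A L`, with the sign rule for the total degree:
`(a ⊗ u) (b ⊗ v) = (-1)^(|u| |b|) a b ⊗ u ∧ v`. The product `*` is that of Mathlib, without signs. -/
def gmul (𝒢 : ℤ → Submodule A B) [GradedAlgebra 𝒢] (x y : B ⊗[A] ExteriorAlgebra A L) :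
    B ⊗[A] ExteriorAlgebra A L :=
  x * evenPart L 𝒢 y + extSign A L B x * oddPart L 𝒢 y

/-- The bigraded crossed product Gerstenhaber bracket on `B ⊗_A ⋀_A L`:
for `u = α₁ ∧ ⋯ ∧ αₗ` and `v = β₁ ∧ ⋯ ∧ βₘ`, `[a ⊗ u, b ⊗ v]` is `(-1)^((l - 1) |b|)` times
`a b ⊗ [u, v] + ∑ⱼ (-1)^(l-j) a αⱼ(b) ⊗ (α₁ ⋯ α̂ⱼ ⋯ αₗ) ∧ v + ∑ₖ (-1)^k βₖ(a) b ⊗ u ∧ (β₁ ⋯ β̂ₖ ⋯ βₘ)`,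
`[u, v]` being the Gerstenhaber bracket of `⋀_A L`. The sum in the last display is
`brUnsigned (a ⊗ u) (b ⊗ v)`. -/
def bracket (R : Type u) [CommRing R] [Algebra R A] [LieAlgebra R L] [LieRinehartAlgebra R A L]
    [Algebra R B] [IsScalarTower R A B] [LieModule R L B]
    (𝒢 : ℤ → Submodule A B) [GradedAlgebra 𝒢] (x y : B ⊗[A] ExteriorAlgebra A L) :
    B ⊗[A] ExteriorAlgebra A L :=
  brUnsigned R A L B x (evenPart L 𝒢 y) - brUnsigned R A L B (extSign A L B x) (oddPart L 𝒢 y)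

/-- The part of bidegree `(p, q)`, spanned by the `a ⊗ u` with `|a| = p` and `u ∈ ⋀^q L`. -/
def bidegree (L : Type u) [LieRing L] [Module A L] (𝒢 : ℤ → Submodule A B) (p : ℤ) (q : ℕ) :
    Submodule A (B ⊗[A] ExteriorAlgebra A L) :=
  LinearMap.range (TensorProduct.map (𝒢 p).subtype (⋀[A]^q L).subtype)

/-- `D` is an exact generator of the bigraded crossed product Gerstenhaber algebra
`B ⊗_A ⋀_A L`. -/
structure IsExactGenerator (𝒢 : ℤ → Submodule A B) [GradedAlgebra 𝒢]
    (D : B ⊗[A] ExteriorAlgebra A L →ₗ[R] B ⊗[A] ExteriorAlgebra A L) : Prop where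
  mem_bidegree : ∀ (p : ℤ) (q : ℕ), ∀ x ∈ bidegree L 𝒢 p (q + 1), D x ∈ bidegree L 𝒢 p q
  bidegree_zero : ∀ (p : ℤ), ∀ x ∈ bidegree L 𝒢 p 0, D x = 0
  generates : ∀ (p p' : ℤ) (q q' : ℕ), ∀ x ∈ bidegree L 𝒢 p q, ∀ y ∈ bidegree L 𝒢 p' q',
    bracket R 𝒢 x y = (p + q).negOnePow •
      (D (gmul 𝒢 x y) - gmul 𝒢 (D x) y - (p + q).negOnePow • gmul 𝒢 x (D y))
  exact : ∀ x, D (D x) = 0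

end Generator

section ConnDiff
variable {R A L N : Type u} [CommRing R] [CommRing A] [Algebra R A] [LieRing L] [LieAlgebra R L]
  [Module A L] [LieRingModule L A] [LieRinehartRing A L] [LieRinehartAlgebra R A L]
  [AddCommGroup N] [Module R N] [Module A N] [IsScalarTower R A N]

section
variable (r : L →ₗ[R] N →ₗ[R] N)
  (h1 : ∀ α (c : A) n, r α (c • n) = c • r α n - ⁅α, c⁆ • n)
  (h2 : ∀ α (c : A) n, r (c • α) n = r α (c • n))

theorem connDiff_tmul (n : N) (x : ExteriorAlgebra R L) :
    connDiff r h1 h2 (n ⊗ₜ extProj R A L x) = tensProj R A L N (ceDiff r x n) :=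
  descend_tmul _ _ _ _

theorem connDiff_tensProj (t : N ⊗[R] ExteriorAlgebra R L) :
    connDiff r h1 h2 (tensProj R A L N t) = tensProj R A L N (ceTot r t) := by
  induction t with
  | zero => simp
  | add s t hs ht => simp only [map_add, hs, ht]
  | tmul n x => exact connDiff_tmul r h1 h2 n x

theorem connDiff_connDiff (hr : ∀ α β n, r ⁅α, β⁆ n = r β (r α n) - r α (r β n))
    (t : N ⊗[A] ExteriorAlgebra A L) : connDiff r h1 h2 (connDiff r h1 h2 t) = 0 := by
  refine tmul_induction (R := R) (p := fun t => connDiff r h1 h2 (connDiff r h1 h2 t) = 0)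
    (by simp) (fun s t hs ht => by simp only [map_add, hs, ht, add_zero]) (fun n x => ?_) t
  rw [connDiff_tmul, connDiff_tensProj, ← ceTot_tmul, ceTot_ceTot r hr, map_zero]

theorem ceDiff_comm {M : Type u} [AddCommGroup M] [Module R M] (r' : L →ₗ[R] M →ₗ[R] M)
    (f : N →ₗ[R] M) (hf : ∀ α n, f (r α n) = r' α (f n)) (x : ExteriorAlgebra R L) (n : N) :
    ceDiff r' x (f n) = f.rTensor _ (ceDiff r x n) := by
  induction x using extR_induction with
  | h0 => simp
  | h1 => simp [ceDiff_one]
  | hadd x y hx hy => simp only [map_add, LinearMap.add_apply, hx, hy]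
  | hsmul c x hx => simp only [map_smul, LinearMap.smul_apply, hx]
  | hι m x hx =>
    simp only [ceDiff_ι_mul, hx, map_sub, LinearMap.rTensor_tmul, hf]
    congr 1
    generalize ceDiff r x n = t
    induction t with
    | zero => simp
    | add s t hs ht => simp only [map_add, hs, ht]
    | tmul n x => simp

theorem connDiff_rTensor {M : Type u} [AddCommGroup M] [Module R M] [Module A M]
    [IsScalarTower R A M] (r' : L →ₗ[R] M →ₗ[R] M)
    (h1' : ∀ α (c : A) n, r' α (c • n) = c • r' α n - ⁅α, c⁆ • n)
    (h2' : ∀ α (c : A) n, r' (c • α) n = r' α (c • n))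
    (f : N →ₗ[A] M) (hf : ∀ α n, f (r α n) = r' α (f n)) (t : N ⊗[A] ExteriorAlgebra A L) :
    connDiff r' h1' h2' (f.rTensor _ t) = f.rTensor _ (connDiff r h1 h2 t) := by
  refine tmul_induction (R := R) (p := fun t =>
    connDiff r' h1' h2' (f.rTensor _ t) = f.rTensor _ (connDiff r h1 h2 t))
    (by simp) (fun s t hs ht => by simp only [map_add, hs, ht]) (fun n x => ?_) t
  rw [LinearMap.rTensor_tmul, connDiff_tmul, connDiff_tmul]
  have := ceDiff_comm r r' (f.restrictScalars R) hf x n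
  rw [LinearMap.restrictScalars_apply] at this
  rw [this]
  generalize ceDiff r x n = t
  induction t with
  | zero => simp
  | add s t hs ht => simp only [map_add, hs, ht]
  | tmul n x => simp

end

variable (A L N) in
/-- The image of `N ⊗_A ⋀^q L` in `N ⊗_A ⋀_A L`. -/
def extDegree (q : ℕ) : Submodule A (N ⊗[A] ExteriorAlgebra A L) :=
  LinearMap.range ((⋀[A]^q L).subtype.lTensor N)

theorem tmul_mem_extDegree {q : ℕ} (n : N) {w : ExteriorAlgebra A L} (hw : w ∈ ⋀[A]^q L) :
    n ⊗ₜ w ∈ extDegree A L N q := ⟨n ⊗ₜ ⟨w, hw⟩, rfl⟩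

theorem ι_mul_mem {q : ℕ} (m : L) {w : ExteriorAlgebra A L} (hw : w ∈ ⋀[A]^q L) :
    ExteriorAlgebra.ι A m * w ∈ ⋀[A]^(q + 1) L := by
  rw [ExteriorAlgebra.exteriorPower, pow_succ']
  exact Submodule.mul_mem_mul ⟨m, rfl⟩ hw

theorem wedgeL_mem {q : ℕ} (m : L) {t : N ⊗[A] ExteriorAlgebra A L}
    (ht : t ∈ extDegree A L N q) : wedgeL A N m t ∈ extDegree A L N (q + 1) := by
  obtain ⟨t, rfl⟩ := ht
  induction t with
  | zero => simp
  | add s t hs ht => rw [map_add, map_add]; exact add_mem hs ht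
  | tmul n w => exact tmul_mem_extDegree _ (ι_mul_mem m w.2)

theorem extProj_ιMulti_mem {q : ℕ} (v : Fin q → L) :
    extProj R A L (ExteriorAlgebra.ιMulti R q v) ∈ ⋀[A]^q L := by
  rw [extProj_ιMulti]; exact ExteriorAlgebra.ιMulti_range A q ⟨v, rfl⟩

theorem extProj_lieExt_mem {q : ℕ} (v : Fin q → L) (α : L) :
    extProj R A L (lieExt R L (ExteriorAlgebra.ιMulti R q v) α) ∈ ⋀[A]^q L := by
  induction q with
  | zero => simp [ExteriorAlgebra.ιMulti_zero_apply, lieExt_one]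
  | succ q ih =>
    rw [ExteriorAlgebra.ιMulti_succ_apply, lieExt_ι_mul, map_add, map_mul, map_mul, extProj_ι,
      extProj_ι]
    exact add_mem (ι_mul_mem _ (extProj_ιMulti_mem _)) (ι_mul_mem _ (ih _))

theorem tensProj_ceDiff_mem (r : L →ₗ[R] N →ₗ[R] N) {q : ℕ} (v : Fin (q + 1) → L) (n : N) :
    tensProj R A L N (ceDiff r (ExteriorAlgebra.ιMulti R (q + 1) v) n) ∈ extDegree A L N q := by
  induction q with
  | zero =>
    rw [ExteriorAlgebra.ιMulti_succ_apply, ceDiff_ι_mul, ExteriorAlgebra.ιMulti_zero_apply,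
      ceDiff_one, lieExt_one]
    simp only [TensorProduct.tmul_zero, map_zero, sub_zero, tensProj_tmul, map_one]
    exact tmul_mem_extDegree _ (by simp [ExteriorAlgebra.exteriorPower])
  | succ q ih =>
    rw [ExteriorAlgebra.ιMulti_succ_apply, ceDiff_ι_mul, map_sub, map_sub, tensProj_tmul,
      tensProj_tmul, tensProj_ceMul]
    exact sub_mem (sub_mem (tmul_mem_extDegree _ (extProj_ιMulti_mem _))
      (tmul_mem_extDegree _ (extProj_lieExt_mem _ _))) (wedgeL_mem _ (ih _))

theorem connDiff_mem (r : L →ₗ[R] N →ₗ[R] N)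
    (h1 : ∀ α (c : A) n, r α (c • n) = c • r α n - ⁅α, c⁆ • n)
    (h2 : ∀ α (c : A) n, r (c • α) n = r α (c • n)) {q : ℕ} {t : N ⊗[A] ExteriorAlgebra A L}
    (ht : t ∈ extDegree A L N (q + 1)) : connDiff r h1 h2 t ∈ extDegree A L N q := by
  obtain ⟨t, rfl⟩ := ht
  induction t with
  | zero => simp
  | add s t hs ht => rw [map_add, map_add]; exact add_mem hs ht
  | tmul n w =>
    obtain ⟨w, hw⟩ := w
    rw [LinearMap.lTensor_tmul, Submodule.subtype_apply]
    dsimp only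
    rw [← ExteriorAlgebra.ιMulti_span_fixedDegree] at hw
    induction hw using Submodule.span_induction generalizing n with
    | mem x h =>
      obtain ⟨v, rfl⟩ := h
      rw [← extProj_ιMulti (R := R), connDiff_tmul]
      exact tensProj_ceDiff_mem r v n
    | zero => rw [TensorProduct.tmul_zero, map_zero]; exact zero_mem _
    | add x y _ _ hx hy => rw [TensorProduct.tmul_add, map_add]; exact add_mem (hx n) (hy n)
    | smul c x _ hx => rw [← TensorProduct.smul_tmul]; exact hx _

end ConnDiff

section Enveloping
variable (R A L : Type u) [CommRing R] [CommRing A] [Algebra R A] [LieRing L] [LieAlgebra R L]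
  [Module A L] [LieRingModule L A]

/-- The relations defining `U(A, L)`. -/
inductive URel : FreeAlgebra R (A ⊕ L) → FreeAlgebra R (A ⊕ L) → Prop
  | add_left (a b : A) : URel (FreeAlgebra.ι R (Sum.inl (a + b)))
      (FreeAlgebra.ι R (Sum.inl a) + FreeAlgebra.ι R (Sum.inl b))
  | mul_left (a b : A) : URel (FreeAlgebra.ι R (Sum.inl (a * b)))
      (FreeAlgebra.ι R (Sum.inl a) * FreeAlgebra.ι R (Sum.inl b))
  | algebraMap_left (r : R) : URel (FreeAlgebra.ι R (Sum.inl (algebraMap R A r)))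
      (algebraMap R _ r)
  | add_right (α β : L) : URel (FreeAlgebra.ι R (Sum.inr (α + β)))
      (FreeAlgebra.ι R (Sum.inr α) + FreeAlgebra.ι R (Sum.inr β))
  | smul_right (a : A) (α : L) : URel (FreeAlgebra.ι R (Sum.inr (a • α)))
      (FreeAlgebra.ι R (Sum.inl a) * FreeAlgebra.ι R (Sum.inr α))
  | lie_right (α β : L) : URel (FreeAlgebra.ι R (Sum.inr ⁅α, β⁆))
      (FreeAlgebra.ι R (Sum.inr α) * FreeAlgebra.ι R (Sum.inr β) -
        FreeAlgebra.ι R (Sum.inr β) * FreeAlgebra.ι R (Sum.inr α))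
  | lie_left (α : L) (a : A) : URel (FreeAlgebra.ι R (Sum.inl ⁅α, a⁆))
      (FreeAlgebra.ι R (Sum.inr α) * FreeAlgebra.ι R (Sum.inl a) -
        FreeAlgebra.ι R (Sum.inl a) * FreeAlgebra.ι R (Sum.inr α))

/-- The universal algebra `U(A, L)` of the Lie--Rinehart algebra `(A, L)`. -/
def UAlg : Type u := RingQuot (URel R A L)

instance : Ring (UAlg R A L) := inferInstanceAs (Ring (RingQuot (URel R A L)))
instance : Algebra R (UAlg R A L) := inferInstanceAs (Algebra R (RingQuot (URel R A L)))

/-- The quotient map. -/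
def UAlg.mk : FreeAlgebra R (A ⊕ L) →ₐ[R] UAlg R A L := RingQuot.mkAlgHom R (URel R A L)

variable {R A L} in
theorem UAlg.mk_rel {x y : FreeAlgebra R (A ⊕ L)} (h : URel R A L x y) :
    UAlg.mk R A L x = UAlg.mk R A L y := RingQuot.mkAlgHom_rel R h

/-- The canonical map `A → U(A, L)`. -/
def UAlg.ιA : A →ₐ[R] UAlg R A L :=
  { toFun := fun a => UAlg.mk R A L (FreeAlgebra.ι R (Sum.inl a))
    map_one' := by
      have := UAlg.mk_rel (URel.algebraMap_left (R := R) (A := A) (L := L) 1)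
      simpa using this
    map_mul' := fun a b => by rw [UAlg.mk_rel (URel.mul_left a b), map_mul]
    map_zero' := by
      have := UAlg.mk_rel (URel.algebraMap_left (R := R) (A := A) (L := L) 0)
      simpa using this
    map_add' := fun a b => by rw [UAlg.mk_rel (URel.add_left a b), map_add]
    commutes' := fun r => by rw [UAlg.mk_rel (URel.algebraMap_left r)]; exact AlgHom.commutes _ r }

/-- The canonical map `L → U(A, L)`. -/
def UAlg.ιL [IsScalarTower R A L] : L →ₗ[R] UAlg R A L where
  toFun α := UAlg.mk R A L (FreeAlgebra.ι R (Sum.inr α))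
  map_add' α β := by rw [UAlg.mk_rel (URel.add_right α β), map_add]
  map_smul' r α := by
    rw [← algebraMap_smul A r α, UAlg.mk_rel (URel.smul_right _ α), map_mul,
      UAlg.mk_rel (URel.algebraMap_left r), AlgHom.commutes, ← Algebra.smul_def]
    rfl

variable {R A L}
variable [IsScalarTower R A L]

theorem UAlg.ιL_smul (a : A) (α : L) :
    UAlg.ιL R A L (a • α) = UAlg.ιA R A L a * UAlg.ιL R A L α :=
  (UAlg.mk_rel (URel.smul_right a α)).trans (map_mul _ _ _)

theorem UAlg.ιL_lie (α β : L) :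
    UAlg.ιL R A L ⁅α, β⁆ = UAlg.ιL R A L α * UAlg.ιL R A L β -
      UAlg.ιL R A L β * UAlg.ιL R A L α :=
  (UAlg.mk_rel (URel.lie_right α β)).trans (by rw [map_sub, map_mul, map_mul]; rfl)

theorem UAlg.ιA_lie (α : L) (a : A) :
    UAlg.ιA R A L ⁅α, a⁆ = UAlg.ιL R A L α * UAlg.ιA R A L a -
      UAlg.ιA R A L a * UAlg.ιL R A L α :=
  (UAlg.mk_rel (URel.lie_left α a)).trans (by rw [map_sub, map_mul, map_mul]; rfl)

/-- The universal property of `U(A, L)`. -/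
def UAlg.lift {S : Type u} [Ring S] [Algebra R S] (f : A →ₐ[R] S) (g : L →ₗ[R] S)
    (h1 : ∀ (a : A) α, g (a • α) = f a * g α) (h2 : ∀ α β, g ⁅α, β⁆ = g α * g β - g β * g α)
    (h3 : ∀ α (a : A), f ⁅α, a⁆ = g α * f a - f a * g α) : UAlg R A L →ₐ[R] S :=
  RingQuot.liftAlgHom R ⟨FreeAlgebra.lift R (Sum.elim f g), by
    intro x y h
    cases h <;> simp [h1, h2, h3]⟩

theorem UAlg.lift_ιA {S : Type u} [Ring S] [Algebra R S] (f : A →ₐ[R] S) (g : L →ₗ[R] S)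
    (h1 h2 h3) (a : A) : UAlg.lift f g h1 h2 h3 (UAlg.ιA R A L a) = f a :=
  (RingQuot.liftAlgHom_mkAlgHom_apply _ _ _ _).trans (by simp)

theorem UAlg.lift_ιL {S : Type u} [Ring S] [Algebra R S] (f : A →ₐ[R] S) (g : L →ₗ[R] S)
    (h1 h2 h3) (α : L) : UAlg.lift f g h1 h2 h3 (UAlg.ιL R A L α) = g α :=
  (RingQuot.liftAlgHom_mkAlgHom_apply _ _ _ _).trans (by simp)

end Enveloping

section Rinehart
variable (R A L : Type u) [CommRing R] [CommRing A] [Algebra R A] [LieRing L] [LieAlgebra R L]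
  [Module A L] [LieRingModule L A]

/-- `U(A, L)`, viewed as a left module over itself and as an `A`-module through multiplication
by elements of `A` from the right. -/
def URight : Type u := UAlg R A L

instance : AddCommGroup (URight R A L) := inferInstanceAs (AddCommGroup (UAlg R A L))
instance : Module R (URight R A L) := inferInstanceAs (Module R (UAlg R A L))
instance : Module (UAlg R A L) (URight R A L) := inferInstanceAs (Module (UAlg R A L) (UAlg R A L))

/-- The element `u` of `U(A, L)`. -/
def URight.of : UAlg R A L →ₗ[UAlg R A L] URight R A L := LinearMap.id

/-- Multiplication by `v` from the right. -/
def URight.mulRight : UAlg R A L →ₗ[R] URight R A L →ₗ[R] URight R A L :=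
  (LinearMap.mul R (UAlg R A L)).flip

variable {R A L} in
theorem URight.mulRight_apply (u v : UAlg R A L) :
    URight.mulRight R A L v (URight.of R A L u) = URight.of R A L (u * v) := rfl

variable {R A L} in
theorem URight.mulRight_mul (v w : UAlg R A L) (x : URight R A L) :
    URight.mulRight R A L (v * w) x = URight.mulRight R A L w (URight.mulRight R A L v x) :=
  (mul_assoc (G := UAlg R A L) x v w).symm

instance : Module A (URight R A L) where
  smul a x := URight.mulRight R A L (UAlg.ιA R A L a) x
  one_smul x := by
    change URight.mulRight R A L (UAlg.ιA R A L 1) x = x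
    rw [map_one]; exact mul_one (M := UAlg R A L) x
  mul_smul a b x := by
    change URight.mulRight R A L (UAlg.ιA R A L (a * b)) x = _
    rw [mul_comm, map_mul, URight.mulRight_mul]; rfl
  smul_zero a := map_zero _
  smul_add a x y := map_add _ x y
  add_smul a b x := by
    change URight.mulRight R A L (UAlg.ιA R A L (a + b)) x = _
    rw [map_add, map_add]; rfl
  zero_smul x := by
    change URight.mulRight R A L (UAlg.ιA R A L 0) x = 0
    rw [map_zero, map_zero]; rfl

variable {R A L} in
theorem URight.smul_def (a : A) (x : URight R A L) :
    a • x = URight.mulRight R A L (UAlg.ιA R A L a) x := rfl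

instance : IsScalarTower R A (URight R A L) where
  smul_assoc r a x := by
    rw [URight.smul_def, URight.smul_def, map_smul, map_smul]; rfl

instance : SMulCommClass A (UAlg R A L) (URight R A L) where
  smul_comm a u x := (mul_assoc (G := UAlg R A L) u x (UAlg.ιA R A L a))

variable {R A L}

/-- `id ⊗ f` as a map of `U(A, L)`-modules. -/
def URight.lTensor {P Q : Type u} [AddCommGroup P] [Module A P] [AddCommGroup Q] [Module A Q]
    (f : P →ₗ[A] Q) : URight R A L ⊗[A] P →ₗ[UAlg R A L] URight R A L ⊗[A] Q :=
  { f.lTensor (URight R A L) with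
    map_smul' := by
      intro u t
      change f.lTensor (URight R A L) (u • t) = u • f.lTensor (URight R A L) t
      induction t with
      | zero => simp
      | add s t hs ht => rw [smul_add, map_add, hs, ht, map_add, smul_add]
      | tmul x p => rfl }

theorem URight.lTensor_apply {P Q : Type u} [AddCommGroup P] [Module A P] [AddCommGroup Q]
    [Module A Q] (f : P →ₗ[A] Q) (t : URight R A L ⊗[A] P) :
    URight.lTensor f t = f.lTensor (URight R A L) t := rfl

variable [LieRinehartRing A L] [LieRinehartAlgebra R A L]

variable (R A L) in
/-- The right multiplication of `L` on `U(A, L)`. -/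
def URight.act : L →ₗ[R] URight R A L →ₗ[R] URight R A L :=
  URight.mulRight R A L ∘ₗ UAlg.ιL R A L

theorem URight.act_smul (α : L) (c : A) (x : URight R A L) :
    URight.act R A L α (c • x) = c • URight.act R A L α x - ⁅α, c⁆ • x := by
  simp only [URight.act, LinearMap.comp_apply, URight.smul_def, UAlg.ιA_lie, map_sub,
    LinearMap.sub_apply, URight.mulRight_mul]
  abel

theorem URight.smul_act (α : L) (c : A) (x : URight R A L) :
    URight.act R A L (c • α) x = URight.act R A L α (c • x) := by
  simp only [URight.act, LinearMap.comp_apply, URight.smul_def, UAlg.ιL_smul,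
    URight.mulRight_mul]

theorem URight.lie_act (α β : L) (x : URight R A L) :
    URight.act R A L ⁅α, β⁆ x =
      URight.act R A L β (URight.act R A L α x) - URight.act R A L α (URight.act R A L β x) := by
  simp only [URight.act, LinearMap.comp_apply, UAlg.ιL_lie, map_sub,
    LinearMap.sub_apply, URight.mulRight_mul]

variable (R A L) in
/-- The differential of the Rinehart complex, on `U(A, L) ⊗_A ⋀_A L`:
`d (u ⊗ α₁ ∧ ⋯ ∧ αₙ) = ∑ᵢ (-1)^(i-1) u αᵢ ⊗ α₁ ⋯ α̂ᵢ ⋯ αₙ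
  + ∑_{j<k} (-1)^(j+k) u ⊗ [αⱼ, αₖ] ∧ α₁ ⋯ α̂ⱼ ⋯ α̂ₖ ⋯ αₙ`. -/
def rinehartDiff : URight R A L ⊗[A] ExteriorAlgebra A L →ₗ[UAlg R A L]
    URight R A L ⊗[A] ExteriorAlgebra A L :=
  { connDiff (URight.act R A L) URight.act_smul URight.smul_act with
    map_smul' := by
      intro u t
      change connDiff (URight.act R A L) URight.act_smul URight.smul_act (u • t) =
        u • connDiff (URight.act R A L) URight.act_smul URight.smul_act t
      let f : URight R A L →ₗ[A] URight R A L :=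
        { toFun := fun x => u • x
          map_add' := smul_add u
          map_smul' := fun a x => (smul_comm a u x).symm }
      have hf : ∀ t : URight R A L ⊗[A] ExteriorAlgebra A L, f.rTensor _ t = u • t := by
        intro t
        induction t with
        | zero => simp
        | add s t hs ht => rw [map_add, hs, ht, smul_add]
        | tmul x p => rfl
      rw [← hf, ← hf]
      exact connDiff_rTensor _ _ _ _ _ _ f
        (fun α x => (mul_assoc (G := UAlg R A L) u x _).symm) t }

theorem rinehartDiff_apply (t : URight R A L ⊗[A] ExteriorAlgebra A L) :
    rinehartDiff R A L t = connDiff (URight.act R A L) URight.act_smul URight.smul_act t := rfl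

/-- The projection `⋀_A L → ⋀^n L`. -/
def extPart (A L : Type u) [CommRing A] [LieRing L] [Module A L] (n : ℕ) :
    ExteriorAlgebra A L →ₗ[A] ⋀[A]^n L :=
  DirectSum.component A ℕ (fun i => ⋀[A]^i L) n ∘ₗ
    (DirectSum.decomposeLinearEquiv (fun i => ⋀[A]^i L)).toLinearMap

theorem extPart_coe {n : ℕ} (w : ⋀[A]^n L) : extPart A L n w = w := by
  simp only [extPart, LinearMap.comp_apply, LinearEquiv.coe_coe,
    DirectSum.decomposeLinearEquiv_apply, DirectSum.decompose_coe]
  exact DirectSum.component.lof_self A (M := fun i => ⋀[A]^i L) n w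

variable (R A L) in
/-- The differential `K_{n+1} → K_n` of the Rinehart complex `K_n = U(A, L) ⊗_A ⋀^n L`. -/
def rinehartD (n : ℕ) : URight R A L ⊗[A] ⋀[A]^(n + 1) L →ₗ[UAlg R A L]
    URight R A L ⊗[A] ⋀[A]^n L :=
  URight.lTensor (extPart A L n) ∘ₗ rinehartDiff R A L ∘ₗ
    URight.lTensor (⋀[A]^(n + 1) L).subtype

theorem incl_rinehartD (n : ℕ) (t : URight R A L ⊗[A] ⋀[A]^(n + 1) L) :
    URight.lTensor (⋀[A]^n L).subtype (rinehartD R A L n t) =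
      rinehartDiff R A L (URight.lTensor (⋀[A]^(n + 1) L).subtype t) := by
  have h : connDiff (URight.act R A L) URight.act_smul URight.smul_act
      ((⋀[A]^(n + 1) L).subtype.lTensor (URight R A L) t) ∈
      extDegree A L (URight R A L) n := connDiff_mem _ _ _ (LinearMap.mem_range_self _ t)
  obtain ⟨s, hs⟩ := h
  have hd : rinehartD R A L n t = (extPart A L n).lTensor (URight R A L)
      (connDiff (URight.act R A L) URight.act_smul URight.smul_act
      ((⋀[A]^(n + 1) L).subtype.lTensor (URight R A L) t)) := rfl
  rw [hd, rinehartDiff_apply, URight.lTensor_apply, URight.lTensor_apply, ← hs,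
    ← LinearMap.comp_apply (LinearMap.lTensor _ (extPart A L n)), ← LinearMap.lTensor_comp]
  have : extPart A L n ∘ₗ (⋀[A]^n L).subtype = LinearMap.id := LinearMap.ext extPart_coe
  rw [this, LinearMap.lTensor_id]; rfl

theorem rinehartD_rinehartD (n : ℕ) (t : URight R A L ⊗[A] ⋀[A]^(n + 1 + 1) L) :
    rinehartD R A L n (rinehartD R A L (n + 1) t) = 0 := by
  conv_lhs => rw [rinehartD]
  rw [LinearMap.comp_apply, LinearMap.comp_apply, incl_rinehartD, rinehartDiff_apply,
    rinehartDiff_apply, connDiff_connDiff _ _ _ URight.lie_act, map_zero]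

variable (R A L) in
/-- The Rinehart complex `K(A, L)`, a complex of left `U(A, L)`-modules. -/
def rinehartComplex : ChainComplex (ModuleCat.{u} (UAlg R A L)) ℕ :=
  ChainComplex.of (fun n => ModuleCat.of (UAlg R A L) (URight R A L ⊗[A] ⋀[A]^n L))
    (fun n => ModuleCat.ofHom (rinehartD R A L n))
    (fun n => by
      apply ModuleCat.hom_ext
      exact LinearMap.ext (rinehartD_rinehartD n))

/-- The element `u ⊗ w` of `K_n = U(A, L) ⊗_A ⋀^n L`. -/
def rinehartTmul {n : ℕ} (u : UAlg R A L) (w : ⋀[A]^n L) : (rinehartComplex R A L).X n :=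
  (URight.of R A L u ⊗ₜ[A] w : URight R A L ⊗[A] ⋀[A]^n L)

variable (R A L) in
/-- `A` as a left `U(A, L)`-module: elements of `A` act by multiplication, elements of `L` through
the given action on `A`. -/
def UTriv (_ : Type u) (A : Type u) (_ : Type u) : Type u := A

instance : AddCommGroup (UTriv R A L) := inferInstanceAs (AddCommGroup A)

variable (R A L) in
/-- The structure map of the left `U(A, L)`-module `A`. -/
def UTriv.rep : UAlg R A L →ₐ[R] Module.End R A :=
  UAlg.lift (Algebra.lmul R A)
    (LinearMap.mk₂ R (fun (α : L) (a : A) => ⁅α, a⁆) add_lie smul_lie lie_add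
      (fun r α a => lie_smul r α a))
    (fun a α => by ext b; simp)
    (fun α β => by ext b; simp)
    (fun α a => by ext b; simp [mul_comm])

instance : Module (UAlg R A L) (UTriv R A L) :=
  Module.compHom (R := Module.End R A) A (UTriv.rep R A L).toRingHom

end Rinehart

section RightModules
variable (R A L : Type u) [CommRing R] [CommRing A] [Algebra R A] [LieRing L] [LieAlgebra R L]
  [Module A L] [LieRingModule L A]

/-- A right `(A, L)`-module structure on the `A`-module `N`; `act α n` is `n α`. -/
structure RightALModule (N : Type u) [AddCommGroup N] [Module R N] [Module A N] : Type u where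
  act : L →ₗ[R] N →ₗ[R] N
  act_smul : ∀ (α : L) (a : A) (n : N), act α (a • n) = a • act α n - ⁅α, a⁆ • n
  smul_act : ∀ (α : L) (a : A) (n : N), act (a • α) n = a • act α n - ⁅α, a⁆ • n
  lie_act : ∀ (α β : L) (n : N), act ⁅α, β⁆ n = act β (act α n) - act α (act β n)

variable {R A L}
variable {N : Type u} [AddCommGroup N] [Module R N] [Module A N]

/-- The underlying module of a right `(A, L)`-module. -/
def RightALModule.Carrier (_ : RightALModule R A L N) : Type u := N

namespace RightALModule
variable (S : RightALModule R A L N)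

instance : AddCommGroup S.Carrier := inferInstanceAs (AddCommGroup N)
instance : Module R S.Carrier := inferInstanceAs (Module R N)
instance : Module A S.Carrier := inferInstanceAs (Module A N)

/-- The element `n`. -/
def of : N ≃ₗ[A] S.Carrier := LinearEquiv.refl A N

variable [IsScalarTower R A N] [LieRinehartRing A L] [LieRinehartAlgebra R A L]

/-- The structure map of the right `U(A, L)`-module corresponding to a right `(A, L)`-module. -/
def rep : UAlg R A L →ₐ[R] (Module.End R N)ᵐᵒᵖ :=
  UAlg.lift
    ((Algebra.lsmul R R N).toOpposite fun a b => by
      rw [commute_iff_eq, ← map_mul, ← map_mul, mul_comm])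
    ((MulOpposite.opLinearEquiv R).toLinearMap ∘ₗ S.act)
    (fun a α => by
      apply MulOpposite.unop_injective; ext n
      change S.act (a • α) n = S.act α (a • n)
      rw [S.smul_act, S.act_smul])
    (fun α β => by
      apply MulOpposite.unop_injective; ext n
      exact S.lie_act α β n)
    (fun α a => by
      apply MulOpposite.unop_injective; ext n
      change ⁅α, a⁆ • n = a • S.act α n - S.act α (a • n)
      rw [S.act_smul]; abel)

instance : Module (UAlg R A L)ᵐᵒᵖ S.Carrier :=
  Module.compHom (R := Module.End R N) N
    ((RingEquiv.opOp (Module.End R N)).symm.toRingHom.comp (RingHom.op S.rep.toRingHom))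

theorem op_smul (u : UAlg R A L) (n : N) :
    MulOpposite.op u • S.of n = S.of ((S.rep u).unop n) := rfl

theorem op_ιA_smul (a : A) (n : N) :
    MulOpposite.op (UAlg.ιA R A L a) • S.of n = S.of (a • n) := by
  rw [op_smul, rep, UAlg.lift_ιA]; rfl

theorem op_ιL_smul (α : L) (n : N) :
    MulOpposite.op (UAlg.ιL R A L α) • S.of n = S.of (S.act α n) := by
  rw [op_smul, rep, UAlg.lift_ιL]; rfl

instance : IsScalarTower R (UAlg R A L)ᵐᵒᵖ S.Carrier where
  smul_assoc r u n := by
    change (S.rep (r • u.unop)).unop n = r • (S.rep u.unop).unop n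
    rw [map_smul]; rfl

/-- A homomorphism of right `(A, L)`-modules is one of right `U(A, L)`-modules. -/
def map (S : RightALModule R A L N) {N' : Type u} [AddCommGroup N'] [Module R N']
    [Module A N'] [IsScalarTower R A N'] (S' : RightALModule R A L N') (f : N →ₗ[A] N')
    (hf : ∀ α n, f (S.act α n) = S'.act α (f n)) :
    S.Carrier →ₗ[(UAlg R A L)ᵐᵒᵖ] S'.Carrier where
  toFun n := S'.of (f n)
  map_add' x y := map_add f x y
  map_smul' u n := by
    let F : N →ₗ[R] N' := f.restrictScalars R
    have key : ∀ (x : FreeAlgebra R (A ⊕ L)) (n : N),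
        f ((S.rep (UAlg.mk R A L x)).unop n) = (S'.rep (UAlg.mk R A L x)).unop (f n) := by
      intro x
      induction x using FreeAlgebra.induction with
      | grade0 r => 
        intro n
        rw [AlgHom.commutes, AlgHom.commutes, AlgHom.commutes]
        exact F.map_smul r n
      | grade1 x =>
        intro n
        cases x with
        | inl a =>
          have h1 := S.op_ιA_smul a n
          have h2 := S'.op_ιA_smul a (f n)
          change (S.rep (UAlg.mk R A L _)).unop n = a • n at h1
          change (S'.rep (UAlg.mk R A L _)).unop (f n) = a • f n at h2
          rw [h1, h2, map_smul]
        | inr α =>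
          have h1 := S.op_ιL_smul α n
          have h2 := S'.op_ιL_smul α (f n)
          change (S.rep (UAlg.mk R A L _)).unop n = S.act α n at h1
          change (S'.rep (UAlg.mk R A L _)).unop (f n) = S'.act α (f n) at h2
          rw [h1, h2, hf]
      | mul x y hx hy =>
        intro n
        rw [map_mul, map_mul, map_mul, MulOpposite.unop_mul, MulOpposite.unop_mul,
          Module.End.mul_apply, Module.End.mul_apply, hy, hx]
      | add x y hx hy =>
        intro n
        rw [map_add, map_add, map_add, MulOpposite.unop_add, MulOpposite.unop_add,
          LinearMap.add_apply, LinearMap.add_apply, map_add, hx, hy]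
    obtain ⟨x, hx⟩ := RingQuot.mkAlgHom_surjective R (URel R A L) u.unop
    have := key x n
    rw [show UAlg.mk R A L x = u.unop from hx] at this
    exact this

end RightALModule
end RightModules

section NTensor
variable {R : Type u} [CommRing R] (U : Type u) [Ring U]
  (N : Type u) [AddCommGroup N] [Module R N] [Module Uᵐᵒᵖ N]
  (M : Type u) [AddCommGroup M] [Module U M]

variable (R) in
/-- The relations `(n u) ⊗ m = n ⊗ (u m)`. -/
def nTensorRel : Submodule R (N ⊗[ℤ] M) :=
  Submodule.span R (Set.range fun t : N × U × M =>
    (MulOpposite.op t.2.1 • t.1) ⊗ₜ[ℤ] t.2.2 - t.1 ⊗ₜ[ℤ] (t.2.1 • t.2.2))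

variable (R) in
/-- The tensor product `N ⊗_U M` of a right `U`-module `N` and a left `U`-module `M`, as an
`R`-module through `N`. -/
abbrev NTensor : Type u := (N ⊗[ℤ] M) ⧸ nTensorRel R U N M

variable (R) {N M} in
/-- The element `n ⊗ m` of `N ⊗_U M`. -/
def ntmul (n : N) (m : M) : NTensor R U N M := (nTensorRel R U N M).mkQ (n ⊗ₜ[ℤ] m)

variable {U N M}

theorem ntmul_smul (n : N) (u : U) (m : M) :
    ntmul R U (MulOpposite.op u • n) m = ntmul R U n (u • m) := by
  rw [ntmul, ntmul, ← sub_eq_zero, ← map_sub, Submodule.mkQ_apply,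
    Submodule.Quotient.mk_eq_zero]
  exact Submodule.subset_span ⟨(n, u, m), rfl⟩

theorem ntensor_induction {p : NTensor R U N M → Prop} (h0 : p 0)
    (hadd : ∀ s t, p s → p t → p (s + t)) (h : ∀ n m, p (ntmul R U n m)) (t) : p t := by
  obtain ⟨t, rfl⟩ := Submodule.mkQ_surjective _ t
  induction t with
  | zero => rw [map_zero]; exact h0
  | add s t hs ht => rw [map_add]; exact hadd _ _ hs ht
  | tmul n m => exact h n m

theorem ntmul_add (n : N) (m m' : M) :
    ntmul R U n (m + m') = ntmul R U n m + ntmul R U n m' := by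
  rw [ntmul, TensorProduct.tmul_add, map_add]; rfl

theorem ntmul_zero (n : N) : ntmul R U n (0 : M) = 0 := by
  rw [ntmul, TensorProduct.tmul_zero, map_zero]

variable [Algebra R U] [IsScalarTower R Uᵐᵒᵖ N]
variable {N' : Type u} [AddCommGroup N'] [Module R N'] [Module Uᵐᵒᵖ N'] [IsScalarTower R Uᵐᵒᵖ N']
  {M' : Type u} [AddCommGroup M'] [Module U M']

variable (R) in
/-- The map `f ⊗ g` on the tensor product over `ℤ`. -/
def nTensorMapAux (f : N →ₗ[Uᵐᵒᵖ] N') (g : M →ₗ[U] M') : N ⊗[ℤ] M →ₗ[R] N' ⊗[ℤ] M' :=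
  { TensorProduct.map (f.toAddMonoidHom.toIntLinearMap) (g.toAddMonoidHom.toIntLinearMap) with
    map_smul' := by
      intro r t
      change TensorProduct.map (f.toAddMonoidHom.toIntLinearMap) (g.toAddMonoidHom.toIntLinearMap)
        (r • t) = r • TensorProduct.map (f.toAddMonoidHom.toIntLinearMap)
          (g.toAddMonoidHom.toIntLinearMap) t
      induction t with
      | zero => simp
      | add s t hs ht => rw [smul_add, map_add, hs, ht, map_add, smul_add]
      | tmul n m =>
        change (f.restrictScalars R (r • n)) ⊗ₜ[ℤ] g m = (r • f n) ⊗ₜ[ℤ] g m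
        rw [map_smul]; rfl }

variable (R) in
/-- The map `f ⊗ g : N ⊗_U M → N' ⊗_U M'`. -/
def nTensorMap (f : N →ₗ[Uᵐᵒᵖ] N') (g : M →ₗ[U] M') : NTensor R U N M →ₗ[R] NTensor R U N' M' :=
  Submodule.mapQ _ _ (nTensorMapAux R f g) (by
    rw [nTensorRel, Submodule.span_le]
    rintro _ ⟨⟨n, u, m⟩, rfl⟩
    change nTensorMapAux R f g _ ∈ nTensorRel R U N' M'
    rw [map_sub]
    change f (MulOpposite.op u • n) ⊗ₜ[ℤ] g m - f n ⊗ₜ[ℤ] g (u • m) ∈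
      nTensorRel R U N' M'
    rw [map_smul, map_smul]
    exact Submodule.subset_span ⟨(f n, u, g m), rfl⟩)

@[simp] theorem nTensorMap_ntmul (f : N →ₗ[Uᵐᵒᵖ] N') (g : M →ₗ[U] M') (n : N) (m : M) :
    nTensorMap R f g (ntmul R U n m) = ntmul R U (f n) (g m) := rfl

variable (R U N) in
/-- The functor `N ⊗_U -` from left `U`-modules to `R`-modules. -/
def nTensorFunctor : ModuleCat.{u} U ⥤ ModuleCat.{u} R where
  obj M := ModuleCat.of R (NTensor R U N M)
  map g := ModuleCat.ofHom (nTensorMap R LinearMap.id g.hom)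
  map_id M := by
    apply ModuleCat.hom_ext; apply LinearMap.ext; intro t
    induction t using ntensor_induction with
    | h0 => exact map_zero _
    | hadd s t hs ht => rw [map_add, hs, ht, map_add]
    | h n m => rfl
  map_comp g h := by
    apply ModuleCat.hom_ext; apply LinearMap.ext; intro t
    induction t using ntensor_induction with
    | h0 => rw [map_zero, map_zero]
    | hadd s t hs ht => rw [map_add, hs, ht, map_add]
    | h n m => rfl

instance : (nTensorFunctor R U N).Additive where
  map_add {M M' g h} := by
    apply ModuleCat.hom_ext; apply LinearMap.ext; intro t
    change nTensorMap R (LinearMap.id (R := Uᵐᵒᵖ) (M := N)) (g.hom + h.hom) t =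
      nTensorMap R LinearMap.id g.hom t + nTensorMap R LinearMap.id h.hom t
    induction t using ntensor_induction with
    | h0 => simp only [map_zero, add_zero]
    | hadd s t hs ht => rw [map_add, hs, ht, map_add, map_add]; abel
    | h n m => exact ntmul_add _ _ _

variable (R U N) in
/-- `Tor_n^U(N, M)` for a right `U`-module `N` and a left `U`-module `M`. -/
def torModule (n : ℕ) (M : ModuleCat.{u} U) : ModuleCat.{u} R :=
  ((nTensorFunctor R U N).leftDerived n).obj M

/-- For a graded right `U`-module `N`, with sign operator `ε` (multiplication by `(-1)^p` on the
elements of degree `p`), the complex `N ⊗_U K`, with the differential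
`d (n ⊗ k) = (-1)^|n| n ⊗ d k` of the tensor product of `N` (with zero differential) and `K`. -/
def nTensorComplex (ε : N →ₗ[Uᵐᵒᵖ] N) (K : ChainComplex (ModuleCat.{u} U) ℕ) :
    ChainComplex (ModuleCat.{u} R) ℕ :=
  ChainComplex.of (fun n => ModuleCat.of R (NTensor R U N (K.X n)))
    (fun n => ModuleCat.ofHom (nTensorMap R ε (K.d (n + 1) n).hom))
    (fun n => by
      apply ModuleCat.hom_ext; apply LinearMap.ext; intro t
      induction t using ntensor_induction with
      | h0 => rw [map_zero, map_zero]
      | hadd s t hs ht => rw [map_add, hs, ht, map_add]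
      | h x k =>
        have h := congrArg (fun f => f.hom k) (K.d_comp_d (n + 1 + 1) (n + 1) n)
        change (K.d (n + 1) n).hom ((K.d (n + 1 + 1) (n + 1)).hom k) = 0 at h
        change ntmul R U (ε (ε x)) ((K.d (n + 1) n).hom ((K.d (n + 1 + 1) (n + 1)).hom k)) = 0
        rw [h, ntmul_zero])

/-- The element `x ⊗ k`. -/
def nTensorTmul (ε : N →ₗ[Uᵐᵒᵖ] N) (K : ChainComplex (ModuleCat.{u} U) ℕ) {n : ℕ} (x : N)
    (k : K.X n) : (nTensorComplex (R := R) ε K).X n :=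
  ntmul R U x k

end NTensor

section Main
variable {R A L B : Type u} [CommRing R] [CommRing A] [Algebra R A] [LieRing L] [LieAlgebra R L]
  [Module A L] [LieRingModule L A] [LieRinehartRing A L] [LieRinehartAlgebra R A L]
  [Ring B] [Algebra A B] [Algebra R B] [IsScalarTower R A B] [LieRingModule L B] [LieModule R L B]
  [LAlgebra A L B] {𝒢 : ℤ → Submodule A B} [GradedAlgebra 𝒢]

/-- `b ⊗ u ↦ u₀ b`, where `u₀ ∈ A` is the component of degree zero of `u`. -/
def coef (A L B : Type u) [CommRing A] [LieRing L] [Module A L] [Ring B] [Algebra A B] :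
    B ⊗[A] ExteriorAlgebra A L →ₗ[A] B :=
  (TensorProduct.rid A B).toLinearMap ∘ₗ
    (ExteriorAlgebra.algebraMapInv (M := L)).toLinearMap.lTensor B

theorem mem_bidegree_zero {p : ℤ} {x : B ⊗[A] ExteriorAlgebra A L} (hx : x ∈ bidegree L 𝒢 p 0) :
    coef A L B x ∈ 𝒢 p ∧ x = coef A L B x ⊗ₜ 1 := by
  obtain ⟨t, rfl⟩ := hx
  induction t with
  | zero => simp
  | add s t hs ht =>
    rw [map_add, map_add]
    refine ⟨add_mem hs.1 ht.1, ?_⟩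
    rw [TensorProduct.add_tmul, ← hs.2, ← ht.2]
  | tmul b w =>
    obtain ⟨w, hw⟩ := w
    have : ∃ c : A, algebraMap A _ c = w := by
      rw [ExteriorAlgebra.exteriorPower, pow_zero] at hw
      exact Submodule.mem_one.1 hw
    obtain ⟨c, rfl⟩ := this
    have hc : coef A L B (TensorProduct.map (𝒢 p).subtype (⋀[A]^0 L).subtype
        (b ⊗ₜ ⟨algebraMap A _ c, hw⟩)) = c • (b : B) := by
      simp [coef]
    rw [hc]
    refine ⟨(𝒢 p).smul_mem _ b.2, ?_⟩
    rw [TensorProduct.map_tmul, Submodule.subtype_apply, Submodule.subtype_apply]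
    change (b : B) ⊗ₜ[A] algebraMap A (ExteriorAlgebra A L) c = _
    rw [Algebra.algebraMap_eq_smul_one, TensorProduct.tmul_smul, TensorProduct.smul_tmul']

theorem tmul_mem_bidegree {p : ℤ} {q : ℕ} {b : B} {w : ExteriorAlgebra A L} (hb : b ∈ 𝒢 p)
    (hw : w ∈ ⋀[A]^q L) : b ⊗ₜ w ∈ bidegree L 𝒢 p q :=
  ⟨(⟨b, hb⟩ : 𝒢 p) ⊗ₜ (⟨w, hw⟩ : ⋀[A]^q L), rfl⟩

theorem one_mem_ext : (1 : ExteriorAlgebra A L) ∈ ⋀[A]^0 L := by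
  simp [ExteriorAlgebra.exteriorPower]

theorem ι_mem_ext (α : L) : ExteriorAlgebra.ι A α ∈ ⋀[A]^1 L := by
  rw [ExteriorAlgebra.exteriorPower, pow_one]; exact ⟨α, rfl⟩

theorem evenPart_tmul {b : B} (hb : b ∈ 𝒢 0) (w : ExteriorAlgebra A L) :
    evenPart L 𝒢 (b ⊗ₜ w) = b ⊗ₜ w := by
  simp [evenPart, gradeScale_of_mem 𝒢 _ hb]

theorem oddPart_tmul {b : B} (hb : b ∈ 𝒢 0) (w : ExteriorAlgebra A L) :
    oddPart L 𝒢 (b ⊗ₜ w) = 0 := by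
  simp [oddPart, gradeScale_of_mem 𝒢 _ hb]

theorem gmul_tmul (b : B) {b' : B} (hb : b' ∈ 𝒢 0) (w w' : ExteriorAlgebra A L) :
    gmul 𝒢 (b ⊗ₜ w) (b' ⊗ₜ w') = (b * b') ⊗ₜ (w * w') := by
  rw [gmul, evenPart_tmul hb, oddPart_tmul hb, mul_zero, add_zero,
    Algebra.TensorProduct.tmul_mul_tmul]

theorem lie_one (A : Type u) {L B : Type u} [CommRing A] [LieRing L] [Module A L]
    [LieRingModule L A] [Ring B] [Algebra A B] [LieRingModule L B] [LAlgebra A L B] (α : L) : ⁅α, (1 : B)⁆ = 0 := by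
  have := LAlgebra.lie_mul (A := A) α (1 : B) 1
  simpa using this

theorem bracket_one_ι (b : B) (α : L) :
    bracket R 𝒢 (b ⊗ₜ 1) (1 ⊗ₜ ExteriorAlgebra.ι A α) = -(⁅α, b⁆ ⊗ₜ 1) := by
  rw [bracket, evenPart_tmul SetLike.GradedOne.one_mem, oddPart_tmul SetLike.GradedOne.one_mem,
    map_zero, sub_zero, brUnsigned, ← map_one (extProj R A L), descend_tmul]
  simp only [brAux, LinearMap.mk₂_apply, brExt_one, mul_zero, zero_add, Module.End.mul_apply,
    LinearMap.mulLeft_apply, brFun_tmul, map_one]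
  rw [← mul_one (ExteriorAlgebra.ι A α), contrForm_ι_mul, contrForm_one, map_zero, sub_zero]
  simp

theorem bracket_ι_ι (α β : L) :
    bracket R 𝒢 ((1 : B) ⊗ₜ ExteriorAlgebra.ι A α) (1 ⊗ₜ ExteriorAlgebra.ι A β) =
      1 ⊗ₜ ExteriorAlgebra.ι A ⁅α, β⁆ := by
  rw [bracket, evenPart_tmul SetLike.GradedOne.one_mem, oddPart_tmul SetLike.GradedOne.one_mem,
    map_zero, sub_zero, brUnsigned, ← extProj_ι (R := R), descend_tmul]
  simp only [brAux, LinearMap.mk₂_apply, LinearMap.add_apply, Module.End.mul_apply,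
    LinearMap.mulLeft_apply, brFun_tmul]
  have h : contrForm R A L B (ExteriorAlgebra.ι A β) 1 = 0 := by
    rw [← mul_one (ExteriorAlgebra.ι A β), contrForm_ι_mul, contrForm_one, lie_one A]; simp
  have h2 : ∀ t : B ⊗[A] ExteriorAlgebra A L,
      brExt R A L B (ExteriorAlgebra.ι R α) t = lieE R A L B α t := by
    intro t
    rw [← mul_one (ExteriorAlgebra.ι R α), brExt_ι_mul, brExt_one]
    simp [← Algebra.TensorProduct.one_def]
  rw [h2, ← extProj_ι (R := R) β, lieE_tmul, lie_one A, ← mul_one (ExteriorAlgebra.ι R β),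
    lieExt_ι_mul, lieExt_one]
  simp [h, ← Algebra.TensorProduct.one_def]

namespace IsExactGenerator
variable {D : B ⊗[A] ExteriorAlgebra A L →ₗ[R] B ⊗[A] ExteriorAlgebra A L}

variable (D) in
/-- `α ↦ D α ∈ B`, for `α ∈ L`. -/
def form : L →ₗ[R] B :=
  ((coef A L B).restrictScalars R ∘ₗ D) ∘ₗ
    (((TensorProduct.mk A B (ExteriorAlgebra A L) 1) ∘ₗ ExteriorAlgebra.ι A).restrictScalars R)

theorem form_apply (α : L) : form D α = coef A L B (D (1 ⊗ₜ ExteriorAlgebra.ι A α)) := rfl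

theorem D_ι (hD : IsExactGenerator 𝒢 D) (α : L) : D (1 ⊗ₜ ExteriorAlgebra.ι A α) = form D α ⊗ₜ 1 :=
  (mem_bidegree_zero (hD.mem_bidegree 0 0 _
    (tmul_mem_bidegree SetLike.GradedOne.one_mem (ι_mem_ext α)))).2

theorem form_mem (hD : IsExactGenerator 𝒢 D) (α : L) : form D α ∈ 𝒢 0 :=
  (mem_bidegree_zero (hD.mem_bidegree 0 0 _
    (tmul_mem_bidegree SetLike.GradedOne.one_mem (ι_mem_ext α)))).1

theorem D_tmul_ι (hD : IsExactGenerator 𝒢 D) {b : B} (hb : b ∈ 𝒢 0) (α : L) :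
    D (b ⊗ₜ ExteriorAlgebra.ι A α) = (b * form D α - ⁅α, b⁆) ⊗ₜ 1 := by
  have h := hD.generates 0 0 0 1 (b ⊗ₜ 1) (tmul_mem_bidegree hb one_mem_ext)
    (1 ⊗ₜ ExteriorAlgebra.ι A α) (tmul_mem_bidegree SetLike.GradedOne.one_mem (ι_mem_ext α))
  rw [bracket_one_ι, gmul_tmul _ SetLike.GradedOne.one_mem, hD.bidegree_zero 0 (b ⊗ₜ 1)
    (tmul_mem_bidegree hb one_mem_ext), hD.D_ι, gmul_tmul _ (hD.form_mem α)] at h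
  simp only [gmul, zero_mul, map_zero, add_zero, sub_zero, one_mul, mul_one, Nat.cast_zero,
    Int.negOnePow_zero, one_smul] at h
  rw [TensorProduct.sub_tmul, sub_eq_add_neg, h]
  abel

theorem form_smul (hD : IsExactGenerator 𝒢 D) (c : A) (α : L) :
    form D (c • α) = c • form D α - algebraMap A B ⁅α, c⁆ := by
  have hc : algebraMap A B c ∈ 𝒢 0 := SetLike.algebraMap_mem_graded 𝒢 c
  have h := congrArg (coef A L B) (hD.D_tmul_ι hc α)
  rw [form_apply, map_smul, TensorProduct.tmul_smul, TensorProduct.smul_tmul',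
    ← Algebra.algebraMap_eq_smul_one, h, LAlgebra.lie_algebraMap, ← Algebra.smul_def]
  simp [coef]

theorem form_lie (hD : IsExactGenerator 𝒢 D) (h𝒢 : IsGradedLAlgebra L 𝒢) (α β : L) :
    form D ⁅α, β⁆ = ⁅α, form D β⁆ - ⁅β, form D α⁆ := by
  have h := hD.generates 0 0 1 1 _ (tmul_mem_bidegree SetLike.GradedOne.one_mem (ι_mem_ext α))
    _ (tmul_mem_bidegree SetLike.GradedOne.one_mem (ι_mem_ext β))
  rw [bracket_ι_ι, hD.D_ι, hD.D_ι, gmul_tmul _ SetLike.GradedOne.one_mem,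
    gmul_tmul _ SetLike.GradedOne.one_mem, gmul_tmul _ (hD.form_mem β)] at h
  simp only [zero_add, Nat.cast_one, Int.negOnePow_one, Units.neg_smul, one_smul, mul_one,
    one_mul, sub_neg_eq_add] at h
  have h2 := congrArg D h
  rw [map_neg, map_add, map_sub, hD.exact, hD.D_ι, hD.D_tmul_ι (hD.form_mem _),
    hD.D_tmul_ι (hD.form_mem _)] at h2
  have h3 := congrArg (coef A L B) h2
  have hcomm : form D α * form D β = form D β * form D α := by
    have := h𝒢.mul_comm 0 0 _ _ (hD.form_mem α) (hD.form_mem β)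
    simpa using this
  have hco : ∀ b : B, coef A L B (b ⊗ₜ 1) = b := by intro b; simp [coef]
  simp only [map_neg, map_add, map_sub, map_zero, hco, hcomm] at h3
  rw [h3]; abel

/-- The right `(A, L)`-module `B_D`, given by `b ∘ α = b (D α) - α(b)`. -/
def rightModule (hD : IsExactGenerator 𝒢 D) (h𝒢 : IsGradedLAlgebra L 𝒢) : RightALModule R A L B where
  act := LinearMap.mk₂ R (fun α b => b * form D α - ⁅α, b⁆)
    (by intro α β b; rw [map_add, mul_add, add_lie]; abel)
    (by intro r α b; rw [map_smul, mul_smul_comm, smul_lie, smul_sub])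
    (by intro α b b'; rw [add_mul, lie_add]; abel)
    (by intro r α b; rw [smul_mul_assoc, lie_smul, smul_sub])
  act_smul α a b := by
    simp only [LinearMap.mk₂_apply, lie_smul_B, smul_mul_assoc, smul_sub]; abel
  smul_act α a b := by
    simp only [LinearMap.mk₂_apply, hD.form_smul, LAlgebra.smul_lie, mul_sub, mul_smul_comm,
      smul_sub, Algebra.smul_def ⁅α, a⁆ b, Algebra.commutes]
    abel
  lie_act α β b := by
    have hcomm : form D α * form D β = form D β * form D α := by
      have := h𝒢.mul_comm 0 0 _ _ (hD.form_mem α) (hD.form_mem β)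
      simpa using this
    simp only [LinearMap.mk₂_apply, hD.form_lie h𝒢, lie_sub, LAlgebra.lie_mul (A := A), sub_mul,
      mul_sub, mul_assoc, hcomm, lie_lie]
    abel

theorem rightModule_act (hD : IsExactGenerator 𝒢 D) (h𝒢 : IsGradedLAlgebra L 𝒢) (α : L) (b : B) :
    (hD.rightModule h𝒢).act α b = b * form D α - ⁅α, b⁆ := rfl

theorem act_mem (hD : IsExactGenerator 𝒢 D) (h𝒢 : IsGradedLAlgebra L 𝒢) {p : ℤ} (α : L) {b : B} (hb : b ∈ 𝒢 p) :
    (hD.rightModule h𝒢).act α b ∈ 𝒢 p := by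
  have h := SetLike.mul_mem_graded hb (hD.form_mem α)
  rw [add_zero] at h
  exact sub_mem h (h𝒢.lie_mem p α b hb)

/-- The part of degree `p` of the right `(A, L)`-module `B_D`. -/
def rightModulePart (hD : IsExactGenerator 𝒢 D) (h𝒢 : IsGradedLAlgebra L 𝒢) (p : ℤ) : RightALModule R A L (𝒢 p) where
  act := LinearMap.mk₂ R
    (fun α b => ⟨(hD.rightModule h𝒢).act α b, hD.act_mem h𝒢 α b.2⟩)
    (by intro α β b; apply Subtype.ext; simp)
    (by intro r α b; apply Subtype.ext; simp)
    (by intro α b b'; apply Subtype.ext; simp)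
    (by intro r α b; apply Subtype.ext; simp)
  act_smul α a b := Subtype.ext ((hD.rightModule h𝒢).act_smul α a b)
  smul_act α a b := Subtype.ext ((hD.rightModule h𝒢).smul_act α a b)
  lie_act α β b := Subtype.ext ((hD.rightModule h𝒢).lie_act α β b)

theorem gradeScale_mem (f : ℤ → ℤ) (b : B) {p : ℤ} {b' : B} (hb : b' ∈ 𝒢 0) :
    gradeScale 𝒢 f (b * b') = gradeScale 𝒢 f b * b' := by
  induction b using DirectSum.Decomposition.inductionOn 𝒢 with
  | zero => simp
  | homogeneous b =>
    have h := SetLike.mul_mem_graded b.2 hb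
    rw [add_zero] at h
    rw [gradeScale_of_mem 𝒢 f h, gradeScale_of_mem 𝒢 f b.2, smul_mul_assoc]
  | add b c hb hc => rw [add_mul, map_add, hb, hc, map_add, add_mul]

theorem gradeScale_lie (h𝒢 : IsGradedLAlgebra L 𝒢) (f : ℤ → ℤ) (α : L) (b : B) :
    gradeScale 𝒢 f ⁅α, b⁆ = ⁅α, gradeScale 𝒢 f b⁆ := by
  induction b using DirectSum.Decomposition.inductionOn 𝒢 with
  | zero => simp
  | homogeneous b =>
    rw [gradeScale_of_mem 𝒢 f (h𝒢.lie_mem _ α _ b.2), gradeScale_of_mem 𝒢 f b.2, lie_zsmul]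
  | add b c hb hc => rw [lie_add, map_add, hb, hc, map_add, lie_add]

/-- The sign operator `b ↦ (-1)^|b| b` of `B_D`. -/
def sign (hD : IsExactGenerator 𝒢 D) (h𝒢 : IsGradedLAlgebra L 𝒢) :
    (hD.rightModule h𝒢).Carrier →ₗ[(UAlg R A L)ᵐᵒᵖ] (hD.rightModule h𝒢).Carrier :=
  RightALModule.map _ _ (gradeScale 𝒢 (fun p => (p.negOnePow : ℤ))) (by
    intro α b
    rw [hD.rightModule_act, hD.rightModule_act, map_sub, gradeScale_lie h𝒢,
      gradeScale_mem _ _ (p := 0) (hD.form_mem α)])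

theorem D_mem (hD : IsExactGenerator 𝒢 D) (n : ℕ) {x : B ⊗[A] ExteriorAlgebra A L} (hx : x ∈ extDegree A L B (n + 1)) :
    D x ∈ extDegree A L B n := by
  obtain ⟨t, rfl⟩ := hx
  induction t with
  | zero => simp
  | add s t hs ht => rw [map_add, map_add]; exact add_mem hs ht
  | tmul b w =>
    induction b using DirectSum.Decomposition.inductionOn 𝒢 with
    | zero => simp
    | @homogeneous p b =>
      obtain ⟨s, hs⟩ := hD.mem_bidegree p n ((b : B) ⊗ₜ (w : ExteriorAlgebra A L))
        (tmul_mem_bidegree b.2 w.2)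
      refine ⟨(𝒢 p).subtype.rTensor _ s, ?_⟩
      rw [LinearMap.lTensor_tmul, Submodule.subtype_apply, ← hs, ← LinearMap.comp_apply,
        LinearMap.lTensor_comp_rTensor]
    | add b c hb hc => rw [TensorProduct.add_tmul, map_add, map_add]; exact add_mem hb hc

end IsExactGenerator

/-- The chain complex underlying `(B ⊗_A ⋀_A L, D)`, with `B ⊗_A ⋀^n L` in degree `n`. -/
def bvComplex {D : B ⊗[A] ExteriorAlgebra A L →ₗ[R] B ⊗[A] ExteriorAlgebra A L}
    (hD : IsExactGenerator 𝒢 D) : ChainComplex (ModuleCat.{u} R) ℕ :=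
  ChainComplex.of (fun n => ModuleCat.of R (extDegree A L B n))
    (fun n => ModuleCat.ofHom
      (D.restrict (p := (extDegree A L B (n + 1)).restrictScalars R)
        (q := (extDegree A L B n).restrictScalars R) (fun _ hx => hD.D_mem n hx)))
    (fun n => by
      apply ModuleCat.hom_ext; apply LinearMap.ext; intro x
      exact Subtype.ext (hD.exact x.1))

/-- The part of degree `p` in the grading of `B` of the chain complex underlying
`(B ⊗_A ⋀_A L, D)`. -/
def bvComplexPart {D : B ⊗[A] ExteriorAlgebra A L →ₗ[R] B ⊗[A] ExteriorAlgebra A L}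
    (hD : IsExactGenerator 𝒢 D) (p : ℤ) : ChainComplex (ModuleCat.{u} R) ℕ :=
  ChainComplex.of (fun n => ModuleCat.of R (bidegree L 𝒢 p n))
    (fun n => ModuleCat.ofHom
      (D.restrict (p := (bidegree L 𝒢 p (n + 1)).restrictScalars R)
        (q := (bidegree L 𝒢 p n).restrictScalars R) (fun _ hx => hD.mem_bidegree p n _ hx)))
    (fun n => by
      apply ModuleCat.hom_ext; apply LinearMap.ext; intro x
      exact Subtype.ext (hD.exact x.1))

/-- The element `b ⊗ w` of `B ⊗_A ⋀^n L`. -/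
def bvTmul {D : B ⊗[A] ExteriorAlgebra A L →ₗ[R] B ⊗[A] ExteriorAlgebra A L}
    (hD : IsExactGenerator 𝒢 D) {n : ℕ} (b : B) (w : ⋀[A]^n L) : (bvComplex hD).X n :=
  (⟨b ⊗ₜ (w : ExteriorAlgebra A L), tmul_mem_extDegree b w.2⟩ : extDegree A L B n)

/-- The element `b ⊗ w` of the part of bidegree `(p, n)` of `B ⊗_A ⋀_A L`. -/
def bvTmulPart {D : B ⊗[A] ExteriorAlgebra A L →ₗ[R] B ⊗[A] ExteriorAlgebra A L}
    (hD : IsExactGenerator 𝒢 D) {p : ℤ} {n : ℕ} (b : 𝒢 p) (w : ⋀[A]^n L) :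
    (bvComplexPart hD p).X n :=
  (⟨(b : B) ⊗ₜ (w : ExteriorAlgebra A L), tmul_mem_bidegree b.2 w.2⟩ : bidegree L 𝒢 p n)

end Main

end LRBV

end

open LRBV CategoryTheory

open scoped TensorProduct

set_option linter.unusedSectionVars false
set_option linter.unusedSimpArgs false
set_option linter.overlappingInstances false

noncomputable section

/-! Part 1. The generating identity determines `∂` recursively. Applied to `b ⊗ α` with `|b| = p`
and to `1 ⊗ x`, it gives `(-1)^p ∂(b ⊗ α ∧ x) = (b ∘ α) ⊗ x - b ⊗ L_α x - α ∧ (-1)^p ∂(b ⊗ x)`, and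
`∂(b ⊗ 1) = 0` for reasons of degree. The Chevalley–Eilenberg operator of the right module `𝒜_∂`
obeys the same recursion, so `∂` is that operator composed with the sign `(-1)^|b|` (`D_eq`). On the
other side `N ⊗_U (U ⊗_A ⋀^n L)` is `N ⊗_A ⋀^n L` for every right module `N`. Since `u ↦ n u` is a
homomorphism of right modules `U → N`, naturality turns the Rinehart differential into the
Chevalley–Eilenberg operator of `N`.

Part 2 needs the Rinehart complex to be a projective resolution of `A` when `L` is projective. A
classical proof filters `U(A, L)` and invokes the Poincaré–Birkhoff–Witt theorem. Here `U` is
deformed instead. The homogenized algebra `H = HAlg` has a central parameter `η` and the relations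
`αβ - βα = η[α, β]`, `αa - aα = η α(a)`. It is graded, with `L` and `η` in degree one. Universal
properties alone give `H/(η - 1) = U` and `H/(η) = Sym_A L`.

The complex `H ⊗_A ⋀ L` reduces modulo `η` to the Koszul complex, which is exact away from the
constants (`koszul_exact`). Once `η` is known to be injective, successive approximation by powers of
`η`, finite in each degree, shows that every cycle of `H ⊗_A ⋀ L` is `u ⊗ 1` plus a boundary
(`exact_diff`). Multiplication by `η - 1` is injective by a degree argument, and reduction modulo `η
- 1` carries the result to `U` (`rinehartDiff_exact`).

Injectivity of `η` (`η_injective`) takes the place of Poincaré–Birkhoff–Witt. Extending the cokernel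
of the differential by `A[η]` to a representation of `H` shows, for every `L`, that `H = A[η] ⊕ HL`
and that the kernel of `u ⊗ α ↦ uα` consists of boundaries (`of_ofSeq_add_mulL_eq_zero`). If `ηu =
0`, this fact, Koszul exactness and flatness of `⋀ L` exhibit `u ⊗ 1` as the boundary of an element
with coefficients in `ker η`. As the differential raises the degree by one, the homogeneous
components of `u` vanish one after another. -/

namespace LRBV

open CategoryTheory

/-! ### The Chevalley–Eilenberg operator with a parameter scaling the bracket. -/

section ParamCE
variable {R L N : Type u} [CommRing R] [LieRing L] [LieAlgebra R L]
  [AddCommGroup N] [Module R N]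

/-- Input of the recursion defining `pceDiff`. -/
def pceAux (η : N →ₗ[R] N) (r : L →ₗ[R] N →ₗ[R] N) :
    L →ₗ[R] (ExteriorAlgebra R L × (N →ₗ[R] N ⊗[R] ExteriorAlgebra R L)) →ₗ[R]
      (N →ₗ[R] N ⊗[R] ExteriorAlgebra R L) :=
  LinearMap.mk₂ R
    (fun m p => (TensorProduct.mk R N _).flip p.1 ∘ₗ r m
      - (TensorProduct.mk R N _).flip (lieExt R L p.1 m) ∘ₗ η - ceMul R N m ∘ₗ p.2)
    (by intro m m' p; ext n; simp [TensorProduct.add_tmul, TensorProduct.tmul_add]; abel)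
    (by intro c m p; ext n
        simp [smul_sub, TensorProduct.smul_tmul])
    (by intro m p p'; ext n; simp [TensorProduct.tmul_add]; abel)
    (by intro c m p; ext n; simp [smul_sub])

/-- This compatibility with `α ∧ α = 0` makes the recursion well defined on the exterior algebra.
Because `[α, α] = 0`, the Lie derivative `L_α` commutes with `α ∧ ·`, so the first two terms cancel
between the two applications, and the last term dies with `α ∧ α`. -/
theorem pceAux_pceAux (η : N →ₗ[R] N) (r : L →ₗ[R] N →ₗ[R] N) (m : L) (x : ExteriorAlgebra R L)
    (T : N →ₗ[R] N ⊗[R] ExteriorAlgebra R L) :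
    pceAux η r m (ExteriorAlgebra.ι R m * x, pceAux η r m (x, T)) = 0 := by
  have h2 := ExteriorAlgebra.ι_sq_zero (R := R) m
  have h3 : ∀ t, ceMul R N m (ceMul R N m t) = 0 := by
    intro t
    induction t with
    | zero => simp
    | add s t hs ht => simp [hs, ht]
    | tmul n x => simp [← mul_assoc, h2]
  ext n
  simp [pceAux, lieExt_ι_mul, h3]

/-- The Chevalley--Eilenberg operator in which the bracket of `L` is scaled by an endomorphism `η`
of `N`: `d(n ⊗ 1) = 0` and `d(n ⊗ α ∧ x) = nα ⊗ x - η n ⊗ L_α x - α ∧ d(n ⊗ x)`. -/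
def pceDiff (η : N →ₗ[R] N) (r : L →ₗ[R] N →ₗ[R] N) :
    ExteriorAlgebra R L →ₗ[R] N →ₗ[R] N ⊗[R] ExteriorAlgebra R L :=
  CliffordAlgebra.foldr' 0 (pceAux η r)
    (by intro m x T; simpa using pceAux_pceAux η r m x T) 0

theorem pceDiff_one (η : N →ₗ[R] N) (r : L →ₗ[R] N →ₗ[R] N) (n : N) : pceDiff η r 1 n = 0 := by
  have := CliffordAlgebra.foldr'_algebraMap (Q := (0 : QuadraticForm R L)) (pceAux η r)
    (by intro m x T; simpa using pceAux_pceAux η r m x T) 0 1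
  rw [map_one] at this
  rw [pceDiff, this]; simp

theorem pceDiff_ι_mul (η : N →ₗ[R] N) (r : L →ₗ[R] N →ₗ[R] N) (m : L) (x : ExteriorAlgebra R L)
    (n : N) :
    pceDiff η r (ExteriorAlgebra.ι R m * x) n =
      r m n ⊗ₜ x - η n ⊗ₜ lieExt R L x m - ceMul R N m (pceDiff η r x n) := by
  rw [pceDiff, CliffordAlgebra.foldr'_ι_mul]; rfl

theorem pceDiff_id (r : L →ₗ[R] N →ₗ[R] N) (x : ExteriorAlgebra R L) (n : N) :
    pceDiff LinearMap.id r x n = ceDiff r x n := by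
  induction x using extR_induction with
  | h0 => simp
  | h1 => simp [ceDiff_one, pceDiff_one]
  | hadd x y hx hy => simp only [map_add, LinearMap.add_apply, hx, hy]
  | hsmul c x hx => simp only [map_smul, LinearMap.smul_apply, hx]
  | hι m x hx => rw [pceDiff_ι_mul, ceDiff_ι_mul, hx]; rfl

/-- `pceDiff` as an endomorphism. -/
def pceTot (η : N →ₗ[R] N) (r : L →ₗ[R] N →ₗ[R] N) :
    N ⊗[R] ExteriorAlgebra R L →ₗ[R] N ⊗[R] ExteriorAlgebra R L :=
  TensorProduct.lift (pceDiff η r).flip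

@[simp] theorem pceTot_tmul (η : N →ₗ[R] N) (r : L →ₗ[R] N →ₗ[R] N) (n : N)
    (x : ExteriorAlgebra R L) : pceTot η r (n ⊗ₜ x) = pceDiff η r x n := rfl

/-- The Lie derivative `n ⊗ x ↦ n α ⊗ x - η n ⊗ L_α x`. -/
def pceLie (η : N →ₗ[R] N) (r : L →ₗ[R] N →ₗ[R] N) (α : L) :
    N ⊗[R] ExteriorAlgebra R L →ₗ[R] N ⊗[R] ExteriorAlgebra R L :=
  (r α).rTensor _ - TensorProduct.map η ((lieExt R L).flip α)

@[simp] theorem pceLie_tmul (η : N →ₗ[R] N) (r : L →ₗ[R] N →ₗ[R] N) (α : L) (n : N)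
    (x : ExteriorAlgebra R L) :
    pceLie η r α (n ⊗ₜ x) = r α n ⊗ₜ x - η n ⊗ₜ lieExt R L x α := rfl

/-- Cartan's formula: the Lie derivative is the anticommutator of the differential and `α ∧ ·`. It
is the defining recursion, read on tensors. -/
theorem pceTot_ceMul (η : N →ₗ[R] N) (r : L →ₗ[R] N →ₗ[R] N) (m : L)
    (t : N ⊗[R] ExteriorAlgebra R L) :
    pceTot η r (ceMul R N m t) = pceLie η r m t - ceMul R N m (pceTot η r t) := by
  induction t with
  | zero => simp
  | add s t hs ht => simp only [map_add, hs, ht]; abel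
  | tmul n x => simp [pceDiff_ι_mul]

theorem pceLie_ceMul (η : N →ₗ[R] N) (r : L →ₗ[R] N →ₗ[R] N) (α m : L)
    (t : N ⊗[R] ExteriorAlgebra R L) :
    pceLie η r α (ceMul R N m t) =
      ceMul R N m (pceLie η r α t) - ceMul R N ⁅α, m⁆ (η.rTensor _ t) := by
  induction t with
  | zero => simp
  | add s t hs ht => simp only [map_add, hs, ht]; abel
  | tmul n x => simp [lieExt_ι_mul, TensorProduct.tmul_add]; abel

theorem ceMul_rTensor {M : Type u} [AddCommGroup M] [Module R M] (f : N →ₗ[R] M) (m : L)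
    (t : N ⊗[R] ExteriorAlgebra R L) :
    f.rTensor _ (ceMul R N m t) = ceMul R M m (f.rTensor _ t) := by
  induction t with
  | zero => simp
  | add s t hs ht => simp only [map_add, hs, ht]
  | tmul n x => simp

/-- Naturality with two maps: `f` acts before the differential and `g` after it, and each use of `η`
or of the action of `L` trades one for the other. Taking for `f`, `g` the projections to degrees `n`
and `n + 1` of `HAlg` expresses that the differential raises the degree by one. -/
theorem pceDiff_comm {M : Type u} [AddCommGroup M] [Module R M] (η : N →ₗ[R] N)
    (r : L →ₗ[R] N →ₗ[R] N) (η' : M →ₗ[R] M) (r' : L →ₗ[R] M →ₗ[R] M)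
    (f g : N →ₗ[R] M) (hη : ∀ n, g (η n) = η' (f n)) (hf : ∀ α n, g (r α n) = r' α (f n))
    (x : ExteriorAlgebra R L) (n : N) :
    pceDiff η' r' x (f n) = g.rTensor _ (pceDiff η r x n) := by
  induction x using extR_induction with
  | h0 => simp
  | h1 => simp [pceDiff_one]
  | hadd x y hx hy => simp only [map_add, LinearMap.add_apply, hx, hy]
  | hsmul c x hx => simp only [map_smul, LinearMap.smul_apply, hx]
  | hι m x hx =>
    simp only [pceDiff_ι_mul, hx, map_sub, LinearMap.rTensor_tmul, hf, hη, ceMul_rTensor]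

/-- The bracket relation for the Lie derivatives, in homogeneous form: the additional `η` on the
left makes both sides quadratic in `η` and the action. -/
theorem pceLie_lie (η : N →ₗ[R] N) (r : L →ₗ[R] N →ₗ[R] N) (hη : ∀ α n, η (r α n) = r α (η n))
    (hr : ∀ α β n, η (r ⁅α, β⁆ n) = r β (r α n) - r α (r β n)) (α β : L)
    (t : N ⊗[R] ExteriorAlgebra R L) :
    pceLie η r ⁅α, β⁆ (η.rTensor _ t) =
      pceLie η r β (pceLie η r α t) - pceLie η r α (pceLie η r β t) := by
  induction t with
  | zero => simp
  | add s t hs ht => simp only [map_add, hs, ht]; abel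
  | tmul n x =>
    simp only [pceLie_tmul, map_sub, LinearMap.rTensor_tmul, ← hη, hr, lieExt_lie,
      TensorProduct.sub_tmul, TensorProduct.tmul_sub]
    abel

/-- Moving both operators past `m ∧ ·` by Cartan's formula leaves the bracket relation `pceLie_lie`
and the same claim in lower exterior degree. -/
theorem pceTot_pceLie (η : N →ₗ[R] N) (r : L →ₗ[R] N →ₗ[R] N)
    (hη : ∀ α n, η (r α n) = r α (η n))
    (hr : ∀ α β n, η (r ⁅α, β⁆ n) = r β (r α n) - r α (r β n)) (α : L) (n : N)
    (x : ExteriorAlgebra R L) :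
    pceTot η r (pceLie η r α (n ⊗ₜ x)) = pceLie η r α (pceTot η r (n ⊗ₜ x)) := by
  induction x using extR_induction with
  | h0 => simp
  | h1 => simp [pceDiff_one, lieExt_one]
  | hadd x y hx hy => simp only [TensorProduct.tmul_add, map_add, hx, hy]
  | hsmul c x hx => simp only [TensorProduct.tmul_smul, map_smul, hx]
  | hι m x hx =>
    -- The differential commutes with `η`. This matches the two terms `[α, m] ∧ ·`, in which `η`
    -- stands once inside and once outside the differential.
    have h := pceDiff_comm η r η r η η (fun _ => rfl) (fun α n => hη α n) x n
    rw [← ceMul_tmul, pceLie_ceMul, map_sub, pceTot_ceMul, pceTot_ceMul, pceTot_ceMul, hx, map_sub,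
      pceLie_ceMul, pceLie_lie η r hη hr, LinearMap.rTensor_tmul, pceTot_tmul, pceTot_tmul, h]
    abel

/-- By Cartan's formula `dd(α ∧ t) = dL_α t - L_α dt + α ∧ ddt`. The first two terms cancel by
`pceTot_pceLie` and the third vanishes by induction. -/
theorem pceTot_pceTot (η : N →ₗ[R] N) (r : L →ₗ[R] N →ₗ[R] N)
    (hη : ∀ α n, η (r α n) = r α (η n))
    (hr : ∀ α β n, η (r ⁅α, β⁆ n) = r β (r α n) - r α (r β n)) (t : N ⊗[R] ExteriorAlgebra R L) :
    pceTot η r (pceTot η r t) = 0 := by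
  induction t with
  | zero => simp
  | add s t hs ht => simp [hs, ht]
  | tmul n x =>
    induction x using extR_induction with
    | h0 => simp
    | h1 => simp [pceDiff_one]
    | hadd x y hx hy => simp only [TensorProduct.tmul_add, map_add, hx, hy, add_zero]
    | hsmul c x hx => simp only [TensorProduct.tmul_smul, map_smul, hx, smul_zero]
    | hι m x hx =>
      rw [← ceMul_tmul, pceTot_ceMul, map_sub, pceTot_ceMul, pceTot_pceLie η r hη hr, hx]
      simp

end ParamCE

/-! ### Descent of the differential from `R` to `A`. -/

section ParamModule
variable (R A L : Type u) [CommRing R] [CommRing A] [Algebra R A] [LieRing L] [LieAlgebra R L]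
  [Module A L] [LieRingModule L A] [LieRinehartRing A L] [LieRinehartAlgebra R A L]

/-- A right module over the homogenized enveloping algebra of `(A, L)`: `η` is the action of the
homogenizing parameter and `act α n` is `n α`. -/
structure ParamModule (N : Type u) [AddCommGroup N] [Module R N] [Module A N] : Type u where
  η : N →ₗ[A] N
  act : L →ₗ[R] N →ₗ[R] N
  act_smul : ∀ (α : L) (c : A) (n : N), act α (c • n) = c • act α n - ⁅α, c⁆ • η n
  smul_act : ∀ (α : L) (c : A) (n : N), act (c • α) n = act α (c • n)
  η_act : ∀ (α : L) (n : N), η (act α n) = act α (η n)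
  lie_act : ∀ (α β : L) (n : N), η (act ⁅α, β⁆ n) = act β (act α n) - act α (act β n)

variable {R A L} {N : Type u} [AddCommGroup N] [Module R N] [Module A N] [IsScalarTower R A N]

namespace ParamModule
variable (S : ParamModule R A L N)

/-- The failure of `A`-linearity in `N` comes from `act_smul` alone: each factor `α` contributes
`α(c) η`, and together these form the contraction with the differential of `c`. -/
theorem tensProj_pceDiff_smul (y : ExteriorAlgebra R L) (c : A) (n : N) :
    tensProj R A L N (pceDiff (S.η.restrictScalars R) S.act y (c • n)) =
      c • tensProj R A L N (pceDiff (S.η.restrictScalars R) S.act y n) -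
      S.η n ⊗ₜ CliffordAlgebra.contractLeft (dForm L c) (extProj R A L y) := by
  induction y using extR_induction with
  | h0 => simp
  | h1 => simp [pceDiff_one]
  | hadd x y hx hy =>
    simp only [map_add, LinearMap.add_apply, hx, hy, smul_add, TensorProduct.tmul_add]; abel
  | hsmul r x hx =>
    have : ∀ z : ExteriorAlgebra A L, r • z = algebraMap R A r • z := fun z => by simp
    simp only [map_smul, LinearMap.smul_apply, hx, smul_sub, TensorProduct.tmul_smul, smul_comm c,
      this]
    simp
  | hι k x hx =>
    simp only [pceDiff_ι_mul, map_sub, tensProj_tmul, S.act_smul, tensProj_ceMul, hx, map_mul,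
      extProj_ι, LinearMap.restrictScalars_apply, map_smul S.η,
      CliffordAlgebra.contractLeft_ι_mul, TensorProduct.sub_tmul, TensorProduct.tmul_sub, map_smul,
      smul_sub, wedgeL_tmul, TensorProduct.smul_tmul', TensorProduct.tmul_smul]
    simp only [dForm, LinearMap.coe_mk, AddHom.coe_mk]
    abel

/-- The decisive case is `x = 1`. There the term `α ∧ (contraction with dc)` arises on one side from
`L_{cα}` and on the other from the defect in `tensProj_pceDiff_smul`. Prepending a factor `k`
produces the term `k(c)` on both sides, from the Lie derivative and from `act_smul` respectively. -/
theorem balanced_pceDiff :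
    Balanced A ((tensProj R A L N).compRight R ∘ₗ pceDiff (S.η.restrictScalars R) S.act) := by
  intro x y m c n
  simp only [LinearMap.comp_apply, LinearMap.compRight_apply]
  induction x using extR_induction generalizing n with
  | h0 => simp
  | h1 =>
    simp only [one_mul, pceDiff_ι_mul, map_sub, tensProj_tmul, tensProj_ceMul,
      extProj_lieExt_smul', S.tensProj_pceDiff_smul, S.smul_act, TensorProduct.tmul_sub,
      LinearMap.restrictScalars_apply, map_smul S.η,
      TensorProduct.tmul_smul, wedgeL_tmul, TensorProduct.smul_tmul', map_smul]
    have : wedgeL A N (c • m) (tensProj R A L N (pceDiff (S.η.restrictScalars R) S.act y n)) =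
        c • wedgeL A N m (tensProj R A L N (pceDiff (S.η.restrictScalars R) S.act y n)) := by
      generalize tensProj R A L N (pceDiff (S.η.restrictScalars R) S.act y n) = t
      induction t with
      | zero => simp
      | add s t hs ht => simp [hs, ht]
      | tmul n x => simp
    rw [this]
    abel
  | hadd x y hx hy => simp only [add_mul, map_add, LinearMap.add_apply, hx, hy]
  | hsmul r x hx => simp only [smul_mul_assoc, map_smul, LinearMap.smul_apply, hx]
  | hι k x hx =>
    have e : ∀ z, ExteriorAlgebra.ι R k * x * z * y = ExteriorAlgebra.ι R k * (x * z * y) := by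
      intro z; simp only [mul_assoc]
    simp only [e, pceDiff_ι_mul, map_sub, tensProj_tmul, tensProj_ceMul, hx, extProj_lieExt_smul,
      LinearMap.restrictScalars_apply, map_smul S.η,
      S.act_smul, TensorProduct.sub_tmul, TensorProduct.tmul_add]
    simp only [map_mul, extProj_ι, map_smul, mul_smul_comm, smul_mul_assoc,
      TensorProduct.tmul_smul, TensorProduct.smul_tmul']
    abel

/-- The operator on `N ⊗_A ⋀_A L` induced by the action on `N`. -/
def diff : N ⊗[A] ExteriorAlgebra A L →ₗ[R] N ⊗[A] ExteriorAlgebra A L :=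
  descend _ S.balanced_pceDiff

theorem diff_tmul (n : N) (x : ExteriorAlgebra R L) :
    S.diff (n ⊗ₜ extProj R A L x) =
      tensProj R A L N (pceDiff (S.η.restrictScalars R) S.act x n) :=
  descend_tmul _ _ _ _

theorem diff_one (n : N) : S.diff (n ⊗ₜ 1) = 0 := by
  rw [← map_one (extProj R A L), S.diff_tmul, pceDiff_one, map_zero]

theorem diff_wedge (n : N) (α : L) (x : ExteriorAlgebra R L) :
    S.diff (n ⊗ₜ (ExteriorAlgebra.ι A α * extProj R A L x)) =
      S.act α n ⊗ₜ extProj R A L x - S.η n ⊗ₜ extProj R A L (lieExt R L x α) -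
        wedgeL A N α (S.diff (n ⊗ₜ extProj R A L x)) := by
  rw [← extProj_ι (R := R), ← map_mul, S.diff_tmul, S.diff_tmul, pceDiff_ι_mul, map_sub, map_sub,
    tensProj_ceMul]
  rfl

theorem diff_ι (n : N) (α : L) :
    S.diff (n ⊗ₜ ExteriorAlgebra.ι A α) = S.act α n ⊗ₜ 1 := by
  have h := S.diff_wedge n α 1
  rw [map_one, mul_one, S.diff_one, lieExt_one] at h
  simpa using h

/-- These boundaries encode the commutation relation of `α` and `β`; `seqTmul_lie` reads them as
identities in the cokernel. -/
theorem diff_ι_ι (n : N) (α β : L) :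
    S.diff (n ⊗ₜ (ExteriorAlgebra.ι A α * ExteriorAlgebra.ι A β)) =
      S.act α n ⊗ₜ ExteriorAlgebra.ι A β - S.act β n ⊗ₜ ExteriorAlgebra.ι A α -
        S.η n ⊗ₜ ExteriorAlgebra.ι A ⁅α, β⁆ := by
  have h := S.diff_wedge n α (ExteriorAlgebra.ι R β)
  have h2 : lieExt R L (ExteriorAlgebra.ι R β) α = ExteriorAlgebra.ι R ⁅α, β⁆ := by
    rw [← mul_one (ExteriorAlgebra.ι R β), lieExt_ι_mul, lieExt_one]; simp
  rw [h2, extProj_ι, extProj_ι, S.diff_ι, wedgeL_tmul, mul_one] at h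
  rw [h]; abel

theorem diff_tensProj (t : N ⊗[R] ExteriorAlgebra R L) :
    S.diff (tensProj R A L N t) =
      tensProj R A L N (pceTot (S.η.restrictScalars R) S.act t) := by
  induction t with
  | zero => simp
  | add s t hs ht => simp only [map_add, hs, ht]
  | tmul n x => exact S.diff_tmul n x

theorem diff_diff (t : N ⊗[A] ExteriorAlgebra A L) : S.diff (S.diff t) = 0 := by
  refine tmul_induction (R := R) (p := fun t => S.diff (S.diff t) = 0)
    (by simp) (fun s t hs ht => by simp only [map_add, hs, ht, add_zero]) (fun n x => ?_) t
  rw [diff_tmul, diff_tensProj, ← pceTot_tmul,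
    pceTot_pceTot (S.η.restrictScalars R) S.act S.η_act S.lie_act, map_zero]

theorem diff_rTensor {M : Type u} [AddCommGroup M] [Module R M] [Module A M]
    [IsScalarTower R A M] (S' : ParamModule R A L M) (f g : N →ₗ[A] M)
    (hη : ∀ n, g (S.η n) = S'.η (f n)) (hf : ∀ α n, g (S.act α n) = S'.act α (f n))
    (t : N ⊗[A] ExteriorAlgebra A L) :
    S'.diff (f.rTensor _ t) = g.rTensor _ (S.diff t) := by
  refine tmul_induction (R := R) (p := fun t => S'.diff (f.rTensor _ t) = g.rTensor _ (S.diff t))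
    (by simp) (fun s t hs ht => by simp only [map_add, hs, ht]) (fun n x => ?_) t
  rw [LinearMap.rTensor_tmul, diff_tmul, diff_tmul]
  have := pceDiff_comm (S.η.restrictScalars R) S.act (S'.η.restrictScalars R) S'.act
    (f.restrictScalars R) (g.restrictScalars R) hη hf x n
  rw [LinearMap.restrictScalars_apply] at this
  rw [this]
  generalize pceDiff (S.η.restrictScalars R) S.act x n = t
  induction t with
  | zero => simp
  | add s t hs ht => simp only [map_add, hs, ht]
  | tmul n x => simp

theorem diff_eq_connDiff (hη : S.η = LinearMap.id) (h1 h2) (t : N ⊗[A] ExteriorAlgebra A L) :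
    S.diff t = connDiff S.act h1 h2 t := by
  refine tmul_induction (R := R) (p := fun t => S.diff t = connDiff S.act h1 h2 t)
    (by simp) (fun s t hs ht => by simp only [map_add, hs, ht]) (fun n x => ?_) t
  rw [diff_tmul, connDiff_tmul, hη, ← pceDiff_id]
  rfl

end ParamModule
end ParamModule

/-! ### Exactness of the Koszul complex of a projective module. -/

section Koszul
variable {A V W : Type u} [CommRing A] [AddCommGroup V] [Module A V] [AddCommGroup W] [Module A W]

variable (A V) in
/-- The module underlying the Koszul complex of `V`. -/
abbrev Koszul : Type u := SymmetricAlgebra A V ⊗[A] ExteriorAlgebra A V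

/-- Input of the recursion defining `koszulAt`. -/
def koszulAux : V →ₗ[A] (ExteriorAlgebra A V × (SymmetricAlgebra A V →ₗ[A] Koszul A V)) →ₗ[A]
    (SymmetricAlgebra A V →ₗ[A] Koszul A V) :=
  LinearMap.mk₂ A
    (fun m p => (TensorProduct.mk A _ _).flip p.1 ∘ₗ LinearMap.mulRight A (SymmetricAlgebra.ι A V m)
      - ceMul A _ m ∘ₗ p.2)
    (by intro m m' p; apply LinearMap.ext; intro s
        simp [TensorProduct.add_tmul, mul_add]; abel)
    (by intro c m p; apply LinearMap.ext; intro s; simp [smul_sub, TensorProduct.smul_tmul'])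
    (by intro m p p'; apply LinearMap.ext; intro s; simp [TensorProduct.tmul_add]; abel)
    (by intro c m p; apply LinearMap.ext; intro s; simp [smul_sub])

@[simp] theorem ceMul_apply_tmul (m : V) (n : W) (x : ExteriorAlgebra A V) :
    ceMul A W m (n ⊗ₜ x) = n ⊗ₜ (ExteriorAlgebra.ι A m * x) := rfl

theorem ceMul_ceMul (m : V) (t : W ⊗[A] ExteriorAlgebra A V) :
    ceMul A W m (ceMul A W m t) = 0 := by
  have h2 := ExteriorAlgebra.ι_sq_zero (R := A) m
  induction t with
  | zero => simp
  | add s t hs ht => simp [hs, ht]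
  | tmul n x => simp [← mul_assoc, h2]

theorem ceMul_swap (m m' : V) (t : W ⊗[A] ExteriorAlgebra A V) :
    ceMul A W m (ceMul A W m' t) = -ceMul A W m' (ceMul A W m t) := by
  induction t with
  | zero => simp
  | add s t hs ht => simp only [map_add, hs, ht, neg_add]
  | tmul n x =>
    have h := eq_neg_of_add_eq_zero_left (ExteriorAlgebra.ι_add_mul_swap (R := A) m m')
    simp only [ceMul_apply_tmul, ← mul_assoc, h, neg_mul, TensorProduct.tmul_neg]

theorem koszulAux_koszulAux (m : V) (x : ExteriorAlgebra A V)
    (T : SymmetricAlgebra A V →ₗ[A] Koszul A V) :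
    koszulAux m (ExteriorAlgebra.ι A m * x, koszulAux m (x, T)) = 0 := by
  apply LinearMap.ext; intro s
  simp [koszulAux, ceMul_ceMul]

variable (A V) in
/-- The Koszul differential `s ⊗ w`, as a function of `w` and `s`. -/
def koszulAt : ExteriorAlgebra A V →ₗ[A] SymmetricAlgebra A V →ₗ[A] Koszul A V :=
  CliffordAlgebra.foldr' (N := SymmetricAlgebra A V →ₗ[A] Koszul A V) (0 : QuadraticForm A V)
    koszulAux
    (by intro m x T; simpa using koszulAux_koszulAux m x T) 0

variable (A V) in
/-- The Koszul differential `κ(s ⊗ α ∧ w) = s α ⊗ w - α ∧ κ(s ⊗ w)`. -/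
def koszul : Koszul A V →ₗ[A] Koszul A V := TensorProduct.lift (koszulAt A V).flip

theorem koszul_one (s : SymmetricAlgebra A V) : koszul A V (s ⊗ₜ 1) = 0 := by
  have := CliffordAlgebra.foldr'_algebraMap (N := SymmetricAlgebra A V →ₗ[A] Koszul A V) (Q := (0 : QuadraticForm A V)) (koszulAux (A := A) (V := V))
    (by intro m x T; simpa using koszulAux_koszulAux m x T) 0 1
  rw [map_one] at this
  change koszulAt A V 1 s = 0
  rw [koszulAt, this]; simp

theorem koszul_wedge (s : SymmetricAlgebra A V) (m : V) (x : ExteriorAlgebra A V) :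
    koszul A V (s ⊗ₜ (ExteriorAlgebra.ι A m * x)) =
      (s * SymmetricAlgebra.ι A V m) ⊗ₜ x - ceMul A _ m (koszul A V (s ⊗ₜ x)) := by
  change koszulAt A V _ s = _
  rw [koszulAt, CliffordAlgebra.foldr'_ι_mul]; rfl

theorem ext_induction {p : ExteriorAlgebra A V → Prop}
    (h1 : p 1) (hadd : ∀ x y, p x → p y → p (x + y)) (hsmul : ∀ (r : A) x, p x → p (r • x))
    (hι : ∀ m x, p x → p (ExteriorAlgebra.ι A m * x)) (x) : p x := by
  induction x using CliffordAlgebra.left_induction with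
  | algebraMap r => rw [Algebra.algebraMap_eq_smul_one]; exact hsmul _ _ h1
  | add x y hx hy => exact hadd _ _ hx hy
  | ι_mul x m hx => exact hι _ _ hx

theorem koszul_induction {p : Koszul A V → Prop} (h0 : p 0)
    (hadd : ∀ s t, p s → p t → p (s + t)) (h1 : ∀ s, p (s ⊗ₜ 1))
    (hι : ∀ s m w, p (s ⊗ₜ w) → p (s ⊗ₜ (ExteriorAlgebra.ι A m * w))) (t) : p t := by
  induction t using TensorProduct.induction_on with
  | zero => exact h0
  | add s t hs ht => exact hadd _ _ hs ht
  | tmul s w =>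
    induction w using ext_induction generalizing s with
    | h1 => exact h1 s
    | hadd x y hx hy => rw [TensorProduct.tmul_add]; exact hadd _ _ (hx s) (hy s)
    | hsmul r x hx => rw [← TensorProduct.smul_tmul]; exact hx _
    | hι m x hx => exact hι _ _ _ (hx s)

/-- The algebra map `Sym V → Sym W` induced by a linear map. -/
def symMap (p : V →ₗ[A] W) : SymmetricAlgebra A V →ₐ[A] SymmetricAlgebra A W :=
  SymmetricAlgebra.lift (SymmetricAlgebra.ι A W ∘ₗ p)

@[simp] theorem symMap_ι (p : V →ₗ[A] W) (v : V) :
    symMap p (SymmetricAlgebra.ι A V v) = SymmetricAlgebra.ι A W (p v) :=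
  SymmetricAlgebra.lift_ι_apply _ _

theorem symMap_id : symMap (LinearMap.id : V →ₗ[A] V) = AlgHom.id A _ := by
  apply SymmetricAlgebra.algHom_ext; ext v; simp

theorem symMap_comp {X : Type u} [AddCommGroup X] [Module A X] (q : W →ₗ[A] X) (p : V →ₗ[A] W) :
    symMap (q ∘ₗ p) = (symMap q).comp (symMap p) := by
  apply SymmetricAlgebra.algHom_ext; ext v; simp

/-- The map of Koszul complexes induced by a linear map. -/
def koszulMap (p : V →ₗ[A] W) : Koszul A V →ₗ[A] Koszul A W :=
  TensorProduct.map (symMap p).toLinearMap (ExteriorAlgebra.map p).toLinearMap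

@[simp] theorem koszulMap_tmul (p : V →ₗ[A] W) (s : SymmetricAlgebra A V)
    (w : ExteriorAlgebra A V) :
    koszulMap p (s ⊗ₜ w) = symMap p s ⊗ₜ ExteriorAlgebra.map p w := rfl

theorem koszulMap_id (z : Koszul A V) : koszulMap LinearMap.id z = z := by
  rw [koszulMap, symMap_id, ExteriorAlgebra.map_id]
  exact LinearMap.congr_fun TensorProduct.map_id z

theorem koszulMap_comp {X : Type u} [AddCommGroup X] [Module A X] (q : W →ₗ[A] X) (p : V →ₗ[A] W)
    (z : Koszul A V) : koszulMap (q ∘ₗ p) z = koszulMap q (koszulMap p z) := by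
  induction z using TensorProduct.induction_on with
  | zero => simp
  | add s t hs ht => simp only [map_add, hs, ht]
  | tmul s w =>
    rw [koszulMap_tmul, koszulMap_tmul, koszulMap_tmul, symMap_comp,
      ← ExteriorAlgebra.map_comp_map]
    rfl

theorem koszulMap_ceMul (p : V →ₗ[A] W) (m : V) (z : Koszul A V) :
    koszulMap p (ceMul A _ m z) = ceMul A _ (p m) (koszulMap p z) := by
  induction z using TensorProduct.induction_on with
  | zero => simp
  | add s t hs ht => simp only [map_add, hs, ht]
  | tmul s w => simp

theorem koszul_koszulMap (p : V →ₗ[A] W) (z : Koszul A V) :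
    koszul A W (koszulMap p z) = koszulMap p (koszul A V z) := by
  induction z using koszul_induction with
  | h0 => simp
  | hadd s t hs ht => simp only [map_add, hs, ht]
  | h1 s => simp [koszul_one]
  | hι s m w h =>
    rw [koszulMap_tmul] at h
    simp [koszul_wedge, koszulMap_ceMul, h]

section Homotopy
variable (e : V) (φ : V →ₗ[A] A)

/-- The transvection-like endomorphism `v ↦ v - φ(v) e`. -/
def subProj : V →ₗ[A] V := LinearMap.id - φ.smulRight e

theorem subProj_apply (v : V) : subProj e φ v = v - φ v • e := rfl

/-- The homomorphism `Sym V → Sym V [X]` sending `v` to `(v - φ(v) e) + φ(v) X`. -/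
def symPoly : SymmetricAlgebra A V →ₐ[A] Polynomial (SymmetricAlgebra A V) :=
  SymmetricAlgebra.lift
    ((Polynomial.CAlgHom (R := A) (A := SymmetricAlgebra A V)).toLinearMap ∘ₗ
      SymmetricAlgebra.ι A V ∘ₗ subProj e φ + φ.smulRight Polynomial.X)

theorem symPoly_ι (v : V) : symPoly e φ (SymmetricAlgebra.ι A V v) =
    Polynomial.C (SymmetricAlgebra.ι A V (subProj e φ v)) + φ v • Polynomial.X := by
  rw [symPoly, SymmetricAlgebra.lift_ι_apply]; rfl

/-- The constant coefficient is the value at `X = 0`, where `v` becomes `v - φ(v) e`. The value at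
`X = e` in `eval_symPoly` restores `v`; the divided difference compares these two. -/
theorem coeff_symPoly (s : SymmetricAlgebra A V) :
    (symPoly e φ s).coeff 0 = symMap (subProj e φ) s := by
  have h : ((Polynomial.aeval (R := SymmetricAlgebra A V) (0 : SymmetricAlgebra A V)).restrictScalars
      A).comp (symPoly e φ) = symMap (subProj e φ) := by
    apply SymmetricAlgebra.algHom_ext; ext v; simp [symPoly_ι]
  rw [← h, Polynomial.coeff_zero_eq_aeval_zero]; rfl

theorem eval_symPoly (s : SymmetricAlgebra A V) :
    (symPoly e φ s).eval (SymmetricAlgebra.ι A V e) = s := by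
  have h : ((Polynomial.aeval (R := SymmetricAlgebra A V) (SymmetricAlgebra.ι A V e)).restrictScalars
      A).comp (symPoly e φ) = AlgHom.id A _ := by
    apply SymmetricAlgebra.algHom_ext; ext v; simp [symPoly_ι, subProj_apply]
  have h2 := AlgHom.congr_fun h s
  simpa using h2

/-- The divided difference `(s - σ(s)) / e`, where `σ` is induced by `v ↦ v - φ(v) e`. -/
def symQuot : SymmetricAlgebra A V →ₗ[A] SymmetricAlgebra A V where
  toFun s := (symPoly e φ s).divX.eval (SymmetricAlgebra.ι A V e)
  map_add' s t := by rw [map_add, Polynomial.divX_add, Polynomial.eval_add]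
  map_smul' c s := by
    have : (c • symPoly e φ s).divX = c • (symPoly e φ s).divX := by
      ext n; simp [Polynomial.coeff_divX]
    rw [map_smul, this, Polynomial.eval_smul]; rfl

/-- A Leibniz rule twisted by `σ`: the divided difference is a `σ`-derivation that takes the value
`φ(v)` on `v`. -/
theorem symQuot_mul_ι (s : SymmetricAlgebra A V) (v : V) :
    symQuot e φ (s * SymmetricAlgebra.ι A V v) =
      symQuot e φ s * SymmetricAlgebra.ι A V v + φ v • symMap (subProj e φ) s := by
  -- For polynomials, `divX (P Q) = divX P * Q + P(0) * divX Q`. Here `Q` is linear in `X` with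
  -- leading coefficient `φ(v)`.
  have h : (symPoly e φ (s * SymmetricAlgebra.ι A V v)).divX =
      (symPoly e φ s).divX * symPoly e φ (SymmetricAlgebra.ι A V v) +
        Polynomial.C (φ v • symMap (subProj e φ) s) := by
    ext n
    rw [map_mul, symPoly_ι, mul_add, mul_add, Polynomial.coeff_divX]
    simp only [Polynomial.coeff_add, Polynomial.coeff_mul_C, mul_smul_comm, Polynomial.coeff_smul,
      Polynomial.coeff_mul_X, Polynomial.coeff_divX, Polynomial.coeff_C]
    cases n with
    | zero => simp [coeff_symPoly]
    | succ n => simp [Polynomial.coeff_divX, Polynomial.coeff_mul_X]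
  change Polynomial.eval _ _ = Polynomial.eval _ _ * _ + _
  rw [h, Polynomial.eval_add, Polynomial.eval_mul, eval_symPoly, Polynomial.eval_C]

theorem symQuot_mul (s : SymmetricAlgebra A V) :
    symQuot e φ s * SymmetricAlgebra.ι A V e = s - symMap (subProj e φ) s := by
  have h := congrArg (Polynomial.eval (SymmetricAlgebra.ι A V e))
    (Polynomial.divX_mul_X_add (symPoly e φ s))
  rw [Polynomial.eval_add, Polynomial.eval_mul, Polynomial.eval_X, Polynomial.eval_C,
    eval_symPoly, coeff_symPoly] at h
  exact eq_sub_of_add_eq h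

/-- The homotopy `s ⊗ w ↦ q(s) ⊗ e ∧ w`. -/
def koszulHomotopy : Koszul A V →ₗ[A] Koszul A V :=
  ceMul A _ e ∘ₗ (symQuot e φ).rTensor _

theorem koszulHomotopy_tmul (s : SymmetricAlgebra A V) (w : ExteriorAlgebra A V) :
    koszulHomotopy e φ (s ⊗ₜ w) = symQuot e φ s ⊗ₜ (ExteriorAlgebra.ι A e * w) := rfl

theorem koszulHomotopy_ceMul (m : V) (z : Koszul A V) :
    koszulHomotopy e φ (ceMul A _ m z) = -ceMul A _ m (koszulHomotopy e φ z) := by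
  rw [koszulHomotopy, LinearMap.comp_apply, LinearMap.comp_apply, ceMul_swap m e, neg_neg]
  congr 1
  induction z using TensorProduct.induction_on with
  | zero => simp
  | add s t hs ht => simp only [map_add, hs, ht]
  | tmul s w => simp

/-- The vectors `v` and `v - φ(v) e` differ by a multiple of `e`, which `e ∧ ·` kills. -/
theorem ι_mul_map_subProj (w : ExteriorAlgebra A V) :
    ExteriorAlgebra.ι A e * ExteriorAlgebra.map (subProj e φ) w = ExteriorAlgebra.ι A e * w := by
  induction w using ext_induction with
  | h1 => simp
  | hadd x y hx hy => simp only [map_add, mul_add, hx, hy]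
  | hsmul c x hx => simp only [map_smul, mul_smul_comm, hx]
  | hι m x hx =>
    have h := eq_neg_of_add_eq_zero_left (ExteriorAlgebra.ι_add_mul_swap (R := A) e m)
    have h2 := ExteriorAlgebra.ι_sq_zero (R := A) e
    simp only [map_mul, ExteriorAlgebra.map_apply_ι, subProj_apply, map_sub, map_smul, sub_mul,
      mul_sub, smul_mul_assoc, mul_smul_comm, ← mul_assoc, h2, h, zero_mul, smul_zero, sub_zero,
      neg_mul]
    rw [mul_assoc, hx, mul_assoc]

/-- On `s ⊗ 1` this is `symQuot_mul`. For the induction both operators are moved past `m ∧ ·`; the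
term `φ(m) σ(s) ⊗ e ∧ w` left over by the twisted Leibniz rule is what changes `m` into `m - φ(m)
e`, thanks to `ι_mul_map_subProj`. Only division by `e` occurs and never division by an integer, so
the homotopy works in every characteristic. -/
theorem koszul_homotopy (z : Koszul A V) :
    koszul A V (koszulHomotopy e φ z) + koszulHomotopy e φ (koszul A V z) =
      z - koszulMap (subProj e φ) z := by
  induction z using koszul_induction with
  | h0 => simp
  | hadd s t hs ht =>
    simp only [map_add]
    rw [add_sub_add_comm, ← hs, ← ht]; abel
  | h1 s =>
    rw [koszulHomotopy_tmul, koszul_wedge, koszul_one, koszul_one, symQuot_mul]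
    simp [TensorProduct.sub_tmul]
  | hι s m w h =>
    rw [koszul_wedge, map_sub, koszulHomotopy_ceMul, koszulHomotopy_tmul (w := w), symQuot_mul_ι,
      ← ceMul_apply_tmul, koszulHomotopy_ceMul, map_neg, koszulHomotopy_tmul, ceMul_apply_tmul, koszul_wedge]
    have h' := congrArg (ceMul A _ m) h
    rw [map_add, koszulHomotopy_tmul] at h'
    rw [sub_neg_eq_add, neg_sub, ← sub_eq_zero]
    have h3 : ceMul A (SymmetricAlgebra A V) m (koszul A V
        (symQuot e φ s ⊗ₜ[A] (ExteriorAlgebra.ι A e * w))) = ceMul A _ m (s ⊗ₜ[A] w - (koszulMap (subProj e φ)) (s ⊗ₜ[A] w)) - ceMul A _ m (koszulHomotopy e φ (koszul A V (s ⊗ₜ[A] w))) := by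
      rw [← h']; abel
    rw [h3]
    have h4 := ι_mul_map_subProj e φ w
    simp only [koszulMap_tmul, ceMul_apply_tmul, map_sub, map_mul, ExteriorAlgebra.map_apply_ι,
      TensorProduct.add_tmul, subProj_apply, sub_mul, TensorProduct.tmul_sub, map_smul,
      smul_mul_assoc, h4, TensorProduct.tmul_smul, TensorProduct.smul_tmul']
    abel

end Homotopy

/-- The basis vectors in `T` are projected away one at a time. Each projection is homotopic to the
identity by `koszul_homotopy`, so a cycle changes by a boundary at each stage. -/
theorem exists_koszulMap_of_basis {I : Type u} (b : Module.Basis I A V) (T : Finset I) :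
    ∃ p : V →ₗ[A] V, (∀ j ∈ T, p (b j) = 0) ∧ (∀ j ∉ T, p (b j) = b j) ∧
      ∀ z, koszul A V z = 0 → ∃ y, z = koszulMap p z + koszul A V y := by
  classical
  induction T using Finset.induction_on with
  | empty => exact ⟨LinearMap.id, by simp, by simp, fun z _ => ⟨0, by simp [koszulMap_id]⟩⟩
  | insert i T hi ih =>
    obtain ⟨p, hp1, hp2, hp⟩ := ih
    refine ⟨subProj (b i) (b.coord i) ∘ₗ p, ?_, ?_, ?_⟩
    · intro j hj
      by_cases hjT : j ∈ T
      · simp [hp1 j hjT]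
      · obtain rfl : j = i := by simpa [hjT] using hj
        simp [hp2 j hjT, subProj_apply]
    · intro j hj
      rw [Finset.mem_insert, not_or] at hj
      simp [hp2 j hj.2, subProj_apply, Finsupp.single_apply, hj.1]
    · intro z hz
      obtain ⟨y, hy⟩ := hp z hz
      have h := koszul_homotopy (b i) (b.coord i) (koszulMap p z)
      rw [koszul_koszulMap, hz, map_zero, map_zero, add_zero] at h
      refine ⟨y + koszulHomotopy (b i) (b.coord i) (koszulMap p z), ?_⟩
      rw [koszulMap_comp, map_add, h]
      conv_lhs => rw [hy]
      abel

/-- An element of the Koszul complex involves only finitely many basis vectors. A map that kills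
these cannot be told apart from zero on that element. -/
theorem exists_finset_koszulMap {I : Type u} (b : Module.Basis I A V) (z : Koszul A V) :
    ∃ T : Finset I, ∀ p : V →ₗ[A] V, (∀ j ∈ T, p (b j) = 0) → koszulMap p z = koszulMap 0 z := by
  classical
  have hv : ∀ (p : V →ₗ[A] V) (v : V), (∀ j ∈ (b.repr v).support, p (b j) = 0) → p v = 0 := by
    intro p v h
    conv_lhs => rw [← b.linearCombination_repr v]
    rw [Finsupp.linearCombination_apply, Finsupp.sum, map_sum]
    exact Finset.sum_eq_zero fun j hj => by rw [map_smul, h j hj, smul_zero]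
  have hS : ∀ s : SymmetricAlgebra A V, ∃ T : Finset I, ∀ p : V →ₗ[A] V,
      (∀ j ∈ T, p (b j) = 0) → symMap p s = symMap 0 s := by
    intro s
    induction s using SymmetricAlgebra.induction with
    | algebraMap r => exact ⟨∅, fun p _ => by simp⟩
    | ι v => exact ⟨(b.repr v).support, fun p hp => by simp [hv p v hp]⟩
    | mul s t hs ht =>
      obtain ⟨T, hT⟩ := hs
      obtain ⟨T', hT'⟩ := ht
      refine ⟨T ∪ T', fun p hp => ?_⟩
      rw [map_mul, map_mul, hT p fun j hj => hp j (Finset.mem_union_left _ hj),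
        hT' p fun j hj => hp j (Finset.mem_union_right _ hj)]
    | add s t hs ht =>
      obtain ⟨T, hT⟩ := hs
      obtain ⟨T', hT'⟩ := ht
      refine ⟨T ∪ T', fun p hp => ?_⟩
      rw [map_add, map_add, hT p fun j hj => hp j (Finset.mem_union_left _ hj),
        hT' p fun j hj => hp j (Finset.mem_union_right _ hj)]
  have hE : ∀ s : ExteriorAlgebra A V, ∃ T : Finset I, ∀ p : V →ₗ[A] V,
      (∀ j ∈ T, p (b j) = 0) → ExteriorAlgebra.map p s = ExteriorAlgebra.map 0 s := by
    intro s
    induction s using ExteriorAlgebra.induction with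
    | algebraMap r => exact ⟨∅, fun p _ => by simp⟩
    | ι v => exact ⟨(b.repr v).support, fun p hp => by simp [hv p v hp]⟩
    | mul s t hs ht =>
      obtain ⟨T, hT⟩ := hs
      obtain ⟨T', hT'⟩ := ht
      refine ⟨T ∪ T', fun p hp => ?_⟩
      rw [map_mul, map_mul, hT p fun j hj => hp j (Finset.mem_union_left _ hj),
        hT' p fun j hj => hp j (Finset.mem_union_right _ hj)]
    | add s t hs ht =>
      obtain ⟨T, hT⟩ := hs
      obtain ⟨T', hT'⟩ := ht
      refine ⟨T ∪ T', fun p hp => ?_⟩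
      rw [map_add, map_add, hT p fun j hj => hp j (Finset.mem_union_left _ hj),
        hT' p fun j hj => hp j (Finset.mem_union_right _ hj)]
  induction z using TensorProduct.induction_on with
  | zero => exact ⟨∅, fun p _ => by simp⟩
  | add s t hs ht =>
    obtain ⟨T, hT⟩ := hs
    obtain ⟨T', hT'⟩ := ht
    refine ⟨T ∪ T', fun p hp => ?_⟩
    rw [map_add, map_add, hT p fun j hj => hp j (Finset.mem_union_left _ hj),
      hT' p fun j hj => hp j (Finset.mem_union_right _ hj)]
  | tmul s w =>
    obtain ⟨T, hT⟩ := hS s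
    obtain ⟨T', hT'⟩ := hE w
    refine ⟨T ∪ T', fun p hp => ?_⟩
    rw [koszulMap_tmul, koszulMap_tmul, hT p fun j hj => hp j (Finset.mem_union_left _ hj),
      hT' p fun j hj => hp j (Finset.mem_union_right _ hj)]

/-- The zero map factors through the Koszul complex of the zero module, which is `A`. -/
theorem exists_koszulMap_zero (z : Koszul A V) :
    ∃ a : A, koszulMap (0 : V →ₗ[A] W) z = a • (1 ⊗ₜ 1) := by
  induction z using TensorProduct.induction_on with
  | zero => exact ⟨0, by simp⟩
  | add s t hs ht =>
    obtain ⟨a, ha⟩ := hs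
    obtain ⟨b, hb⟩ := ht
    exact ⟨a + b, by rw [map_add, ha, hb, add_smul]⟩
  | tmul s w =>
    have hs : ∃ a : A, symMap (0 : V →ₗ[A] W) s = a • 1 := by
      induction s using SymmetricAlgebra.induction with
      | algebraMap r => exact ⟨r, by simp [Algebra.algebraMap_eq_smul_one]⟩
      | ι v => exact ⟨0, by simp⟩
      | mul s t hs ht =>
        obtain ⟨a, ha⟩ := hs
        obtain ⟨b, hb⟩ := ht
        exact ⟨b * a, by rw [map_mul, ha, hb]; simp [smul_smul]⟩
      | add s t hs ht =>
        obtain ⟨a, ha⟩ := hs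
        obtain ⟨b, hb⟩ := ht
        exact ⟨a + b, by rw [map_add, ha, hb, add_smul]⟩
    have hw : ∃ a : A, ExteriorAlgebra.map (0 : V →ₗ[A] W) w = a • 1 := by
      induction w using ExteriorAlgebra.induction with
      | algebraMap r => exact ⟨r, by simp [Algebra.algebraMap_eq_smul_one]⟩
      | ι v => exact ⟨0, by simp⟩
      | mul s t hs ht =>
        obtain ⟨a, ha⟩ := hs
        obtain ⟨b, hb⟩ := ht
        exact ⟨b * a, by rw [map_mul, ha, hb]; simp [smul_smul]⟩
      | add s t hs ht =>
        obtain ⟨a, ha⟩ := hs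
        obtain ⟨b, hb⟩ := ht
        exact ⟨a + b, by rw [map_add, ha, hb, add_smul]⟩
    obtain ⟨a, ha⟩ := hs
    obtain ⟨b, hb⟩ := hw
    exact ⟨b * a, by rw [koszulMap_tmul, ha, hb, TensorProduct.tmul_smul,
      ← TensorProduct.smul_tmul', smul_smul]⟩

/-- Projecting away the finitely many basis vectors that occur in a cycle changes it by a boundary
and leaves a constant. -/
theorem koszul_exact_of_basis {I : Type u} (b : Module.Basis I A V) (z : Koszul A V)
    (hz : koszul A V z = 0) : ∃ (a : A) (y : Koszul A V), z = a • (1 ⊗ₜ 1) + koszul A V y := by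
  obtain ⟨T, hT⟩ := exists_finset_koszulMap b z
  obtain ⟨p, hp, -, h⟩ := exists_koszulMap_of_basis b T
  obtain ⟨y, hy⟩ := h z hz
  obtain ⟨a, ha⟩ := exists_koszulMap_zero (W := V) z
  exact ⟨a, y, by rw [← ha, ← hT p hp]; exact hy⟩

/-- The Koszul complex of a projective module is a resolution. -/
theorem koszul_exact [Module.Projective A V] (z : Koszul A V)
    (hz : koszul A V z = 0) : ∃ (a : A) (y : Koszul A V), z = a • (1 ⊗ₜ 1) + koszul A V y := by
  -- `V` is a retract of the free module on its own elements. The cycle travels there along the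
  -- section `s`, and the resulting decomposition comes back along the retraction.
  obtain ⟨s, hs⟩ := Module.projective_def'.1 (inferInstance : Module.Projective A V)
  obtain ⟨a, y, h⟩ := koszul_exact_of_basis (Finsupp.basisSingleOne (R := A) (ι := V))
    (koszulMap s z) (by rw [koszul_koszulMap, hz, map_zero])
  have h2 := congrArg (koszulMap (Finsupp.linearCombination A (id : V → V))) h
  rw [← koszulMap_comp, hs, koszulMap_id, map_add, map_smul, ← koszul_koszulMap] at h2
  exact ⟨a, koszulMap (Finsupp.linearCombination A (id : V → V)) y, by rw [h2]; simp⟩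

end Koszul

/-! ### The homogenized enveloping algebra and its quotients at `η = 1` and `η = 0`. -/

section HAlg
variable (R A L : Type u) [CommRing R] [CommRing A] [Algebra R A] [LieRing L] [LieAlgebra R L]
  [Module A L] [LieRingModule L A]

/-- The relations defining the homogenized enveloping algebra; `none` is the parameter. -/
inductive HRel : FreeAlgebra R (Option (A ⊕ L)) → FreeAlgebra R (Option (A ⊕ L)) → Prop
  | add_left (a b : A) : HRel (FreeAlgebra.ι R (some (Sum.inl (a + b))))
      (FreeAlgebra.ι R (some (Sum.inl a)) + FreeAlgebra.ι R (some (Sum.inl b)))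
  | mul_left (a b : A) : HRel (FreeAlgebra.ι R (some (Sum.inl (a * b))))
      (FreeAlgebra.ι R (some (Sum.inl a)) * FreeAlgebra.ι R (some (Sum.inl b)))
  | algebraMap_left (r : R) : HRel (FreeAlgebra.ι R (some (Sum.inl (algebraMap R A r))))
      (algebraMap R _ r)
  | add_right (α β : L) : HRel (FreeAlgebra.ι R (some (Sum.inr (α + β))))
      (FreeAlgebra.ι R (some (Sum.inr α)) + FreeAlgebra.ι R (some (Sum.inr β)))
  | smul_right (a : A) (α : L) : HRel (FreeAlgebra.ι R (some (Sum.inr (a • α))))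
      (FreeAlgebra.ι R (some (Sum.inl a)) * FreeAlgebra.ι R (some (Sum.inr α)))
  | lie_right (α β : L) :
      HRel (FreeAlgebra.ι R none * FreeAlgebra.ι R (some (Sum.inr ⁅α, β⁆)))
      (FreeAlgebra.ι R (some (Sum.inr α)) * FreeAlgebra.ι R (some (Sum.inr β)) -
        FreeAlgebra.ι R (some (Sum.inr β)) * FreeAlgebra.ι R (some (Sum.inr α)))
  | lie_left (α : L) (a : A) :
      HRel (FreeAlgebra.ι R none * FreeAlgebra.ι R (some (Sum.inl ⁅α, a⁆)))
      (FreeAlgebra.ι R (some (Sum.inr α)) * FreeAlgebra.ι R (some (Sum.inl a)) -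
        FreeAlgebra.ι R (some (Sum.inl a)) * FreeAlgebra.ι R (some (Sum.inr α)))
  | comm (x : A ⊕ L) : HRel (FreeAlgebra.ι R none * FreeAlgebra.ι R (some x))
      (FreeAlgebra.ι R (some x) * FreeAlgebra.ι R none)

/-- The homogenized enveloping algebra of `(A, L)`: the enveloping algebra with a central
parameter `η` and the relations `α β - β α = η [α, β]` and `α a - a α = η α(a)`. -/
def HAlg : Type u := RingQuot (HRel R A L)

instance : Ring (HAlg R A L) := inferInstanceAs (Ring (RingQuot (HRel R A L)))
instance : Algebra R (HAlg R A L) := inferInstanceAs (Algebra R (RingQuot (HRel R A L)))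

namespace HAlg

/-- The quotient map. -/
def mk : FreeAlgebra R (Option (A ⊕ L)) →ₐ[R] HAlg R A L := RingQuot.mkAlgHom R (HRel R A L)

variable {R A L} in
theorem mk_rel {x y : FreeAlgebra R (Option (A ⊕ L))} (h : HRel R A L x y) :
    mk R A L x = mk R A L y := RingQuot.mkAlgHom_rel R h

/-- The canonical map `A → HAlg`. -/
def ιA : A →ₐ[R] HAlg R A L :=
  { toFun := fun a => mk R A L (FreeAlgebra.ι R (some (Sum.inl a)))
    map_one' := by
      have := mk_rel (HRel.algebraMap_left (R := R) (A := A) (L := L) 1)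
      simpa using this
    map_mul' := fun a b => by rw [mk_rel (HRel.mul_left a b), map_mul]
    map_zero' := by
      have := mk_rel (HRel.algebraMap_left (R := R) (A := A) (L := L) 0)
      simpa using this
    map_add' := fun a b => by rw [mk_rel (HRel.add_left a b), map_add]
    commutes' := fun r => by rw [mk_rel (HRel.algebraMap_left r)]; exact AlgHom.commutes _ r }

/-- The canonical map `L → HAlg`. -/
def ιL [IsScalarTower R A L] : L →ₗ[R] HAlg R A L where
  toFun α := mk R A L (FreeAlgebra.ι R (some (Sum.inr α)))
  map_add' α β := by rw [mk_rel (HRel.add_right α β), map_add]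
  map_smul' r α := by
    rw [← algebraMap_smul A r α, mk_rel (HRel.smul_right _ α), map_mul,
      mk_rel (HRel.algebraMap_left r), AlgHom.commutes, ← Algebra.smul_def]
    rfl

/-- The parameter. -/
def η : HAlg R A L := mk R A L (FreeAlgebra.ι R none)

variable {R A L}
variable [IsScalarTower R A L]

theorem ιL_smul (a : A) (α : L) : ιL R A L (a • α) = ιA R A L a * ιL R A L α :=
  (mk_rel (HRel.smul_right a α)).trans (map_mul _ _ _)

theorem ιL_lie (α β : L) :
    η R A L * ιL R A L ⁅α, β⁆ = ιL R A L α * ιL R A L β - ιL R A L β * ιL R A L α := by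
  have h := mk_rel (HRel.lie_right (R := R) (A := A) α β)
  rw [map_sub, map_mul, map_mul, map_mul] at h
  exact h

theorem ιA_lie (α : L) (a : A) :
    η R A L * ιA R A L ⁅α, a⁆ = ιL R A L α * ιA R A L a - ιA R A L a * ιL R A L α := by
  have h := mk_rel (HRel.lie_left (R := R) (A := A) α a)
  rw [map_sub, map_mul, map_mul, map_mul] at h
  exact h

/-- The universal property of `HAlg`. -/
def lift {S : Type u} [Ring S] [Algebra R S] (f : A →ₐ[R] S) (g : L →ₗ[R] S) (c : S)
    (h1 : ∀ (a : A) α, g (a • α) = f a * g α)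
    (h2 : ∀ α β, c * g ⁅α, β⁆ = g α * g β - g β * g α)
    (h3 : ∀ α (a : A), c * f ⁅α, a⁆ = g α * f a - f a * g α)
    (h4 : ∀ a : A, c * f a = f a * c) (h5 : ∀ α : L, c * g α = g α * c) : HAlg R A L →ₐ[R] S :=
  RingQuot.liftAlgHom R ⟨FreeAlgebra.lift R (fun x => x.elim c (Sum.elim f g)), by
    intro x y h
    cases h with
    | comm x => cases x <;> simp [h4, h5]
    | _ => simp [h1, h2, h3]⟩

section
variable {S : Type u} [Ring S] [Algebra R S] (f : A →ₐ[R] S) (g : L →ₗ[R] S) (c : S) (h1 h2 h3 h4 h5)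

@[simp] theorem lift_ιA (a : A) : lift f g c h1 h2 h3 h4 h5 (ιA R A L a) = f a :=
  (RingQuot.liftAlgHom_mkAlgHom_apply _ _ _ _).trans (by simp)

@[simp] theorem lift_ιL (α : L) : lift f g c h1 h2 h3 h4 h5 (ιL R A L α) = g α :=
  (RingQuot.liftAlgHom_mkAlgHom_apply _ _ _ _).trans (by simp)

@[simp] theorem lift_η : lift f g c h1 h2 h3 h4 h5 (η R A L) = c :=
  (RingQuot.liftAlgHom_mkAlgHom_apply _ _ _ _).trans (by simp)

end

theorem induction {p : HAlg R A L → Prop} (hA : ∀ a, p (ιA R A L a)) (hL : ∀ α, p (ιL R A L α))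
    (hη : p (η R A L)) (hmul : ∀ x y, p x → p y → p (x * y)) (hadd : ∀ x y, p x → p y → p (x + y))
    (u) : p u := by
  obtain ⟨x, rfl⟩ := RingQuot.mkAlgHom_surjective R (HRel R A L) u
  change p (mk R A L x)
  induction x using FreeAlgebra.induction with
  | grade0 r => rw [AlgHom.commutes, ← AlgHom.commutes (ιA R A L)]; exact hA _
  | grade1 x =>
    match x with
    | none => exact hη
    | some (Sum.inl a) => exact hA a
    | some (Sum.inr α) => exact hL α
  | mul x y hx hy => rw [map_mul]; exact hmul _ _ hx hy
  | add x y hx hy => rw [map_add]; exact hadd _ _ hx hy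

theorem algHom_ext {S : Type u} [Ring S] [Algebra R S] {F G : HAlg R A L →ₐ[R] S}
    (hA : ∀ a, F (ιA R A L a) = G (ιA R A L a)) (hL : ∀ α, F (ιL R A L α) = G (ιL R A L α))
    (hη : F (η R A L) = G (η R A L)) (u) : F u = G u := by
  induction u using induction with
  | hA a => exact hA a
  | hL α => exact hL α
  | hη => exact hη
  | hmul x y hx hy => rw [map_mul, map_mul, hx, hy]
  | hadd x y hx hy => rw [map_add, map_add, hx, hy]

theorem η_comm (u : HAlg R A L) : η R A L * u = u * η R A L := by
  induction u using induction with
  | hA a =>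
    have h := mk_rel (HRel.comm (R := R) (A := A) (L := L) (Sum.inl a))
    rw [map_mul, map_mul] at h
    exact h
  | hL α =>
    have h := mk_rel (HRel.comm (R := R) (A := A) (L := L) (Sum.inr α))
    rw [map_mul, map_mul] at h
    exact h
  | hη => rfl
  | hmul x y hx hy => rw [← mul_assoc, hx, mul_assoc, hy, mul_assoc]
  | hadd x y hx hy => rw [mul_add, add_mul, hx, hy]

/-- `A` acts on `HAlg` by multiplication from the right. -/
instance : Module A (HAlg R A L) where
  smul a x := x * ιA R A L a
  one_smul x := by change x * ιA R A L 1 = x; rw [map_one, mul_one]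
  mul_smul a b x := by
    change x * ιA R A L (a * b) = x * ιA R A L b * ιA R A L a
    rw [mul_comm, map_mul, mul_assoc]
  smul_zero a := zero_mul _
  smul_add a x y := add_mul _ _ _
  add_smul a b x := by
    change x * ιA R A L (a + b) = _
    rw [map_add, mul_add]; rfl
  zero_smul x := by change x * ιA R A L 0 = 0; rw [map_zero, mul_zero]

theorem smul_def (a : A) (x : HAlg R A L) : a • x = x * ιA R A L a := rfl

instance : IsScalarTower R A (HAlg R A L) where
  smul_assoc r a x := by rw [smul_def, smul_def, map_smul, mul_smul_comm]

instance : SMulCommClass A (HAlg R A L) (HAlg R A L) where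
  smul_comm a u x := mul_assoc u x (ιA R A L a)

theorem isTwoSided_span_singleton {z : HAlg R A L} (hz : ∀ u, z * u = u * z) :
    (Ideal.span {z}).IsTwoSided := by
  constructor
  intro a b ha
  obtain ⟨c, rfl⟩ := Ideal.mem_span_singleton'.1 ha
  exact Ideal.mem_span_singleton'.2 ⟨c * b, by rw [mul_assoc, ← hz, mul_assoc]⟩

variable [LieRinehartRing A L] [LieRinehartAlgebra R A L]

variable (R A L) in
/-- `HAlg` as a right module over itself. -/
def param : ParamModule R A L (HAlg R A L) where
  η := { toFun := fun u => η R A L * u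
         map_add' := mul_add _
         map_smul' := fun a u => (mul_assoc _ _ _).symm }
  act := (LinearMap.mul R (HAlg R A L)).flip ∘ₗ ιL R A L
  act_smul α c u := by
    change u * ιA R A L c * ιL R A L α = u * ιL R A L α * ιA R A L c - η R A L * u * ιA R A L ⁅α, c⁆
    rw [η_comm, mul_assoc u (η R A L), ιA_lie]; noncomm_ring
  smul_act α c u := by
    change u * ιL R A L (c • α) = u * ιA R A L c * ιL R A L α
    rw [ιL_smul, mul_assoc]
  η_act α u := by
    change η R A L * (u * ιL R A L α) = η R A L * u * ιL R A L α
    rw [mul_assoc]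
  lie_act α β u := by
    change η R A L * (u * ιL R A L ⁅α, β⁆) =
      u * ιL R A L α * ιL R A L β - u * ιL R A L β * ιL R A L α
    rw [← mul_assoc, η_comm, mul_assoc, ιL_lie]; noncomm_ring

theorem param_η (u : HAlg R A L) : (param R A L).η u = η R A L * u := rfl
theorem param_act (α : L) (u : HAlg R A L) : (param R A L).act α u = u * ιL R A L α := rfl

variable (R A L) in
/-- The specialization of the parameter to `1`. -/
def toU : HAlg R A L →ₐ[R] UAlg R A L :=
  lift (UAlg.ιA R A L) (UAlg.ιL R A L) 1 UAlg.ιL_smul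
    (fun α β => by rw [one_mul, UAlg.ιL_lie]) (fun α a => by rw [one_mul, UAlg.ιA_lie])
    (fun a => by rw [one_mul, mul_one]) (fun α => by rw [one_mul, mul_one])

theorem toU_ιA (a : A) : toU R A L (ιA R A L a) = UAlg.ιA R A L a := lift_ιA ..

theorem toU_ιL (α : L) : toU R A L (ιL R A L α) = UAlg.ιL R A L α := lift_ιL ..

theorem toU_η : toU R A L (η R A L) = 1 := lift_η ..

theorem toU_surjective : Function.Surjective (toU R A L) := by
  intro u
  obtain ⟨x, rfl⟩ := RingQuot.mkAlgHom_surjective R (URel R A L) u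
  change ∃ v, toU R A L v = UAlg.mk R A L x
  induction x using FreeAlgebra.induction with
  | grade0 r => exact ⟨algebraMap R _ r, by rw [AlgHom.commutes, AlgHom.commutes]⟩
  | grade1 x =>
    cases x with
    | inl a => exact ⟨ιA R A L a, lift_ιA ..⟩
    | inr α => exact ⟨ιL R A L α, lift_ιL ..⟩
  | mul x y hx hy =>
    obtain ⟨v, hv⟩ := hx
    obtain ⟨w, hw⟩ := hy
    exact ⟨v * w, by rw [map_mul, map_mul, hv, hw]⟩
  | add x y hx hy =>
    obtain ⟨v, hv⟩ := hx
    obtain ⟨w, hw⟩ := hy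
    exact ⟨v + w, by rw [map_add, map_add, hv, hw]⟩

/-- In the quotient by the central element `η - 1` the relations of `U(A, L)` hold, so the universal
property yields a map back from `U(A, L)`. Its composite with `toU` is the quotient map, whence the
kernel of `toU` lies in the ideal. -/
theorem toU_eq_zero {u : HAlg R A L} (hu : toU R A L u = 0) :
    ∃ v, u = (η R A L - 1) * v := by
  have hc : ∀ u : HAlg R A L, (η R A L - 1) * u = u * (η R A L - 1) := fun u => by
    rw [sub_mul, mul_sub, η_comm, one_mul, mul_one]
  have := isTwoSided_span_singleton hc
  let I : Ideal (HAlg R A L) := Ideal.span {η R A L - 1}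
  let π : HAlg R A L →ₐ[R] HAlg R A L ⧸ I := Ideal.Quotient.mkₐ R I
  have hη : π (η R A L) = 1 := by
    rw [← sub_eq_zero, ← map_one π, ← map_sub]
    exact Ideal.Quotient.eq_zero_iff_mem.2 (Ideal.subset_span rfl)
  let F : UAlg R A L →ₐ[R] HAlg R A L ⧸ I :=
    UAlg.lift (π.comp (ιA R A L)) (π.toLinearMap ∘ₗ ιL R A L)
      (fun a α => by simp [ιL_smul])
      (fun α β => by
        have h := congrArg π (ιL_lie α β)
        rw [map_mul, hη, one_mul, map_sub, map_mul, map_mul] at h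
        exact h)
      (fun α a => by
        have h := congrArg π (ιA_lie α a)
        rw [map_mul, hη, one_mul, map_sub, map_mul, map_mul] at h
        exact h)
  have h : F.comp (toU R A L) u = π u := by
    refine algHom_ext (fun a => ?_) (fun α => ?_) ?_ u
    · rw [AlgHom.comp_apply, toU, lift_ιA]; exact UAlg.lift_ιA ..
    · rw [AlgHom.comp_apply, toU, lift_ιL]; exact UAlg.lift_ιL ..
    · rw [AlgHom.comp_apply, toU, lift_η, map_one, hη]
  rw [AlgHom.comp_apply, hu, map_zero] at h
  obtain ⟨v, hv⟩ := Ideal.mem_span_singleton'.1 (Ideal.Quotient.eq_zero_iff_mem.1 h.symm)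
  exact ⟨v, by rw [hc, hv]⟩

variable (_R A L) in
/-- The symmetric algebra of the `A`-module `L`, regarded as an `R`-algebra. -/
def SymAlg (_R A L : Type u) [CommRing A] [LieRing L] [Module A L] : Type u := SymmetricAlgebra A L

instance : CommRing (SymAlg R A L) := inferInstanceAs (CommRing (SymmetricAlgebra A L))
instance : Algebra A (SymAlg R A L) := inferInstanceAs (Algebra A (SymmetricAlgebra A L))
instance : Algebra R (SymAlg R A L) := Algebra.compHom _ (algebraMap R A)
instance : IsScalarTower R A (SymAlg R A L) := IsScalarTower.of_algebraMap_eq fun _ => rfl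

variable (R A L) in
/-- The canonical map `L → SymAlg`. -/
def SymAlg.ι : L →ₗ[A] SymAlg R A L := SymmetricAlgebra.ι A L

variable (R A L) in
/-- The specialization of the parameter to `0`. -/
def toSym : HAlg R A L →ₐ[R] SymAlg R A L :=
  lift (IsScalarTower.toAlgHom R A _) ((SymAlg.ι R A L).restrictScalars R) 0
    (fun a α => by simp [Algebra.smul_def])
    (fun α β => by simp [mul_comm]) (fun α a => by simp [mul_comm])
    (fun a => by simp) (fun α => by simp)

theorem toSym_ιA (a : A) : toSym R A L (ιA R A L a) = algebraMap A _ a := lift_ιA ..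

theorem toSym_ιL (α : L) : toSym R A L (ιL R A L α) = SymAlg.ι R A L α := lift_ιL ..

theorem toSym_η : toSym R A L (η R A L) = 0 := lift_η ..

theorem toSym_surjective : Function.Surjective (toSym R A L) := by
  intro u
  change ∃ v, toSym R A L v = (show SymmetricAlgebra A L from u)
  induction (show SymmetricAlgebra A L from u) using SymmetricAlgebra.induction with
  | algebraMap r => exact ⟨ιA R A L r, lift_ιA ..⟩
  | ι α => exact ⟨ιL R A L α, lift_ιL ..⟩
  | mul x y hx hy =>
    obtain ⟨v, hv⟩ := hx
    obtain ⟨w, hw⟩ := hy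
    exact ⟨v * w, by rw [map_mul, hv, hw]; rfl⟩
  | add x y hx hy =>
    obtain ⟨v, hv⟩ := hx
    obtain ⟨w, hw⟩ := hy
    exact ⟨v + w, by rw [map_add, hv, hw]; rfl⟩

/-- Modulo `η` all generators commute, so the quotient is a commutative `A`-algebra and receives a
map from the symmetric algebra. As in `toU_eq_zero`, the composite with `toSym` is the quotient map.
-/
theorem toSym_eq_zero {u : HAlg R A L} (hu : toSym R A L u = 0) : ∃ v, u = η R A L * v := by
  have := isTwoSided_span_singleton (R := R) (A := A) (L := L) η_comm
  let I : Ideal (HAlg R A L) := Ideal.span {η R A L}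
  let π : HAlg R A L →ₐ[R] HAlg R A L ⧸ I := Ideal.Quotient.mkₐ R I
  have hη : π (η R A L) = 0 := Ideal.Quotient.eq_zero_iff_mem.2 (Ideal.subset_span rfl)
  have hL : ∀ α β : L, π (ιL R A L α) * π (ιL R A L β) = π (ιL R A L β) * π (ιL R A L α) := by
    intro α β
    have h := congrArg π (ιL_lie α β)
    rw [map_mul, hη, zero_mul, map_sub, map_mul, map_mul] at h
    exact (sub_eq_zero.1 h.symm)
  have hLA : ∀ (α : L) (a : A),
      π (ιL R A L α) * π (ιA R A L a) = π (ιA R A L a) * π (ιL R A L α) := by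
    intro α a
    have h := congrArg π (ιA_lie α a)
    rw [map_mul, hη, zero_mul, map_sub, map_mul, map_mul] at h
    exact (sub_eq_zero.1 h.symm)
  have hA : ∀ a b : A, π (ιA R A L a) * π (ιA R A L b) = π (ιA R A L b) * π (ιA R A L a) := by
    intro a b
    rw [← map_mul, ← map_mul, mul_comm, map_mul, map_mul]
  -- Commutativity spreads from the generators to all elements by induction on one factor and then
  -- on the other.
  have hc : ∀ u v : HAlg R A L, π u * π v = π v * π u := by
    intro u v
    induction u using induction with
    | hη => rw [hη, zero_mul, mul_zero]
    | hmul x y hx hy => rw [map_mul, mul_assoc, hy, ← mul_assoc, hx, mul_assoc]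
    | hadd x y hx hy => rw [map_add, add_mul, mul_add, hx, hy]
    | hA a =>
      induction v using induction with
      | hη => rw [hη, zero_mul, mul_zero]
      | hmul x y hx hy => rw [map_mul, ← mul_assoc, hx, mul_assoc, hy, mul_assoc]
      | hadd x y hx hy => rw [map_add, add_mul, mul_add, hx, hy]
      | hA b => exact hA a b
      | hL β => exact (hLA β a).symm
    | hL α =>
      induction v using induction with
      | hη => rw [hη, zero_mul, mul_zero]
      | hmul x y hx hy => rw [map_mul, ← mul_assoc, hx, mul_assoc, hy, mul_assoc]
      | hadd x y hx hy => rw [map_add, add_mul, mul_add, hx, hy]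
      | hA b => exact hLA α b
      | hL β => exact hL α β
  let C := HAlg R A L ⧸ I
  let _ : CommRing C :=
    { (inferInstance : Ring (HAlg R A L ⧸ I)) with
      mul_comm := by
        intro x y
        obtain ⟨u, rfl⟩ := Ideal.Quotient.mkₐ_surjective R I x
        obtain ⟨v, rfl⟩ := Ideal.Quotient.mkₐ_surjective R I y
        exact hc u v }
  let _ : Algebra A C := (π.comp (ιA R A L)).toRingHom.toAlgebra
  let g : L →ₗ[A] C :=
    { toFun := fun α => π (ιL R A L α)
      map_add' := fun α β => by rw [map_add, map_add]
      map_smul' := fun a α => by rw [ιL_smul, map_mul]; rfl }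
  let F : SymmetricAlgebra A L →ₐ[A] C := SymmetricAlgebra.lift g
  let F' : SymAlg R A L →+* C := F.toRingHom
  have h : ∀ u, F' (toSym R A L u) = π u := by
    intro u
    induction u using induction with
    | hA a => rw [toSym_ιA]; exact F.commutes a
    | hL α => rw [toSym_ιL]; exact SymmetricAlgebra.lift_ι_apply g α
    | hη => rw [toSym_η, hη]; exact map_zero F
    | hmul x y hx hy => rw [map_mul, map_mul, map_mul, hx, hy]
    | hadd x y hx hy => rw [map_add, map_add, map_add, hx, hy]
  have h0 := h u
  rw [hu, map_zero] at h0
  obtain ⟨v, hv⟩ := Ideal.mem_span_singleton'.1 (Ideal.Quotient.eq_zero_iff_mem.1 h0.symm)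
  exact ⟨v, by rw [η_comm, hv]⟩

end HAlg
end HAlg

/-! ### Specialization of the parameter on the complexes. -/

section Specialization
variable {R A L : Type u} [CommRing R] [CommRing A] [Algebra R A] [LieRing L] [LieAlgebra R L]
  [Module A L] [LieRingModule L A] [LieRinehartRing A L] [LieRinehartAlgebra R A L]

namespace HAlg

variable (R A L) in
/-- `SymAlg` as a right module on which the parameter acts by zero. -/
def symParam : ParamModule R A L (SymAlg R A L) where
  η := 0
  act := (LinearMap.mul R (SymAlg R A L)).flip ∘ₗ (SymAlg.ι R A L).restrictScalars R
  act_smul α c u := by simp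
  smul_act α c u := by simp
  η_act α u := by simp
  lie_act α β u := by simp [mul_assoc, mul_comm (SymAlg.ι R A L α)]

variable (R A L) in
/-- The Koszul differential on `SymAlg`. -/
def symDiff : SymAlg R A L ⊗[A] ExteriorAlgebra A L →ₗ[A] SymAlg R A L ⊗[A] ExteriorAlgebra A L :=
  koszul A L

/-- With `η = 0` the Lie derivative drops out of the recursion, and the Koszul recursion remains. -/
theorem symParam_diff (z : SymAlg R A L ⊗[A] ExteriorAlgebra A L) :
    (symParam R A L).diff z = symDiff R A L z := by
  refine tmul_induction (R := R) (p := fun z => (symParam R A L).diff z = symDiff R A L z)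
    (by rw [map_zero, map_zero])
    (fun s t hs ht => by rw [map_add, hs, ht, map_add])
    (fun s x => ?_) z
  induction x using extR_induction with
  | h0 => rw [map_zero, TensorProduct.tmul_zero, map_zero, map_zero]
  | h1 => rw [map_one, ParamModule.diff_one]; exact (koszul_one s).symm
  | hadd x y hx hy => rw [map_add, TensorProduct.tmul_add, map_add, hx, hy, map_add]
  | hsmul r x hx =>
    have h : ∀ t : SymAlg R A L ⊗[A] ExteriorAlgebra A L, r • t = algebraMap R A r • t :=
      fun t => by simp
    rw [map_smul, TensorProduct.tmul_smul, map_smul, hx, h, h, map_smul]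
  | hι α x hx =>
    rw [map_mul, extProj_ι, ParamModule.diff_wedge, hx]
    have h : (symParam R A L).η s = 0 := rfl
    rw [h, TensorProduct.zero_tmul, sub_zero]
    exact (koszul_wedge s α (extProj R A L x)).symm

variable (R A L) in
/-- The right module `U(A, L)`, the parameter acting as the identity. -/
def uParam : ParamModule R A L (URight R A L) where
  η := LinearMap.id
  act := URight.act R A L
  act_smul := URight.act_smul
  smul_act := URight.smul_act
  η_act _ _ := rfl
  lie_act := URight.lie_act

theorem uParam_diff (z : URight R A L ⊗[A] ExteriorAlgebra A L) :
    (uParam R A L).diff z = rinehartDiff R A L z :=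
  (uParam R A L).diff_eq_connDiff rfl URight.act_smul URight.smul_act z

variable (R A L) in
/-- `toSym` as an `A`-linear map. -/
def toSymₗ : HAlg R A L →ₗ[A] SymAlg R A L where
  toFun := toSym R A L
  map_add' := map_add _
  map_smul' a u := by
    rw [smul_def, map_mul, toSym_ιA, mul_comm, ← Algebra.smul_def]; rfl

variable (R A L) in
/-- `toU` as an `A`-linear map. -/
def toUₗ : HAlg R A L →ₗ[A] URight R A L where
  toFun u := URight.of R A L (toU R A L u)
  map_add' u v := by rw [map_add, map_add]
  map_smul' a u := by
    rw [smul_def, map_mul, toU_ιA, RingHom.id_apply, URight.smul_def, URight.mulRight_apply]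

variable (R A L) in
/-- Multiplication by `η - 1`. -/
def ηSub : HAlg R A L →ₗ[A] HAlg R A L := (param R A L).η - LinearMap.id

theorem ηSub_apply (u : HAlg R A L) : ηSub R A L u = (η R A L - 1) * u := by
  rw [sub_mul, one_mul]; rfl

theorem exact_toSymₗ : Function.Exact (param R A L).η (toSymₗ R A L) := by
  intro u
  constructor
  · intro h
    obtain ⟨v, hv⟩ := toSym_eq_zero (R := R) (A := A) (L := L) h
    exact ⟨v, hv.symm⟩
  · rintro ⟨v, rfl⟩
    change toSym R A L (η R A L * v) = 0
    rw [map_mul, toSym_η, zero_mul]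

theorem exact_toUₗ : Function.Exact (ηSub R A L) (toUₗ R A L) := by
  intro u
  constructor
  · intro h
    obtain ⟨v, hv⟩ := toU_eq_zero (R := R) (A := A) (L := L) h
    exact ⟨v, by rw [hv, ηSub_apply]⟩
  · rintro ⟨v, rfl⟩
    change toU R A L (ηSub R A L v) = 0
    rw [ηSub_apply, map_mul, map_sub, toU_η, map_one, sub_self, zero_mul]

theorem toSymₗ_surjective : Function.Surjective (toSymₗ R A L) := toSym_surjective

theorem toUₗ_surjective : Function.Surjective (toUₗ R A L) := toU_surjective

theorem diff_toSymₗ (z : HAlg R A L ⊗[A] ExteriorAlgebra A L) :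
    symDiff R A L ((toSymₗ R A L).rTensor _ z) = (toSymₗ R A L).rTensor _ ((param R A L).diff z) := by
  refine (symParam_diff _).symm.trans
    ((param R A L).diff_rTensor (symParam R A L) _ _ (fun u => ?_) (fun α u => ?_) z)
  · change toSym R A L (η R A L * u) = 0
    rw [map_mul, toSym_η, zero_mul]
  · change toSym R A L (u * ιL R A L α) = toSym R A L u * SymAlg.ι R A L α
    rw [map_mul, toSym_ιL]

theorem diff_toUₗ (z : HAlg R A L ⊗[A] ExteriorAlgebra A L) :
    rinehartDiff R A L ((toUₗ R A L).rTensor _ z) =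
      (toUₗ R A L).rTensor _ ((param R A L).diff z) := by
  rw [← uParam_diff]
  refine (param R A L).diff_rTensor (uParam R A L) _ _ (fun u => ?_) (fun α u => ?_) z
  · change toU R A L (η R A L * u) = toU R A L u
    rw [map_mul, toU_η, one_mul]
  · change toU R A L (u * ιL R A L α) = toU R A L u * UAlg.ιL R A L α
    rw [map_mul, toU_ιL]

theorem diff_η (z : HAlg R A L ⊗[A] ExteriorAlgebra A L) :
    (param R A L).diff ((param R A L).η.rTensor _ z) =
      (param R A L).η.rTensor _ ((param R A L).diff z) :=
  (param R A L).diff_rTensor (param R A L) _ _ (fun _ => rfl) (param R A L).η_act z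

end HAlg
end Specialization

/-! ### Projectivity and flatness of the exterior algebra. -/

section Flat
variable {A V : Type u} [CommRing A] [AddCommGroup V] [Module A V]

theorem projective_exteriorAlgebra [Module.Projective A V] :
    Module.Projective A (ExteriorAlgebra A V) := by
  obtain ⟨s, hs⟩ := Module.projective_def'.1 (inferInstance : Module.Projective A V)
  classical
  -- The monomial basis of the exterior algebra of a free module requires an ordered index set; any
  -- linear order will do.
  let _ : LinearOrder V := linearOrderOfSTO WellOrderingRel
  have : Module.Projective A (ExteriorAlgebra A (V →₀ A)) :=
    Module.Projective.of_basis (Finsupp.basisSingleOne (R := A) (ι := V)).ExteriorAlgebra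
  refine Module.Projective.of_split (ExteriorAlgebra.map s).toLinearMap
    (ExteriorAlgebra.map (Finsupp.linearCombination A (id : V → V))).toLinearMap ?_
  rw [← AlgHom.comp_toLinearMap, ExteriorAlgebra.map_comp_map, hs, ExteriorAlgebra.map_id]
  rfl

theorem flat_exteriorAlgebra [Module.Projective A V] : Module.Flat A (ExteriorAlgebra A V) :=
  have := projective_exteriorAlgebra (A := A) (V := V)
  inferInstance

end Flat

/-! ### The grading of the homogenized algebra. -/

section Grading
variable {R A L : Type u} [CommRing R] [CommRing A] [Algebra R A] [LieRing L] [LieAlgebra R L]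
  [Module A L] [LieRingModule L A] [LieRinehartRing A L] [LieRinehartAlgebra R A L]

namespace HAlg

variable (R A L) in
/-- The coaction encoding the grading of `HAlg` with `A` in degree `0` and `L`, `η` in degree `1`. -/
def coact : HAlg R A L →ₐ[R] Polynomial (HAlg R A L) :=
  lift (Polynomial.CAlgHom.comp (ιA R A L))
    ((Polynomial.monomial 1).restrictScalars R ∘ₗ ιL R A L) (Polynomial.monomial 1 (η R A L))
    (fun a α => by simp [ιL_smul, Polynomial.C_mul_monomial])
    (fun α β => by simp [Polynomial.monomial_mul_monomial, ιL_lie])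
    (fun α a => by
      simp [Polynomial.monomial_mul_C, Polynomial.C_mul_monomial, ιA_lie])
    (fun a => by simp [Polynomial.monomial_mul_C, Polynomial.C_mul_monomial, η_comm])
    (fun α => by simp [Polynomial.monomial_mul_monomial, η_comm])

theorem coact_ιA (a : A) : coact R A L (ιA R A L a) = Polynomial.C (ιA R A L a) := lift_ιA ..

theorem coact_ιL (α : L) : coact R A L (ιL R A L α) = Polynomial.monomial 1 (ιL R A L α) :=
  lift_ιL ..

theorem coact_η : coact R A L (η R A L) = Polynomial.monomial 1 (η R A L) := lift_η ..

variable (R A L) in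
/-- The projection to the homogeneous component of degree `n`. -/
def gr (n : ℕ) : HAlg R A L →ₗ[A] HAlg R A L where
  toFun u := (coact R A L u).coeff n
  map_add' u v := by rw [map_add, Polynomial.coeff_add]
  map_smul' a u := by
    rw [smul_def, map_mul, coact_ιA, Polynomial.coeff_mul_C]; rfl

theorem gr_apply (n : ℕ) (u : HAlg R A L) : gr R A L n u = (coact R A L u).coeff n := rfl

theorem gr_succ_mul_ιL (n : ℕ) (u : HAlg R A L) (α : L) :
    gr R A L (n + 1) (u * ιL R A L α) = gr R A L n u * ιL R A L α := by
  rw [gr_apply, map_mul, coact_ιL, Polynomial.coeff_mul_monomial]; rfl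

theorem gr_succ_η_mul (n : ℕ) (u : HAlg R A L) :
    gr R A L (n + 1) (η R A L * u) = η R A L * gr R A L n u := by
  rw [η_comm, η_comm, gr_apply, map_mul, coact_η, Polynomial.coeff_mul_monomial]; rfl

theorem gr_zero_mul_ιL (u : HAlg R A L) (α : L) : gr R A L 0 (u * ιL R A L α) = 0 := by
  rw [gr_apply, map_mul, coact_ιL, ← Polynomial.C_mul_X_eq_monomial, ← mul_assoc,
    Polynomial.coeff_mul_X_zero]

theorem gr_zero_η_mul (u : HAlg R A L) : gr R A L 0 (η R A L * u) = 0 := by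
  rw [η_comm, gr_apply, map_mul, coact_η, ← Polynomial.C_mul_X_eq_monomial, ← mul_assoc,
    Polynomial.coeff_mul_X_zero]

theorem eval_coact (u : HAlg R A L) : (coact R A L u).eval 1 = u := by
  -- Although the coefficients do not commute, evaluation at `1` is multiplicative because `1` is
  -- central.
  let ev : Polynomial (HAlg R A L) →+* HAlg R A L :=
    Polynomial.eval₂RingHom' (RingHom.id _) 1 (fun a => Commute.one_right a)
  change ev (coact R A L u) = u
  induction u using induction with
  | hA a => rw [coact_ιA]; exact Polynomial.eval_C
  | hL α => rw [coact_ιL]; exact (Polynomial.eval_monomial).trans (by simp)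
  | hη => rw [coact_η]; exact (Polynomial.eval_monomial).trans (by simp)
  | hmul x y hx hy => rw [map_mul, map_mul, hx, hy]
  | hadd x y hx hy => rw [map_add, map_add, hx, hy]

/-- The equality is kept for all `M ≥ N`, so that several elements can share one bound when tensors
are summed in `exists_sum_gr_rTensor`. -/
theorem exists_sum_gr (u : HAlg R A L) :
    ∃ N, ∀ M ≥ N, ∑ n ∈ Finset.range M, gr R A L n u = u := by
  refine ⟨(coact R A L u).natDegree + 1, fun M hM => ?_⟩
  conv_rhs => rw [← eval_coact u, Polynomial.eval_eq_sum_range' (n := M) (by omega)]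
  simp [gr_apply]

theorem eq_zero_of_gr {u : HAlg R A L} (h : ∀ n, gr R A L n u = 0) : u = 0 := by
  obtain ⟨N, hN⟩ := exists_sum_gr u
  rw [← hN N le_rfl]
  exact Finset.sum_eq_zero fun n _ => h n

/-- If `ηu = u`, the component of degree zero vanishes because `η` has degree one, and the component
of degree `n + 1` is `η` times that of degree `n`. -/
theorem ηSub_injective : Function.Injective (ηSub R A L) := by
  rw [← LinearMap.ker_eq_bot, LinearMap.ker_eq_bot']
  intro u hu
  have h : η R A L * u = u := by
    rw [ηSub_apply, sub_mul, one_mul, sub_eq_zero] at hu; exact hu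
  refine eq_zero_of_gr fun n => ?_
  induction n with
  | zero => rw [← h, gr_zero_η_mul]
  | succ n ih => rw [← h, gr_succ_η_mul, ih, mul_zero]

/-- The grading is that of the coefficients in `HAlg` alone. Every term of the differential
multiplies the coefficient by one factor from `L` or by `η`, so its degree goes up by one. -/
theorem diff_gr_succ (n : ℕ) (z : HAlg R A L ⊗[A] ExteriorAlgebra A L) :
    (gr R A L (n + 1)).rTensor _ ((param R A L).diff z) =
      (param R A L).diff ((gr R A L n).rTensor _ z) :=
  ((param R A L).diff_rTensor (param R A L) _ _ (fun u => gr_succ_η_mul n u)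
    (fun α u => gr_succ_mul_ιL n u α) z).symm

theorem diff_gr_zero (z : HAlg R A L ⊗[A] ExteriorAlgebra A L) :
    (gr R A L 0).rTensor _ ((param R A L).diff z) = 0 := by
  -- This is naturality with the pair `(0, gr 0)`: nothing lies below degree zero.
  have h := (param R A L).diff_rTensor (param R A L) 0 (gr R A L 0)
    (fun u => (gr_zero_η_mul u).trans (map_zero _).symm)
    (fun α u => (gr_zero_mul_ιL u α).trans (map_zero _).symm) z
  rw [← h, LinearMap.rTensor_zero]; simp

theorem exists_sum_gr_rTensor (z : HAlg R A L ⊗[A] ExteriorAlgebra A L) :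
    ∃ N, ∀ M ≥ N, ∑ n ∈ Finset.range M, (gr R A L n).rTensor _ z = z := by
  induction z with
  | zero => exact ⟨0, by simp⟩
  | add s t hs ht =>
    obtain ⟨N, hN⟩ := hs
    obtain ⟨N', hN'⟩ := ht
    refine ⟨max N N', fun M hM => ?_⟩
    simp only [map_add, Finset.sum_add_distrib]
    rw [hN M (le_trans (le_max_left _ _) hM), hN' M (le_trans (le_max_right _ _) hM)]
  | tmul u w =>
    obtain ⟨N, hN⟩ := exists_sum_gr u
    refine ⟨N, fun M hM => ?_⟩
    simp only [LinearMap.rTensor_tmul]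
    rw [← TensorProduct.sum_tmul, hN M hM]

end HAlg
end Grading

/-! ### A representation that detects boundaries in low degrees. -/

section Representation
variable {R A L : Type u} [CommRing R] [CommRing A] [Algebra R A] [LieRing L] [LieAlgebra R L]
  [Module A L] [LieRingModule L A] [LieRinehartRing A L] [LieRinehartAlgebra R A L]

namespace HAlg

/-- `∑ₙ aₙ ηⁿ`. -/
def ofSeq : (ℕ →₀ A) →ₗ[R] HAlg R A L :=
  Finsupp.lsum R fun n => LinearMap.mulRight R (η R A L ^ n) ∘ₗ (ιA R A L).toLinearMap

theorem ofSeq_single (n : ℕ) (a : A) :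
    ofSeq (Finsupp.single n a) = ιA R A L a * η R A L ^ n := by
  simp [ofSeq]

variable (R A) in
/-- The shift of sequences. -/
def seqShift : (ℕ →₀ A) →ₗ[R] ℕ →₀ A := Finsupp.lmapDomain A R Nat.succ

theorem seqShift_single (n : ℕ) (a : A) :
    seqShift R A (Finsupp.single n a) = Finsupp.single (n + 1) a := by
  simp [seqShift]

variable (R A L) in
/-- The action of `L` on sequences. -/
def seqLie : L →ₗ[R] (ℕ →₀ A) →ₗ[R] ℕ →₀ A where
  toFun α := Finsupp.mapRange.linearMap (LieModule.toEnd R L A α)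
  map_add' α β := by ext; simp
  map_smul' r α := by ext; simp

theorem seqLie_single (α : L) (n : ℕ) (a : A) :
    seqLie R A L α (Finsupp.single n a) = Finsupp.single n ⁅α, a⁆ := by
  simp [seqLie]

theorem seq_induction {p : (ℕ →₀ A) → Prop} (h0 : p 0) (hadd : ∀ f g, p f → p g → p (f + g))
    (h : ∀ n a, p (Finsupp.single n a)) (f) : p f := by
  induction f using Finsupp.induction_linear with
  | zero => exact h0
  | add f g hf hg => exact hadd f g hf hg
  | single n a => exact h n a

theorem ofSeq_smul (a : A) (f : ℕ →₀ A) :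
    (ofSeq (a • f) : HAlg R A L) = ιA R A L a * ofSeq f := by
  induction f using seq_induction with
  | h0 => simp
  | hadd f g hf hg => rw [smul_add, map_add, hf, hg, map_add, mul_add]
  | h n b => rw [Finsupp.smul_single, ofSeq_single, ofSeq_single, smul_eq_mul, map_mul, mul_assoc]

theorem ofSeq_mul_ιA (a : A) (f : ℕ →₀ A) :
    (ofSeq f : HAlg R A L) * ιA R A L a = ofSeq (a • f) := by
  induction f using seq_induction with
  | h0 => simp
  | hadd f g hf hg => rw [smul_add, map_add, map_add, add_mul, hf, hg]
  | h n b =>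
    have h := (Commute.pow_left (show Commute (η R A L) (ιA R A L a) from η_comm _) n).eq
    rw [Finsupp.smul_single, ofSeq_single, ofSeq_single, smul_eq_mul, mul_assoc, h, ← mul_assoc,
      ← map_mul, mul_comm]

theorem ofSeq_shift (f : ℕ →₀ A) :
    (ofSeq (seqShift R A f) : HAlg R A L) = η R A L * ofSeq f := by
  induction f using seq_induction with
  | h0 => simp
  | hadd f g hf hg => rw [map_add, map_add, hf, hg, map_add, mul_add]
  | h n b =>
    rw [seqShift_single, ofSeq_single, ofSeq_single, pow_succ', ← mul_assoc, ← mul_assoc, η_comm]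

theorem ιL_mul_ofSeq (α : L) (f : ℕ →₀ A) :
    ιL R A L α * ofSeq f = ofSeq f * ιL R A L α + ofSeq (seqShift R A (seqLie R A L α f)) := by
  induction f using seq_induction with
  | h0 => simp
  | hadd f g hf hg => simp only [map_add, mul_add, add_mul, hf, hg]; abel
  | h n a =>
    have h := (Commute.pow_left (show Commute (η R A L) (ιL R A L α) from η_comm _) n).eq
    have h2 : ιL R A L α * ιA R A L a = ιA R A L a * ιL R A L α + ιA R A L ⁅α, a⁆ * η R A L := by
      rw [← η_comm, ιA_lie]; abel
    rw [seqLie_single, seqShift_single, ofSeq_single, ofSeq_single, ← mul_assoc, h2, mul_assoc _ _ (ιL R A L α), h,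
      add_mul, pow_succ', mul_assoc, mul_assoc]

theorem seqShift_smul (a : A) (f : ℕ →₀ A) : seqShift R A (a • f) = a • seqShift R A f :=
  Finsupp.mapDomain_smul a f

theorem seqLie_smul (α : L) (a : A) (f : ℕ →₀ A) :
    seqLie R A L α (a • f) = a • seqLie R A L α f + ⁅α, a⁆ • f := by
  ext n; simp [seqLie, mul_comm]

theorem smul_seqLie (α : L) (a : A) (f : ℕ →₀ A) :
    seqLie R A L (a • α) f = a • seqLie R A L α f := by
  ext n; simp [seqLie]

theorem seqLie_shift (α : L) (f : ℕ →₀ A) :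
    seqLie R A L α (seqShift R A f) = seqShift R A (seqLie R A L α f) := by
  induction f using seq_induction with
  | h0 => simp
  | hadd f g hf hg => simp only [map_add, hf, hg]
  | h n a => rw [seqShift_single, seqLie_single, seqLie_single, seqShift_single]

theorem seqLie_lie (α β : L) (f : ℕ →₀ A) :
    seqLie R A L ⁅α, β⁆ f = seqLie R A L α (seqLie R A L β f) - seqLie R A L β (seqLie R A L α f) := by
  ext n; simp [seqLie]

theorem seqShift_injective : Function.Injective (seqShift R A) :=
  Finsupp.mapDomain_injective Nat.succ_injective

/-- The shift has zeroth coefficient `0`, and its coefficient at `n + 1` is that of `f` at `n`. All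
coefficients vanish in turn. -/
theorem eq_zero_of_seqShift_eq {f : ℕ →₀ A} (hf : seqShift R A f = f) : f = 0 := by
  ext n
  induction n with
  | zero =>
    rw [← hf]
    exact Finsupp.mapDomain_of_notMem_range _ _ (by simp)
  | succ n ih =>
    rw [← hf]
    exact (Finsupp.mapDomain_apply Nat.succ_injective f n).trans ih

variable (R A L) in
/-- The differential as a left `HAlg`-linear map. -/
def hDiff : HAlg R A L ⊗[A] ExteriorAlgebra A L →ₗ[HAlg R A L]
    HAlg R A L ⊗[A] ExteriorAlgebra A L :=
  { (param R A L).diff with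
    map_smul' := fun u t => by
      let f : HAlg R A L →ₗ[A] HAlg R A L :=
        { toFun := fun v => u * v
          map_add' := mul_add u
          map_smul' := fun a v => (mul_assoc _ _ _).symm }
      have hs : ∀ t : HAlg R A L ⊗[A] ExteriorAlgebra A L, u • t = f.rTensor _ t := fun t => by
        induction t with
        | zero => simp
        | add s t hs ht => rw [smul_add, map_add, hs, ht]
        | tmul v w => rfl
      have := (param R A L).diff_rTensor (param R A L) f f
        (fun n => by
          change u * (η R A L * n) = η R A L * (u * n)
          rw [← mul_assoc, ← η_comm, mul_assoc])
        (fun α n => (mul_assoc _ _ _).symm) t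
      rw [hs]
      exact this.trans (hs _).symm }

theorem hDiff_apply (t : HAlg R A L ⊗[A] ExteriorAlgebra A L) :
    hDiff R A L t = (param R A L).diff t := rfl

variable (R A L) in
/-- The cokernel of the differential. -/
abbrev Coker : Type u := (HAlg R A L ⊗[A] ExteriorAlgebra A L) ⧸ LinearMap.range (hDiff R A L)

variable (R A L) in
/-- `(f, α) ↦ f ⊗ α`, for `f = ∑ₙ fₙ ηⁿ`. -/
def seqTmul : L →ₗ[R] (ℕ →₀ A) →ₗ[R] Coker R A L :=
  LinearMap.mk₂ R (fun α f => Submodule.Quotient.mk (ofSeq f ⊗ₜ ExteriorAlgebra.ι A α))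
    (fun α β f => by rw [map_add, TensorProduct.tmul_add]; rfl)
    (fun r α f => by
      have : ExteriorAlgebra.ι A (r • α) = r • ExteriorAlgebra.ι A α := by
        rw [← algebraMap_smul A r α, map_smul, algebraMap_smul]
      rw [this, TensorProduct.tmul_smul]; rfl)
    (fun α f g => by rw [map_add, TensorProduct.add_tmul]; rfl)
    (fun r α f => by rw [map_smul, ← TensorProduct.smul_tmul']; rfl)

theorem seqTmul_apply (α : L) (f : ℕ →₀ A) :
    seqTmul R A L α f = Submodule.Quotient.mk (ofSeq f ⊗ₜ ExteriorAlgebra.ι A α) := rfl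

theorem mk_ofSeq_mul (u : HAlg R A L) (α : L) (f : ℕ →₀ A) :
    u • seqTmul R A L α f = Submodule.Quotient.mk ((u * ofSeq f) ⊗ₜ ExteriorAlgebra.ι A α) := rfl

theorem seqTmul_smul (a : A) (α : L) (f : ℕ →₀ A) :
    seqTmul R A L α (a • f) = ιA R A L a • seqTmul R A L α f := by
  rw [mk_ofSeq_mul, seqTmul_apply, ofSeq_smul]

theorem smul_seqTmul (a : A) (α : L) (f : ℕ →₀ A) :
    seqTmul R A L (a • α) f = ιA R A L a • seqTmul R A L α f := by
  rw [mk_ofSeq_mul, seqTmul_apply, ← ofSeq_smul, map_smul, TensorProduct.tmul_smul,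
    TensorProduct.smul_tmul', smul_def, ofSeq_mul_ιA]

theorem seqTmul_shift (α : L) (f : ℕ →₀ A) :
    seqTmul R A L α (seqShift R A f) = η R A L • seqTmul R A L α f := by
  rw [mk_ofSeq_mul, seqTmul_apply, ofSeq_shift]

/-- Once `α` and `β` are moved past `f`, the terms with `α(f)` and `β(f)` cancel. What remains is
the boundary of `f ⊗ α ∧ β`. This is the relation that forces the passage to the cokernel. -/
theorem seqTmul_lie (α β : L) (f : ℕ →₀ A) :
    η R A L • seqTmul R A L ⁅α, β⁆ f =
      (ιL R A L α • seqTmul R A L β f + seqTmul R A L α (seqShift R A (seqLie R A L β f))) -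
      (ιL R A L β • seqTmul R A L α f + seqTmul R A L β (seqShift R A (seqLie R A L α f))) := by
  rw [mk_ofSeq_mul, mk_ofSeq_mul, mk_ofSeq_mul, seqTmul_apply, seqTmul_apply, ιL_mul_ofSeq,
    ιL_mul_ofSeq]
  have h := TensorProduct.add_tmul (R := A) (ofSeq f * ιL R A L α)
    (ofSeq (seqShift R A (seqLie R A L α f))) (ExteriorAlgebra.ι A β)
  have h' := TensorProduct.add_tmul (R := A) (ofSeq f * ιL R A L β)
    (ofSeq (seqShift R A (seqLie R A L β f))) (ExteriorAlgebra.ι A α)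
  rw [h, h', ← Submodule.Quotient.mk_add, ← Submodule.Quotient.mk_add, ← Submodule.Quotient.mk_sub]
  rw [eq_comm, Submodule.Quotient.eq]
  refine ⟨ofSeq f ⊗ₜ (ExteriorAlgebra.ι A α * ExteriorAlgebra.ι A β), ?_⟩
  rw [hDiff_apply, ParamModule.diff_ι_ι, param_act, param_act, param_η]
  abel

variable (R A L) in
/-- The representation of `HAlg` extending the cokernel of the differential by the sequences. -/
def rep : HAlg R A L →ₐ[R] Module.End R (Coker R A L × (ℕ →₀ A)) :=
  lift
    ((LinearMap.prodMapAlgHom R (Coker R A L) (ℕ →₀ A)).comp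
      (((Algebra.lsmul R R (Coker R A L)).comp (ιA R A L)).prod (Algebra.lsmul R R (ℕ →₀ A))))
    -- The action imitates `αf = fα + η α(f)` in `HAlg`: the class of `f ⊗ α` stands for the product
    -- `fα` and goes to the first factor, while `η α(f)` stays among the sequences.
    { toFun := fun α => ((Algebra.lsmul R R (Coker R A L) (ιL R A L α)).coprod (seqTmul R A L α)).prod
        (seqShift R A ∘ₗ seqLie R A L α ∘ₗ LinearMap.snd R _ _)
      map_add' := fun α β => by
        apply LinearMap.ext; rintro ⟨q, f⟩
        simp [add_smul]
        abel
      map_smul' := fun r α => by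
        apply LinearMap.ext; rintro ⟨q, f⟩
        simp }
    ((Algebra.lsmul R R (Coker R A L) (η R A L)).prodMap (seqShift R A))
    (fun a α => by
      apply LinearMap.ext; rintro ⟨q, f⟩
      apply Prod.ext
      · simp [ιL_smul, mul_smul, smul_seqTmul]
      · simp [seqShift_smul, smul_seqLie])
    (fun α β => by
      apply LinearMap.ext; rintro ⟨q, f⟩
      apply Prod.ext
      · have h : η R A L • ιL R A L ⁅α, β⁆ • q =
            ιL R A L α • ιL R A L β • q - ιL R A L β • ιL R A L α • q := by
          rw [← mul_smul, ιL_lie, sub_smul, mul_smul, mul_smul]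
        simp [h, seqTmul_lie]
        abel
      · simp [seqLie_shift, seqLie_lie])
    (fun α a => by
      apply LinearMap.ext; rintro ⟨q, f⟩
      apply Prod.ext
      · have h : η R A L • ιA R A L ⁅α, a⁆ • q =
            ιL R A L α • ιA R A L a • q - ιA R A L a • ιL R A L α • q := by
          rw [← mul_smul, ιA_lie, sub_smul, mul_smul, mul_smul]
        simp [h, seqTmul_smul]
      · simp [seqShift_smul, seqLie_smul])
    (fun a => by
      apply LinearMap.ext; rintro ⟨q, f⟩
      apply Prod.ext
      · simp [← mul_smul, η_comm]
      · simp [seqShift_smul])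
    (fun α => by
      apply LinearMap.ext; rintro ⟨q, f⟩
      apply Prod.ext
      · simp [← mul_smul, η_comm, seqTmul_shift]
      · simp [seqLie_shift])

theorem rep_ιA (a : A) (q : Coker R A L) (f : ℕ →₀ A) :
    rep R A L (ιA R A L a) (q, f) = (ιA R A L a • q, a • f) := by
  rw [rep, lift_ιA]; rfl

theorem rep_ιL (α : L) (q : Coker R A L) (f : ℕ →₀ A) :
    rep R A L (ιL R A L α) (q, f) =
      (ιL R A L α • q + seqTmul R A L α f, seqShift R A (seqLie R A L α f)) := by
  rw [rep, lift_ιL]; rfl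

theorem rep_η (q : Coker R A L) (f : ℕ →₀ A) :
    rep R A L (η R A L) (q, f) = (η R A L • q, seqShift R A f) := by
  rw [rep, lift_η]; rfl

theorem rep_inl (u : HAlg R A L) (q : Coker R A L) :
    rep R A L u (q, 0) = (u • q, 0) := by
  induction u using induction generalizing q with
  | hA a => rw [rep_ιA, smul_zero]
  | hL α => rw [rep_ιL, map_zero, map_zero, map_zero, add_zero]
  | hη => rw [rep_η, map_zero]
  | hmul x y hx hy => rw [map_mul, Module.End.mul_apply, hy, hx, mul_smul]
  | hadd x y hx hy => rw [map_add, LinearMap.add_apply, hx, hy, add_smul]; simp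

variable (R A L) in
/-- The orbit map of the constant sequence. -/
def orbit : HAlg R A L →ₗ[R] Coker R A L × (ℕ →₀ A) :=
  LinearMap.applyₗ (0, Finsupp.single 0 1) ∘ₗ (rep R A L).toLinearMap

theorem orbit_apply (u : HAlg R A L) : orbit R A L u = rep R A L u (0, Finsupp.single 0 1) := rfl

theorem orbit_ofSeq (f : ℕ →₀ A) : orbit R A L (ofSeq f) = (0, f) := by
  induction f using seq_induction with
  | h0 => rw [map_zero, map_zero]; rfl
  | hadd f g hf hg => rw [map_add, map_add, hf, hg]; simp
  | h n a =>
    have h : ∀ n, rep R A L (η R A L ^ n) (0, Finsupp.single 0 1) = (0, Finsupp.single n 1) := by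
      intro n
      induction n with
      | zero => simp
      | succ n ih => rw [pow_succ', map_mul, Module.End.mul_apply, ih, rep_η, smul_zero,
          seqShift_single]
    rw [ofSeq_single, orbit_apply, map_mul, Module.End.mul_apply, h, rep_ιA, smul_zero]
    simp

/-- As `α(1) = 0`, the element `α` moves the constant sequence into the cokernel, to the class of `1
⊗ α`. The cokernel is a subrepresentation, on which `u` acts in the ordinary way. -/
theorem orbit_mul_ιL (u : HAlg R A L) (α : L) :
    orbit R A L (u * ιL R A L α) =
      (Submodule.Quotient.mk (u ⊗ₜ ExteriorAlgebra.ι A α), 0) := by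
  have h1 : ⁅α, (1 : A)⁆ = 0 := by
    have := LieRinehartRing.leibniz_mul_right' α (1 : A) 1
    simpa using this
  rw [orbit_apply, map_mul, Module.End.mul_apply, rep_ιL, seqLie_single, h1,
    Finsupp.single_zero, map_zero, smul_zero, zero_add, rep_inl, mk_ofSeq_mul, ofSeq_single]
  simp

variable (R A L) in
/-- `t ↦ u • 1`-component: `u ⊗ w ↦ u w₀`, with `w₀ ∈ A` the component of degree zero. -/
def coef₀ : HAlg R A L ⊗[A] ExteriorAlgebra A L →ₗ[A] HAlg R A L :=
  (TensorProduct.rid A (HAlg R A L)).toLinearMap ∘ₗ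
    (ExteriorAlgebra.algebraMapInv (M := L)).toLinearMap.lTensor _

theorem coef₀_tmul (u : HAlg R A L) (w : ExteriorAlgebra A L) :
    coef₀ R A L (u ⊗ₜ w) = ExteriorAlgebra.algebraMapInv w • u := by
  simp [coef₀]

theorem coef₀_one (u : HAlg R A L) : coef₀ R A L (u ⊗ₜ 1) = u := by
  rw [coef₀_tmul, map_one, one_smul]

theorem algebraMapInv_extProj (x : ExteriorAlgebra R L) :
    ExteriorAlgebra.algebraMapInv (extProj R A L x) =
      algebraMap R A (ExteriorAlgebra.algebraMapInv x) := by
  induction x using extR_induction with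
  | h0 => simp
  | h1 => simp
  | hadd x y hx hy => simp only [map_add, hx, hy]
  | hsmul r x hx =>
    have h : ∀ z : ExteriorAlgebra A L, r • z = algebraMap R A r • z := fun z => by simp
    rw [map_smul, h, map_smul, hx]; simp
  | hι m x hx => simp [ExteriorAlgebra.algebraMapInv]

theorem algebraMapInv_lieExt (x : ExteriorAlgebra R L) (α : L) :
    ExteriorAlgebra.algebraMapInv (extProj R A L (lieExt R L x α)) = 0 := by
  induction x using extR_induction with
  | h0 => simp
  | h1 => simp [lieExt_one]
  | hadd x y hx hy => simp only [map_add, LinearMap.add_apply, hx, hy, add_zero]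
  | hsmul r x hx =>
    have h : ∀ z : ExteriorAlgebra A L, r • z = algebraMap R A r • z := fun z => by simp
    simp only [map_smul, LinearMap.smul_apply, h, hx, smul_zero]
  | hι m x hx =>
    simp [lieExt_ι_mul, ExteriorAlgebra.algebraMapInv]

theorem coef₀_wedgeL (α : L) (t : HAlg R A L ⊗[A] ExteriorAlgebra A L) :
    coef₀ R A L (wedgeL A _ α t) = 0 := by
  induction t with
  | zero => simp
  | add s t hs ht => rw [map_add, map_add, hs, ht, add_zero]
  | tmul u w => rw [wedgeL_tmul, coef₀_tmul, map_mul]; simp [ExteriorAlgebra.algebraMapInv]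

/-- The part of a boundary in exterior degree zero is a combination of products `uα`, and these have
no component among the sequences by `orbit_mul_ιL`. -/
theorem orbit_coef₀_diff (t : HAlg R A L ⊗[A] ExteriorAlgebra A L) :
    (orbit R A L (coef₀ R A L ((param R A L).diff t))).2 = 0 := by
  refine tmul_induction (R := R)
    (p := fun t => (orbit R A L (coef₀ R A L ((param R A L).diff t))).2 = 0)
    (by simp) (fun s t hs ht => by simp only [map_add, Prod.snd_add, hs, ht, add_zero])
    (fun u x => ?_) t
  induction x using extR_induction with
  | h0 => simp
  | h1 => rw [map_one, ParamModule.diff_one]; simp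
  | hadd x y hx hy =>
    simp only [map_add, TensorProduct.tmul_add, Prod.snd_add, hx, hy, add_zero]
  | hsmul r x hx =>
    have h : ∀ v : HAlg R A L, r • v = algebraMap R A r • v := fun v => by simp
    rw [map_smul, TensorProduct.tmul_smul, map_smul, ← algebraMap_smul A r, map_smul, algebraMap_smul,
      map_smul, Prod.smul_snd, hx, smul_zero]
  | hι α x hx =>
    rw [map_mul, extProj_ι, ParamModule.diff_wedge, map_sub, map_sub, coef₀_wedgeL, map_sub, coef₀_tmul,
      coef₀_tmul, algebraMapInv_lieExt, zero_smul, sub_zero, map_zero, sub_zero,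
      algebraMapInv_extProj, algebraMap_smul, map_smul, param_act, orbit_mul_ιL, Prod.smul_snd, smul_zero]

variable (R A L) in
/-- The multiplication `u ⊗ α ↦ u α`. -/
def mulL : HAlg R A L ⊗[A] L →ₗ[R] HAlg R A L :=
  (coef₀ R A L).restrictScalars R ∘ₗ (param R A L).diff ∘ₗ
    ((ExteriorAlgebra.ι A).lTensor _).restrictScalars R

theorem mulL_tmul (u : HAlg R A L) (α : L) : mulL R A L (u ⊗ₜ α) = u * ιL R A L α := by
  change coef₀ R A L ((param R A L).diff (u ⊗ₜ ExteriorAlgebra.ι A α)) = _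
  rw [ParamModule.diff_ι, coef₀_one, param_act]

theorem diff_lTensor_ι (x : HAlg R A L ⊗[A] L) :
    (param R A L).diff ((ExteriorAlgebra.ι A).lTensor _ x) = mulL R A L x ⊗ₜ 1 := by
  induction x with
  | zero => simp
  | add s t hs ht => rw [map_add, map_add, hs, ht, map_add, TensorProduct.add_tmul]
  | tmul u α =>
    rw [mulL_tmul, LinearMap.lTensor_tmul, ParamModule.diff_ι, param_act]

theorem mulL_smul (u : HAlg R A L) (x : HAlg R A L ⊗[A] L) :
    mulL R A L (u • x) = u * mulL R A L x := by
  induction x with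
  | zero => simp
  | add s t hs ht => rw [smul_add, map_add, hs, ht, map_add, mul_add]
  | tmul v α => rw [TensorProduct.smul_tmul', mulL_tmul, mulL_tmul, smul_eq_mul, mul_assoc]

theorem orbit_mulL (x : HAlg R A L ⊗[A] L) :
    orbit R A L (mulL R A L x) =
      (Submodule.Quotient.mk ((ExteriorAlgebra.ι A).lTensor _ x), 0) := by
  induction x with
  | zero => simp; rfl
  | add s t hs ht => rw [map_add, map_add, hs, ht, map_add]; simp
  | tmul u α => rw [mulL_tmul, orbit_mul_ιL, LinearMap.lTensor_tmul]

/-- The sum `A[η] + HL` contains `1` and is stable under left multiplication by the generators. For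
`α` this uses `αf = fα + η α(f)`. -/
theorem exists_eq_ofSeq_add_mulL (u : HAlg R A L) :
    ∃ (f : ℕ →₀ A) (x : HAlg R A L ⊗[A] L), u = ofSeq f + mulL R A L x := by
  suffices h : ∀ (v : HAlg R A L), (∃ f x, v = ofSeq f + mulL R A L x) →
      ∃ f x, u * v = ofSeq f + mulL R A L x by
    have := h 1 ⟨Finsupp.single 0 1, 0, by simp [ofSeq_single]⟩
    rwa [mul_one] at this
  induction u using induction with
  | hA a =>
    rintro _ ⟨f, x, rfl⟩
    exact ⟨a • f, ιA R A L a • x, by rw [mul_add, mulL_smul, ofSeq_smul]⟩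
  | hL α =>
    rintro _ ⟨f, x, rfl⟩
    exact ⟨seqShift R A (seqLie R A L α f), ofSeq f ⊗ₜ α + ιL R A L α • x, by
      rw [mul_add, ιL_mul_ofSeq, map_add, mulL_smul, mulL_tmul]; abel⟩
  | hη =>
    rintro _ ⟨f, x, rfl⟩
    exact ⟨seqShift R A f, η R A L • x, by rw [mul_add, mulL_smul, ofSeq_shift]⟩
  | hmul x y hx hy => intro v hv; rw [mul_assoc]; exact hx _ (hy v hv)
  | hadd x y hx hy =>
    intro v hv
    obtain ⟨f, s, hs⟩ := hx v hv
    obtain ⟨g, t, ht⟩ := hy v hv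
    exact ⟨f + g, s + t, by rw [add_mul, hs, ht, map_add, map_add]; abel⟩

/-- The orbit map separates the two summands and returns `f` itself and the class of `x` modulo
boundaries. This is exactness in exterior degrees zero and one, and it holds without projectivity of
`L`. -/
theorem of_ofSeq_add_mulL_eq_zero {f : ℕ →₀ A} {x : HAlg R A L ⊗[A] L}
    (h : ofSeq f + mulL R A L x = 0) :
    f = 0 ∧ ∃ y, (param R A L).diff y = (ExteriorAlgebra.ι A).lTensor _ x := by
  have h2 := congrArg (orbit R A L) h
  rw [map_add, orbit_ofSeq, orbit_mulL, map_zero, Prod.mk_add_mk, zero_add, add_zero,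
    Prod.mk_eq_zero] at h2
  obtain ⟨y, hy⟩ := (Submodule.Quotient.mk_eq_zero _).1 h2.1
  exact ⟨h2.2, y, hy⟩

end HAlg
end Representation

/-! ### From Koszul exactness to exactness of the Rinehart complex. -/

section Exactness
variable {R A L : Type u} [CommRing R] [CommRing A] [Algebra R A] [LieRing L] [LieAlgebra R L]
  [Module A L] [LieRingModule L A] [LieRinehartRing A L] [LieRinehartAlgebra R A L]

namespace HAlg

/-- The decomposition of a Koszul cycle is lifted from `Sym_A L` to `HAlg`. The error vanishes
modulo `η`, hence is a multiple of `η` by right exactness of the tensor product. -/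
theorem exists_diff_of_symDiff_eq_zero [Module.Projective A L]
    {z : HAlg R A L ⊗[A] ExteriorAlgebra A L}
    (hz : symDiff R A L ((toSymₗ R A L).rTensor _ z) = 0) :
    ∃ (a : A) (y z' : HAlg R A L ⊗[A] ExteriorAlgebra A L),
      z = ιA R A L a ⊗ₜ 1 + (param R A L).diff y + (param R A L).η.rTensor _ z' := by
  obtain ⟨a, y, hy⟩ := koszul_exact (A := A) (V := L) _ hz
  obtain ⟨y, rfl⟩ := LinearMap.rTensor_surjective (ExteriorAlgebra A L)
    (toSymₗ_surjective (R := R) (A := A) (L := L)) y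
  have h1 : (toSymₗ R A L).rTensor (ExteriorAlgebra A L) (ιA R A L a ⊗ₜ 1) =
      a • ((1 : SymAlg R A L) ⊗ₜ[A] (1 : ExteriorAlgebra A L)) := by
    rw [LinearMap.rTensor_tmul, TensorProduct.smul_tmul', ← Algebra.algebraMap_eq_smul_one]
    exact congrArg (· ⊗ₜ 1) (toSym_ιA a)
  have h2 : (toSymₗ R A L).rTensor (ExteriorAlgebra A L)
      (z - (ιA R A L a ⊗ₜ 1 + (param R A L).diff y)) = 0 := by
    rw [map_sub, map_add, h1, ← diff_toSymₗ, sub_eq_zero]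
    exact hy
  obtain ⟨z', hz'⟩ := (rTensor_exact (ExteriorAlgebra A L) exact_toSymₗ
    (toSymₗ_surjective (R := R) (A := A) (L := L)) _).1 h2
  exact ⟨a, y, z', by rw [hz']; abel⟩

theorem toSymₗ_η (z : HAlg R A L ⊗[A] ExteriorAlgebra A L) :
    (toSymₗ R A L).rTensor _ ((param R A L).η.rTensor _ z) = 0 :=
  (rTensor_exact (ExteriorAlgebra A L) exact_toSymₗ
    (toSymₗ_surjective (R := R) (A := A) (L := L)) _).2 ⟨z, rfl⟩

theorem lTensor_ι_smul_η (x : HAlg R A L ⊗[A] L) :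
    (ExteriorAlgebra.ι A).lTensor _ (η R A L • x) =
      (param R A L).η.rTensor _ ((ExteriorAlgebra.ι A).lTensor _ x) := by
  induction x with
  | zero => simp
  | add s t hs ht => rw [smul_add, map_add, hs, ht, map_add, map_add]
  | tmul u α => rfl

theorem diff_η_pow (m : ℕ) (z : HAlg R A L ⊗[A] ExteriorAlgebra A L) :
    ((param R A L).η ^ m).rTensor _ ((param R A L).diff z) =
      (param R A L).diff (((param R A L).η ^ m).rTensor _ z) := by
  induction m with
  | zero => simp [Module.End.one_eq_id]
  | succ m ih =>
    rw [pow_succ', Module.End.mul_eq_comp, LinearMap.rTensor_comp_apply,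
      LinearMap.rTensor_comp_apply, ih, diff_η]

/-- An element of `ker η` is shown to be a boundary with coefficients again in `ker η`. Since the
differential raises the degree, such elements have no component of lowest degree and therefore
vanish. -/
theorem η_injective [Module.Projective A L] : Function.Injective (param R A L).η := by
  rw [← LinearMap.ker_eq_bot, LinearMap.ker_eq_bot']
  have key : ∀ u : HAlg R A L, (param R A L).η u = 0 → ∃ w,
      u ⊗ₜ 1 = (param R A L).diff
        ((LinearMap.ker (param R A L).η).subtype.rTensor (ExteriorAlgebra A L) w) := by
    intro u hu
    obtain ⟨f, x, rfl⟩ := exists_eq_ofSeq_add_mulL u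
    rw [param_η, mul_add, ← ofSeq_shift, ← mulL_smul] at hu
    -- From `ηu = 0` it follows that `ηf = 0`, so `f = 0` and `u = mulL x`, and that `ηx` is a
    -- boundary `dy`.
    obtain ⟨hf, y, hy⟩ := of_ofSeq_add_mulL_eq_zero hu
    have hf0 : f = 0 := seqShift_injective (hf.trans (map_zero _).symm)
    subst hf0
    rw [lTensor_ι_smul_η] at hy
    -- Modulo `η` the element `y` is a cycle, so `y = a + dz + ηy'` and `ηx = dy = η dy'`.
    obtain ⟨a, z, y', h⟩ := exists_diff_of_symDiff_eq_zero (R := R) (z := y)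
      (by rw [diff_toSymₗ, hy, toSymₗ_η])
    have h2 : (param R A L).η.rTensor _
        ((ExteriorAlgebra.ι A).lTensor _ x - (param R A L).diff y') = 0 := by
      rw [map_sub, ← diff_η, ← hy, h, map_add, map_add, ParamModule.diff_one,
        ParamModule.diff_diff, zero_add, zero_add, sub_self]
    have := flat_exteriorAlgebra (A := A) (V := L)
    -- By flatness of `⋀ L`, the element `x - dy'`, killed by `η`, has its coefficients in `ker η`.
    -- Its boundary is `dx = u ⊗ 1`.
    obtain ⟨w, hw⟩ := (Module.Flat.rTensor_exact (ExteriorAlgebra A L)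
      (LinearMap.exact_subtype_ker_map (param R A L).η) _).1 h2
    refine ⟨w, ?_⟩
    rw [hw, map_sub, diff_lTensor_ι, ParamModule.diff_diff, map_zero, zero_add, sub_zero]
  intro u hu
  -- The claim is made for the whole of `ker η` at once, because the step applies the hypothesis in
  -- degree `n` to the coefficients of `w`.
  have hgr : ∀ n, (gr R A L n) ∘ₗ (LinearMap.ker (param R A L).η).subtype = 0 := by
    intro n
    induction n with
    | zero =>
      apply LinearMap.ext; rintro ⟨u, hu⟩
      obtain ⟨w, hw⟩ := key u hu
      have h := congrArg (fun t => coef₀ R A L ((gr R A L 0).rTensor _ t)) hw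
      simp only [diff_gr_zero, LinearMap.rTensor_tmul, coef₀_one, map_zero] at h
      exact h
    | succ n ih =>
      apply LinearMap.ext; rintro ⟨u, hu⟩
      obtain ⟨w, hw⟩ := key u hu
      have h := congrArg (fun t => coef₀ R A L ((gr R A L (n + 1)).rTensor _ t)) hw
      simp only [diff_gr_succ, LinearMap.rTensor_tmul, coef₀_one, map_zero,
        ← LinearMap.rTensor_comp_apply, ih, LinearMap.rTensor_zero, LinearMap.zero_apply] at h
      exact h
  exact eq_zero_of_gr fun n => LinearMap.congr_fun (hgr n) ⟨u, hu⟩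

/-- Koszul exactness is applied repeatedly to remove one power of `η` after another. The process
need not stop, but in each degree only finitely many powers of `η` matter, and `x` has finitely many
components. -/
theorem exact_diff [Module.Projective A L] (x : HAlg R A L ⊗[A] ExteriorAlgebra A L)
    (hx : (param R A L).diff x = 0) :
    ∃ (u : HAlg R A L) (z : HAlg R A L ⊗[A] ExteriorAlgebra A L),
      x = u ⊗ₜ 1 + (param R A L).diff z := by
  have := flat_exteriorAlgebra (A := A) (V := L)
  have hη := Module.Flat.rTensor_preserves_injective_linearMap (M := ExteriorAlgebra A L) _
    (η_injective (R := R) (A := A) (L := L))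
  have step : ∀ m : ℕ, ∃ (u : HAlg R A L) (z x' : HAlg R A L ⊗[A] ExteriorAlgebra A L),
      (param R A L).diff x' = 0 ∧ x = u ⊗ₜ 1 + (param R A L).diff z +
        ((param R A L).η ^ m).rTensor _ x' := by
    intro m
    induction m with
    | zero => exact ⟨0, 0, x, hx, by simp [Module.End.one_eq_id]⟩
    | succ m ih =>
      obtain ⟨u, z, x', hx', h⟩ := ih
      obtain ⟨a, y, x'', h'⟩ := exists_diff_of_symDiff_eq_zero (R := R) (z := x')
        (by rw [diff_toSymₗ, hx', map_zero])
      refine ⟨u + ((param R A L).η ^ m) (ιA R A L a), z + ((param R A L).η ^ m).rTensor _ y, x'',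
        ?_, ?_⟩
      -- The remainder is a cycle only after multiplication by `η`; injectivity of `η` on the tensor
      -- product removes that factor and lets the iteration continue.
      · apply hη
        have h3 := congrArg (param R A L).diff h'
        rw [hx', map_add, map_add, ParamModule.diff_one, ParamModule.diff_diff, diff_η] at h3
        rw [map_zero, ← add_zero (LinearMap.rTensor _ _ _)]
        simpa using h3.symm
      · rw [h, h', map_add, map_add, LinearMap.rTensor_tmul, diff_η_pow, TensorProduct.add_tmul, map_add,
          pow_succ, Module.End.mul_eq_comp, LinearMap.rTensor_comp_apply]
        abel
  -- Multiples of `η ^ m` live in degrees at least `m`.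
  have hg : ∀ n m, n < m → gr R A L n ∘ₗ (param R A L).η ^ m = 0 := by
    intro n
    induction n with
    | zero =>
      intro m hm
      obtain ⟨m, rfl⟩ := Nat.exists_eq_add_of_lt hm
      apply LinearMap.ext; intro u
      rw [Nat.zero_add, pow_succ']
      exact gr_zero_η_mul _
    | succ n ih =>
      intro m hm
      obtain ⟨m, rfl⟩ : ∃ k, m = k + 1 := ⟨m - 1, by omega⟩
      apply LinearMap.ext; intro u
      rw [pow_succ']
      refine (gr_succ_η_mul n _).trans ?_
      have := LinearMap.congr_fun (ih m (by omega)) u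
      exact (congrArg _ this).trans (mul_zero _)
  have comp : ∀ n, ∃ u z, (gr R A L n).rTensor _ x = u ⊗ₜ 1 + (param R A L).diff z := by
    intro n
    -- Approximation to order `n + 1` puts the remainder above degree `n`, where the projection does
    -- not see it.
    obtain ⟨u, z, x', -, h⟩ := step (n + 1)
    have h0 : (gr R A L n).rTensor (ExteriorAlgebra A L)
        (((param R A L).η ^ (n + 1)).rTensor _ x') = 0 := by
      rw [← LinearMap.rTensor_comp_apply, hg n (n + 1) (by omega), LinearMap.rTensor_zero,
        LinearMap.zero_apply]
    rw [h, map_add, h0, map_add, add_zero, LinearMap.rTensor_tmul]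
    cases n with
    | zero => exact ⟨_, 0, by rw [diff_gr_zero, map_zero]⟩
    | succ n => exact ⟨_, _, by rw [diff_gr_succ]⟩
  obtain ⟨N, hN⟩ := exists_sum_gr_rTensor x
  choose u z h using comp
  refine ⟨∑ n ∈ Finset.range N, u n, ∑ n ∈ Finset.range N, z n, ?_⟩
  rw [TensorProduct.sum_tmul, map_sum, ← Finset.sum_add_distrib, ← hN N le_rfl]
  exact Finset.sum_congr rfl fun n _ => h n

theorem diff_ηSub (z : HAlg R A L ⊗[A] ExteriorAlgebra A L) :
    (param R A L).diff ((ηSub R A L).rTensor _ z) = (ηSub R A L).rTensor _ ((param R A L).diff z) := by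
  rw [ηSub, LinearMap.rTensor_sub, LinearMap.sub_apply, LinearMap.sub_apply, map_sub, diff_η,
    LinearMap.rTensor_id, LinearMap.id_apply, LinearMap.id_apply]

/-- In `H = A[η] + HL` the first summand specializes to `A` because `η` becomes `1`, and `uα ⊗ 1` is
the boundary of `u ⊗ α`. -/
theorem ofSeq_mulL_toU (u : HAlg R A L) :
    ∃ (a : A) (z : URight R A L ⊗[A] ExteriorAlgebra A L),
      toUₗ R A L u ⊗ₜ 1 = URight.of R A L (UAlg.ιA R A L a) ⊗ₜ 1 + rinehartDiff R A L z := by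
  obtain ⟨f, x, rfl⟩ := exists_eq_ofSeq_add_mulL u
  have hf : ∀ f : ℕ →₀ A, ∃ a, toUₗ R A L (ofSeq f) = URight.of R A L (UAlg.ιA R A L a) := by
    intro f
    induction f using seq_induction with
    | h0 => exact ⟨0, by simp⟩
    | hadd f g hf hg =>
      obtain ⟨a, ha⟩ := hf
      obtain ⟨b, hb⟩ := hg
      exact ⟨a + b, by rw [map_add, map_add, ha, hb, map_add, map_add]⟩
    | h n a =>
      refine ⟨a, ?_⟩
      change URight.of R A L (toU R A L (ofSeq (Finsupp.single n a))) = _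
      rw [ofSeq_single, map_mul, map_pow, toU_η, one_pow, mul_one, toU_ιA]
  obtain ⟨a, ha⟩ := hf f
  refine ⟨a, (toUₗ R A L).rTensor _ ((ExteriorAlgebra.ι A).lTensor _ x), ?_⟩
  rw [diff_toUₗ, diff_lTensor_ι, LinearMap.rTensor_tmul, map_add, ha, TensorProduct.add_tmul]

end HAlg

open HAlg in
/-- The Rinehart complex of a projective Lie--Rinehart algebra is a resolution of `A`. -/
theorem rinehartDiff_exact [Module.Projective A L] (x : URight R A L ⊗[A] ExteriorAlgebra A L)
    (hx : rinehartDiff R A L x = 0) :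
    ∃ (a : A) (z : URight R A L ⊗[A] ExteriorAlgebra A L),
      x = URight.of R A L (UAlg.ιA R A L a) ⊗ₜ 1 + rinehartDiff R A L z := by
  obtain ⟨x, rfl⟩ := LinearMap.rTensor_surjective (ExteriorAlgebra A L)
    (toUₗ_surjective (R := R) (A := A) (L := L)) x
  rw [diff_toUₗ] at hx
  have hex := rTensor_exact (ExteriorAlgebra A L) exact_toUₗ
    (toUₗ_surjective (R := R) (A := A) (L := L))
  -- For a lift `x` over `HAlg` the boundary is no longer zero; it is `(η - 1)y`. Since `η - 1` is
  -- injective, `y` is a cycle, and `exact_diff` applies to it.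
  obtain ⟨y, hy⟩ := (hex _).1 hx
  have := flat_exteriorAlgebra (A := A) (V := L)
  have hinj := Module.Flat.rTensor_preserves_injective_linearMap (M := ExteriorAlgebra A L) _
    (ηSub_injective (R := R) (A := A) (L := L))
  have hdy : (param R A L).diff y = 0 := by
    apply hinj
    rw [← diff_ηSub, hy, ParamModule.diff_diff, map_zero]
  obtain ⟨u, z, rfl⟩ := exact_diff y hdy
  obtain ⟨f, v, rfl⟩ := exists_eq_ofSeq_add_mulL u
  -- The part `mulL v ⊗ 1` of `y` is itself the boundary of `v`, so only the contribution of `f`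
  -- obstructs a correction of `x` to a cycle by multiples of `η - 1`.
  have hmem : ηSub R A L (ofSeq f) ⊗ₜ 1 = (param R A L).diff (x - (ηSub R A L).rTensor _ z -
      (ηSub R A L).rTensor _ ((ExteriorAlgebra.ι A).lTensor _ v)) := by
    rw [map_sub, map_sub, ← hy, diff_ηSub, diff_ηSub, diff_lTensor_ι, LinearMap.rTensor_tmul,
      map_add, LinearMap.rTensor_tmul, map_add, TensorProduct.add_tmul]
    abel
  -- The orbit map sees `(η - 1)f` as the shift of `f` minus `f`, and on a boundary this component
  -- is zero.
  have hf : f = 0 := by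
    have h := orbit_coef₀_diff (R := R) (A := A) (L := L) (x - (ηSub R A L).rTensor _ z -
      (ηSub R A L).rTensor _ ((ExteriorAlgebra.ι A).lTensor _ v))
    rw [← hmem, coef₀_one, ηSub_apply, sub_mul, one_mul, ← ofSeq_shift, ← map_sub, orbit_ofSeq,
      sub_eq_zero] at h
    exact eq_zero_of_seqShift_eq h
  subst hf
  rw [map_zero, map_zero, TensorProduct.zero_tmul] at hmem
  -- The corrected lift is a cycle over `HAlg`; the corrections disappear again in `U(A, L)`.
  obtain ⟨u, z', h⟩ := exact_diff _ hmem.symm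
  have h2 : x = u ⊗ₜ 1 + (param R A L).diff z' +
      (ηSub R A L).rTensor _ (z + (ExteriorAlgebra.ι A).lTensor _ v) := by
    rw [← h, map_add]; abel
  obtain ⟨a, z'', h3⟩ := ofSeq_mulL_toU u
  refine ⟨a, z'' + (toUₗ R A L).rTensor _ z', ?_⟩
  rw [h2, map_add, (hex _).2 ⟨_, rfl⟩, add_zero, map_add, LinearMap.rTensor_tmul, h3, map_add,
    diff_toUₗ, add_assoc]

end Exactness

/-! ### The Rinehart complex as a projective resolution of `A`, and `Tor`. -/

section Resolution
variable {R A L : Type u} [CommRing R] [CommRing A] [Algebra R A] [LieRing L] [LieAlgebra R L]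
  [Module A L] [LieRingModule L A]

/-- Base change preserves projectivity: a section `s` of the free cover of `P` makes `U ⊗_A P` a
retract of a direct sum of copies of `U`. -/
theorem projective_URight_tensor [IsScalarTower R A L] {P : Type u} [AddCommGroup P] [Module A P]
    [Module.Projective A P] :
    Module.Projective (UAlg R A L) (URight R A L ⊗[A] P) := by
  obtain ⟨s, hs⟩ := Module.projective_def'.1 (inferInstance : Module.Projective A P)
  have hU : Module.Projective (UAlg R A L) (URight R A L) :=
    inferInstanceAs (Module.Projective (UAlg R A L) (UAlg R A L))
  classical
  have hF : Module.Projective (UAlg R A L) (P →₀ URight R A L) :=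
    Module.Projective.of_equiv (finsuppLequivDFinsupp (UAlg R A L)).symm
  -- The coordinate of `u ⊗ p` at `j` is `u · s(p)_j`. Elements of `A` multiply `u` from the right,
  -- so the map commutes with `U` acting from the left.
  let i₀ : URight R A L ⊗[A] P →ₗ[A] P →₀ URight R A L :=
    TensorProduct.lift
      { toFun := fun u => Finsupp.mapRange.linearMap (LinearMap.toSpanSingleton A _ u) ∘ₗ s
        map_add' := fun u v => by
          apply LinearMap.ext; intro p; ext j; simp
        map_smul' := fun a u => by
          apply LinearMap.ext; intro p; ext j; simp [smul_smul, mul_comm] }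
  let i : URight R A L ⊗[A] P →ₗ[UAlg R A L] P →₀ URight R A L :=
    { i₀ with
      map_smul' := fun u t => by
        change i₀ (u • t) = u • i₀ t
        induction t with
        | zero => simp
        | add s t hs ht => rw [smul_add, map_add, hs, ht, map_add, smul_add]
        | tmul v p =>
          ext j
          exact smul_comm (s p j) u v }
  let g : (P →₀ URight R A L) →ₗ[UAlg R A L] URight R A L ⊗[A] P :=
    Finsupp.lsum ℕ fun p =>
      { toFun := fun u => u ⊗ₜ p
        map_add' := fun u v => TensorProduct.add_tmul u v p
        map_smul' := fun u v => rfl }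
  refine Module.Projective.of_split i g ?_
  apply LinearMap.ext
  intro t
  change g (i₀ t) = t
  induction t with
  | zero => simp
  | add s t hs ht => rw [map_add, map_add, hs, ht]
  | tmul u p =>
    have h : ∀ x : P →₀ A, g (Finsupp.mapRange.linearMap (LinearMap.toSpanSingleton A _ u) x) =
        u ⊗ₜ Finsupp.linearCombination A (id : P → P) x := by
      intro x
      induction x using Finsupp.induction_linear with
      | zero => simp
      | add f g hf hg => rw [map_add, map_add, hf, hg, map_add, TensorProduct.tmul_add]
      | single q a =>
        simp only [Finsupp.mapRange.linearMap_apply, Finsupp.mapRange_single, g,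
          Finsupp.lsum_single, Finsupp.linearCombination_single]
        exact TensorProduct.smul_tmul a u q
    exact (h (s p)).trans (congrArg _ (LinearMap.congr_fun hs p))

variable [LieRinehartRing A L]

theorem projective_exteriorPower [Module.Projective A L] (n : ℕ) : Module.Projective A (⋀[A]^n L) := by
  have := projective_exteriorAlgebra (A := A) (V := L)
  exact Module.Projective.of_split (⋀[A]^n L).subtype (extPart A L n) (LinearMap.ext extPart_coe)

theorem extPart_of_ne {m n : ℕ} (h : m ≠ n) {w : ExteriorAlgebra A L} (hw : w ∈ ⋀[A]^m L) :
    extPart A L n w = 0 := by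
  simp only [extPart, LinearMap.comp_apply, LinearEquiv.coe_coe,
    DirectSum.decomposeLinearEquiv_apply]
  apply Subtype.ext
  exact DirectSum.decompose_of_mem_ne (fun i => ⋀[A]^i L) hw h

theorem tmul_ιMulti_induction {N : Type u} [AddCommGroup N] [Module A N]
    {p : N ⊗[A] ExteriorAlgebra A L → Prop} (h0 : p 0) (hadd : ∀ s t, p s → p t → p (s + t))
    (h : ∀ (n : N) k (v : Fin k → L), p (n ⊗ₜ ExteriorAlgebra.ιMulti A k v)) (t) : p t := by
  induction t with
  | zero => exact h0
  | add s t hs ht => exact hadd s t hs ht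
  | tmul n w =>
    induction w using ιMulti_induction generalizing n with
    | h0 => rw [TensorProduct.tmul_zero]; exact h0
    | hadd x y hx hy => rw [TensorProduct.tmul_add]; exact hadd _ _ (hx n) (hy n)
    | hsmul r x hx => rw [← TensorProduct.smul_tmul]; exact hx _
    | h k v => exact h n k v

theorem ιMulti_mem {k : ℕ} (v : Fin k → L) : ExteriorAlgebra.ιMulti A k v ∈ ⋀[A]^k L :=
  ExteriorAlgebra.ιMulti_range A k ⟨v, rfl⟩

theorem extPart_extDegree {N : Type u} [AddCommGroup N] [Module A N] {m n : ℕ} (h : m ≠ n)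
    {t : N ⊗[A] ExteriorAlgebra A L} (ht : t ∈ extDegree A L N m) :
    (extPart A L n).lTensor N t = 0 := by
  obtain ⟨t, rfl⟩ := ht
  rw [← LinearMap.lTensor_comp_apply]
  have : extPart A L n ∘ₗ (⋀[A]^m L).subtype = 0 :=
    LinearMap.ext fun w => extPart_of_ne h w.2
  rw [this, LinearMap.lTensor_zero]; rfl

variable [LieRinehartAlgebra R A L]

theorem lTensor_extPart_subtype {N : Type u} [AddCommGroup N] [Module A N] (n : ℕ)
    (t : N ⊗[A] ⋀[A]^n L) :
    (extPart A L n).lTensor N ((⋀[A]^n L).subtype.lTensor N t) = t := by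
  rw [← LinearMap.lTensor_comp_apply]
  have : extPart A L n ∘ₗ (⋀[A]^n L).subtype = LinearMap.id := LinearMap.ext extPart_coe
  rw [this, LinearMap.lTensor_id]; rfl

theorem rinehartDiff_one (u : URight R A L) :
    rinehartDiff R A L (u ⊗ₜ 1) = 0 := by
  rw [← HAlg.uParam_diff, ParamModule.diff_one]

/-- The differential lowers the exterior degree by exactly one, so exactness on the total exterior
algebra can be read off degree by degree. -/
theorem extPart_rinehartDiff (n : ℕ) (z : URight R A L ⊗[A] ExteriorAlgebra A L) :
    (extPart A L n).lTensor _ (rinehartDiff R A L z) =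
      rinehartD R A L n ((extPart A L (n + 1)).lTensor _ z) := by
  induction z using tmul_ιMulti_induction with
  | h0 => simp only [map_zero]
  | hadd s t hs ht => simp only [map_add, hs, ht]
  | h u k v =>
    have hv := ιMulti_mem (A := A) v
    by_cases hk : k = n + 1
    · subst hk
      rw [rinehartD, LinearMap.comp_apply, LinearMap.comp_apply, URight.lTensor_apply,
        URight.lTensor_apply, LinearMap.lTensor_tmul _ (extPart A L (n + 1)), LinearMap.lTensor_tmul,
        extPart_coe ⟨_, hv⟩]
      rfl
    · rw [LinearMap.lTensor_tmul _ (extPart A L (n + 1)), extPart_of_ne hk hv,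
        TensorProduct.tmul_zero, map_zero]
      cases k with
      | zero => rw [ExteriorAlgebra.ιMulti_zero_apply, rinehartDiff_one, map_zero]
      | succ k =>
        refine extPart_extDegree (m := k) (by omega) ?_
        rw [rinehartDiff_apply]
        exact connDiff_mem _ _ _ (tmul_mem_extDegree _ hv)

variable (R A L) in
/-- The augmentation `u ⊗ w ↦ u w₀`, with `w₀ ∈ A` the component of degree zero of `w`. -/
def rinehartAug : URight R A L ⊗[A] ExteriorAlgebra A L →ₗ[UAlg R A L] UTriv R A L :=
  LinearMap.toSpanSingleton (UAlg R A L) (UTriv R A L) (show A from 1) ∘ₗ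
  ({ (TensorProduct.rid A (URight R A L)).toLinearMap with
      map_smul' := fun u t => by
        change TensorProduct.rid A (URight R A L) (u • t) = u • TensorProduct.rid A (URight R A L) t
        induction t with
        | zero => simp
        | add s t hs ht => rw [smul_add, map_add, hs, ht, map_add, smul_add]
        | tmul v a => exact smul_comm a u v } :
    URight R A L ⊗[A] A →ₗ[UAlg R A L] URight R A L) ∘ₗ
  URight.lTensor (ExteriorAlgebra.algebraMapInv (M := L)).toLinearMap

theorem UTriv.rep_ιA (a b : A) : UTriv.rep R A L (UAlg.ιA R A L a) b = a * b := by
  rw [UTriv.rep, UAlg.lift_ιA]; rfl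

theorem UTriv.rep_ιL (α : L) (b : A) : UTriv.rep R A L (UAlg.ιL R A L α) b = ⁅α, b⁆ := by
  rw [UTriv.rep, UAlg.lift_ιL]; rfl

theorem rinehartAug_tmul (u : UAlg R A L) (w : ExteriorAlgebra A L) :
    rinehartAug R A L (URight.of R A L u ⊗ₜ w) =
      (UTriv.rep R A L u (ExteriorAlgebra.algebraMapInv w) : A) := by
  change UTriv.rep R A L (u * UAlg.ιA R A L (ExteriorAlgebra.algebraMapInv w)) 1 = _
  rw [map_mul, Module.End.mul_apply, UTriv.rep_ιA, mul_one]

theorem algebraMapInv_of_mem {n : ℕ} {w : ExteriorAlgebra A L} (hw : w ∈ ⋀[A]^(n + 1) L) :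
    ExteriorAlgebra.algebraMapInv w = 0 := by
  rw [← ExteriorAlgebra.ιMulti_span_fixedDegree] at hw
  induction hw using Submodule.span_induction with
  | mem x hx =>
    obtain ⟨v, rfl⟩ := hx
    rw [ExteriorAlgebra.ιMulti_succ_apply, map_mul]
    simp [ExteriorAlgebra.algebraMapInv]
  | zero => exact map_zero _
  | add x y _ _ hx hy => rw [map_add, hx, hy, add_zero]
  | smul a x _ hx => rw [map_smul, hx, smul_zero]

theorem exists_eq_smul_one {w : ExteriorAlgebra A L} (hw : w ∈ ⋀[A]^0 L) : ∃ c : A, w = c • 1 := by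
  rw [ExteriorAlgebra.exteriorPower, pow_zero] at hw
  obtain ⟨c, rfl⟩ := Submodule.mem_one.1 hw
  exact ⟨c, Algebra.algebraMap_eq_smul_one c⟩

theorem rinehartAug_extDegree {n : ℕ} {t : URight R A L ⊗[A] ExteriorAlgebra A L}
    (ht : t ∈ extDegree A L (URight R A L) (n + 1)) : rinehartAug R A L t = 0 := by
  obtain ⟨t, rfl⟩ := ht
  induction t with
  | zero => rw [map_zero, map_zero]
  | add s t hs ht => rw [map_add, map_add, hs, ht, add_zero]
  | tmul u w =>
    have h := algebraMapInv_of_mem w.2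
    refine (rinehartAug_tmul (show UAlg R A L from u) (w : ExteriorAlgebra A L)).trans ?_
    rw [h, map_zero]; rfl

/-- Only exterior degree one contributes, and there `uα` acts on `1 ∈ A` as `u(α(1)) = 0`. -/
theorem rinehartAug_diff (t : URight R A L ⊗[A] ExteriorAlgebra A L) :
    rinehartAug R A L (rinehartDiff R A L t) = 0 := by
  induction t using tmul_ιMulti_induction with
  | h0 => simp only [map_zero]
  | hadd s t hs ht => rw [map_add, map_add, hs, ht, add_zero]
  | h u k v =>
    match k with
    | 0 => rw [ExteriorAlgebra.ιMulti_zero_apply, rinehartDiff_one, map_zero]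
    | 1 =>
      have h1 : ⁅v 0, (1 : A)⁆ = 0 := by
        have := LieRinehartRing.leibniz_mul_right' (v 0) (1 : A) 1
        simpa using this
      rw [ExteriorAlgebra.ιMulti_succ_apply, ExteriorAlgebra.ιMulti_zero_apply, mul_one,
        ← HAlg.uParam_diff, ParamModule.diff_ι]
      refine (rinehartAug_tmul ((show UAlg R A L from u) * UAlg.ιL R A L (v 0)) 1).trans ?_
      rw [map_one, map_mul, Module.End.mul_apply, UTriv.rep_ιL, h1, map_zero]; rfl
    | k + 2 =>
      refine rinehartAug_extDegree (n := k) ?_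
      rw [rinehartDiff_apply]
      exact connDiff_mem _ _ _ (tmul_mem_extDegree _ (ιMulti_mem v))

variable (R A L) in
/-- The augmentation of the Rinehart complex. -/
def rinehartAug₀ : URight R A L ⊗[A] ⋀[A]^0 L →ₗ[UAlg R A L] UTriv R A L :=
  rinehartAug R A L ∘ₗ URight.lTensor (⋀[A]^0 L).subtype

theorem rinehartAug₀_rinehartD (t : URight R A L ⊗[A] ⋀[A]^(0 + 1) L) :
    rinehartAug₀ R A L (rinehartD R A L 0 t) = 0 := by
  rw [rinehartAug₀, LinearMap.comp_apply, incl_rinehartD, rinehartAug_diff]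

theorem rinehartAug₀_surjective : Function.Surjective (rinehartAug₀ R A L) := by
  intro a
  refine ⟨URight.of R A L (UAlg.ιA R A L (show A from a)) ⊗ₜ ⟨1, one_mem_ext⟩, ?_⟩
  refine (rinehartAug_tmul (UAlg.ιA R A L (show A from a)) 1).trans ?_
  rw [map_one, UTriv.rep_ιA, mul_one]

/-- The exceptional term `a ⊗ 1` of `rinehartDiff_exact` sits in exterior degree zero and is lost
under projection to degree `n + 1`. -/
theorem rinehartD_exact [Module.Projective A L] (n : ℕ) (t : URight R A L ⊗[A] ⋀[A]^(n + 1) L)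
    (ht : rinehartD R A L n t = 0) : ∃ s, rinehartD R A L (n + 1) s = t := by
  obtain ⟨a, z, h⟩ := rinehartDiff_exact (URight.lTensor (⋀[A]^(n + 1) L).subtype t)
    (by rw [← incl_rinehartD, ht, map_zero])
  have h2 := congrArg ((extPart A L (n + 1)).lTensor _) h
  rw [URight.lTensor_apply, lTensor_extPart_subtype, map_add, extPart_rinehartDiff,
    LinearMap.lTensor_tmul, extPart_of_ne (m := 0) (by omega) one_mem_ext, TensorProduct.tmul_zero,
    zero_add] at h2
  exact ⟨_, h2.symm⟩

/-- In exterior degree zero everything is a cycle. The augmentation kills boundaries and returns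
`a`, so the exceptional term `a ⊗ 1` is zero. -/
theorem rinehartAug₀_exact [Module.Projective A L] (t : URight R A L ⊗[A] ⋀[A]^0 L)
    (ht : rinehartAug₀ R A L t = 0) : ∃ s, rinehartD R A L 0 s = t := by
  have h0 : rinehartDiff R A L (URight.lTensor (⋀[A]^0 L).subtype t) = 0 := by
    clear ht
    induction t with
    | zero => rw [map_zero, map_zero]
    | add s t hs ht => rw [map_add, map_add, hs, ht, add_zero]
    | tmul u w =>
      obtain ⟨c, hc⟩ := exists_eq_smul_one w.2
      rw [URight.lTensor_apply, LinearMap.lTensor_tmul, Submodule.subtype_apply, hc,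
        ← TensorProduct.smul_tmul, rinehartDiff_one]
  obtain ⟨a, z, h⟩ := rinehartDiff_exact _ h0
  have ha := congrArg (rinehartAug R A L) h
  rw [map_add, rinehartAug_diff, add_zero, rinehartAug_tmul, map_one, UTriv.rep_ιA, mul_one] at ha
  have ha0 : a = 0 := ha.symm.trans ht
  have h2 := congrArg ((extPart A L 0).lTensor _) h
  rw [ha0, URight.lTensor_apply, lTensor_extPart_subtype, map_zero, map_zero, TensorProduct.zero_tmul,
    zero_add, extPart_rinehartDiff] at h2
  exact ⟨_, h2.symm⟩

theorem rinehartComplex_d (n : ℕ) :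
    (rinehartComplex R A L).d (n + 1) n = ModuleCat.ofHom (rinehartD R A L n) :=
  ChainComplex.of_d (fun n => ModuleCat.of (UAlg R A L) (URight R A L ⊗[A] ⋀[A]^n L))
    (fun n => ModuleCat.ofHom (rinehartD R A L n)) n

variable (R A L) in
/-- The projective resolution of `A` given by the Rinehart complex, for projective `L`. -/
def rinehartResolution [Module.Projective A L] :
    ProjectiveResolution (ModuleCat.of (UAlg R A L) (UTriv R A L)) where
  complex := rinehartComplex R A L
  projective n := by
    have := projective_exteriorPower (A := A) (L := L) n
    exact (IsProjective.iff_projective _).1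
      (projective_URight_tensor (R := R) (A := A) (L := L) (P := ⋀[A]^n L))
  π := (ChainComplex.toSingle₀Equiv _ _).symm ⟨ModuleCat.ofHom (rinehartAug₀ R A L), by
    rw [rinehartComplex_d]
    apply ModuleCat.hom_ext
    exact LinearMap.ext rinehartAug₀_rinehartD⟩
  quasiIso := ⟨fun n => by
    cases n with
    | zero =>
      -- In degree zero the claim amounts to exactness of `K₁ → K₀ → A` together with surjectivity
      -- of the augmentation.
      rw [ChainComplex.quasiIsoAt₀_iff, ShortComplex.quasiIso_iff_of_zeros' _ rfl rfl rfl]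
      constructor
      · rw [ShortComplex.moduleCat_exact_iff]
        intro t ht
        obtain ⟨s, hs⟩ := rinehartAug₀_exact (R := R) (A := A) (L := L) t (by
          simpa [ChainComplex.toSingle₀Equiv] using! ht)
        refine ⟨s, ?_⟩
        change ((rinehartComplex R A L).d 1 0).hom s = t
        rw [rinehartComplex_d]
        exact hs
      · rw [ModuleCat.epi_iff_surjective]
        intro a
        obtain ⟨t, ht⟩ := rinehartAug₀_surjective (R := R) (A := A) (L := L) a
        refine ⟨t, ?_⟩
        simpa [ChainComplex.toSingle₀Equiv] using! ht
    | succ n =>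
      rw [quasiIsoAt_iff_exactAt' (hL := ChainComplex.exactAt_succ_single_obj ..),
        HomologicalComplex.exactAt_iff' _ (n + 2) (n + 1) n (by simp) (by simp),
        ShortComplex.moduleCat_exact_iff]
      intro t ht
      change ((rinehartComplex R A L).d (n + 1) n).hom t = 0 at ht
      rw [rinehartComplex_d] at ht
      obtain ⟨s, hs⟩ := rinehartD_exact n t ht
      refine ⟨s, ?_⟩
      change ((rinehartComplex R A L).d (n + 1 + 1) (n + 1)).hom s = t
      rw [rinehartComplex_d]
      exact hs⟩

section Tor
variable {U N : Type u} [Ring U] [Algebra R U] [AddCommGroup N] [Module R N] [Module Uᵐᵒᵖ N]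
  [IsScalarTower R Uᵐᵒᵖ N]

theorem nTensorComplex_d (ε : N →ₗ[Uᵐᵒᵖ] N) (K : ChainComplex (ModuleCat.{u} U) ℕ) (n : ℕ) :
    (nTensorComplex (R := R) ε K).d (n + 1) n =
      ModuleCat.ofHom (nTensorMap R ε (K.d (n + 1) n).hom) :=
  ChainComplex.of_d (fun n => ModuleCat.of R (NTensor R U N (K.X n)))
    (fun n => ModuleCat.ofHom (nTensorMap R ε (K.d (n + 1) n).hom)) n

theorem nTensorMap_ext {V : Type u} [AddCommGroup V] [Module R V] {M : Type u} [AddCommGroup M]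
    [Module U M] {f g : NTensor R U N M →ₗ[R] V}
    (h : ∀ n m, f (ntmul R U n m) = g (ntmul R U n m)) : f = g := by
  apply LinearMap.ext
  intro t
  induction t using ntensor_induction with
  | h0 => rw [map_zero, map_zero]
  | hadd s t hs ht => rw [map_add, hs, ht, map_add]
  | h n m => exact h n m

theorem involution_pow {ε : N →ₗ[Uᵐᵒᵖ] N} (hε : ∀ x, ε (ε x) = x) (n : ℕ) (x : N) :
    (ε ^ n) ((ε ^ n) x) = x := by
  induction n generalizing x with
  | zero => rfl
  | succ n ih =>
    have h : (ε ^ (n + 1)) ((ε ^ (n + 1)) x) = (ε ^ n) (ε (ε ((ε ^ n) x))) := by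
      rw [← Module.End.mul_apply ε (ε ^ n), ← pow_succ', pow_succ]; rfl
    rw [h, hε, ih]

/-- For an involutive sign operator, the signs of the differential of the tensor product can be
absorbed in an isomorphism. -/
def nTensorComplexIso {ε : N →ₗ[Uᵐᵒᵖ] N} (hε : ∀ x, ε (ε x) = x)
    (K : ChainComplex (ModuleCat.{u} U) ℕ) :
    nTensorComplex (R := R) ε K ≅ ((nTensorFunctor R U N).mapHomologicalComplex _).obj K :=
  HomologicalComplex.Hom.isoOfComponents
    (fun n =>
      -- The exponent `n` is forced by `ε ^ n (ε ⊗ d) = (1 ⊗ d) ε ^ (n + 1)`; being an involution,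
      -- `ε ^ n` is its own inverse.
      { hom := ModuleCat.ofHom (nTensorMap R (ε ^ n) LinearMap.id)
        inv := ModuleCat.ofHom (nTensorMap R (ε ^ n) LinearMap.id)
        hom_inv_id := by
          apply ModuleCat.hom_ext
          exact nTensorMap_ext fun x k => congrArg (ntmul R U · k) (involution_pow hε n x)
        inv_hom_id := by
          apply ModuleCat.hom_ext
          exact nTensorMap_ext fun x k => congrArg (ntmul R U · k) (involution_pow hε n x) })
    (by
      rintro i n rfl
      rw [nTensorComplex_d]
      apply ModuleCat.hom_ext
      refine nTensorMap_ext fun x k => ?_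
      change ntmul R U ((ε ^ (n + 1)) x) _ = ntmul R U ((ε ^ n) (ε x)) _
      rw [pow_succ]; rfl)

end Tor

/-- The homology of the tensor product with the Rinehart complex is `Tor`, for projective `L`. -/
def homologyIsoTor [Module.Projective A L] {N : Type u} [AddCommGroup N] [Module R N]
    [Module (UAlg R A L)ᵐᵒᵖ N] [IsScalarTower R (UAlg R A L)ᵐᵒᵖ N]
    {ε : N →ₗ[(UAlg R A L)ᵐᵒᵖ] N} (hε : ∀ x, ε (ε x) = x) (n : ℕ) :
    (nTensorComplex (R := R) ε (rinehartComplex R A L)).homology n ≅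
      torModule R (UAlg R A L) N n (ModuleCat.of (UAlg R A L) (UTriv R A L)) :=
  (HomologicalComplex.homologyFunctor _ _ n).mapIso (nTensorComplexIso hε _) ≪≫
    ((rinehartResolution R A L).isoLeftDerivedObj (nTensorFunctor R (UAlg R A L) N) n).symm

end Resolution

/-! ### Tensor products over `U(A, L)` with the Rinehart complex. -/

section TensorIso
variable {R A L N : Type u} [CommRing R] [CommRing A] [Algebra R A] [LieRing L] [LieAlgebra R L]
  [Module A L] [LieRingModule L A] [LieRinehartRing A L] [LieRinehartAlgebra R A L]
  [AddCommGroup N] [Module R N] [Module A N] [IsScalarTower R A N]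

namespace RightALModule
variable (S : RightALModule R A L N)

/-- The map `u ↦ n u` from `U(A, L)` to a right module. -/
def evalAt (n : N) : URight R A L →ₗ[A] N where
  toFun u := (S.rep (show UAlg R A L from u)).unop n
  map_add' u v := by
    change (S.rep ((show UAlg R A L from u) + (show UAlg R A L from v))).unop n = _
    rw [map_add]; rfl
  map_smul' a u := by
    change (S.rep ((show UAlg R A L from u) * UAlg.ιA R A L a)).unop n = _
    rw [map_mul, MulOpposite.unop_mul, Module.End.mul_apply]
    exact S.op_ιA_smul a _

theorem evalAt_act (n : N) (α : L) (u : URight R A L) :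
    S.evalAt n (URight.act R A L α u) = S.act α (S.evalAt n u) := by
  change (S.rep ((show UAlg R A L from u) * UAlg.ιL R A L α)).unop n = _
  rw [map_mul, MulOpposite.unop_mul, Module.End.mul_apply]
  exact S.op_ιL_smul α _

theorem evalAt_one (n : N) : S.evalAt n (URight.of R A L 1) = n := by
  change (S.rep 1).unop n = n
  rw [map_one]; rfl

theorem op_smul_eq_evalAt (u : UAlg R A L) (n : N) :
    MulOpposite.op u • S.of n = S.of (S.evalAt n (URight.of R A L u)) := rfl

theorem evalAt_add (n n' : N) : S.evalAt (n + n') = S.evalAt n + S.evalAt n' :=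
  LinearMap.ext fun u => map_add (S.rep (show UAlg R A L from u)).unop n n'

theorem evalAt_smul (r : R) (n : N) (u : URight R A L) : S.evalAt (r • n) u = r • S.evalAt n u :=
  map_smul (S.rep (show UAlg R A L from u)).unop r n

theorem evalAt_evalAt (n : N) (u : UAlg R A L) (v : URight R A L) :
    S.evalAt (S.evalAt n (URight.of R A L u)) v = S.evalAt n (u • v) := by
  change _ = (S.rep (u * (show UAlg R A L from v))).unop n
  rw [map_mul]; rfl

theorem act_smul' (α : L) (c : A) (n : N) : S.act (c • α) n = S.act α (c • n) :=
  (S.smul_act α c n).trans (S.act_smul α c n).symm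

/-- The Chevalley--Eilenberg operator of a right `(A, L)`-module. -/
def ceOperator : N ⊗[A] ExteriorAlgebra A L →ₗ[R] N ⊗[A] ExteriorAlgebra A L :=
  connDiff S.act S.act_smul S.act_smul'

/-- The map `u ↦ n u` is a homomorphism of right `(A, L)`-modules, and the Chevalley–Eilenberg
operator is natural. The Rinehart differential is thus the universal case, from which that of `N` is
obtained by evaluation. -/
theorem ceOperator_evalAt (n : N) (t : URight R A L ⊗[A] ExteriorAlgebra A L) :
    S.ceOperator ((S.evalAt n).rTensor _ t) = (S.evalAt n).rTensor _ (rinehartDiff R A L t) :=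
  connDiff_rTensor _ URight.act_smul URight.smul_act _ _ _ (S.evalAt n) (fun α u => S.evalAt_act n α u) t

variable (P : Type u) [AddCommGroup P] [Module A P]

variable {P} in
theorem rTensor_evalAt_add (n n' : N) (t : URight R A L ⊗[A] P) :
    (S.evalAt (n + n')).rTensor P t = (S.evalAt n).rTensor P t + (S.evalAt n').rTensor P t := by
  rw [evalAt_add, LinearMap.rTensor_add]; rfl

variable {P} in
theorem rTensor_evalAt_smul (r : R) (n : N) (t : URight R A L ⊗[A] P) :
    (S.evalAt (r • n)).rTensor P t = r • (S.evalAt n).rTensor P t := by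
  induction t with
  | zero => simp
  | add x y hx hy => rw [map_add, hx, hy, map_add, smul_add]
  | tmul u p => rw [LinearMap.rTensor_tmul, LinearMap.rTensor_tmul, evalAt_smul]; rfl

variable {P} in
theorem rTensor_evalAt_evalAt (n : N) (u : UAlg R A L) (t : URight R A L ⊗[A] P) :
    (S.evalAt (S.evalAt n (URight.of R A L u))).rTensor P t = (S.evalAt n).rTensor P (u • t) := by
  induction t with
  | zero => simp
  | add x y hx hy => rw [map_add, hx, hy, smul_add, map_add]
  | tmul v p => rw [LinearMap.rTensor_tmul, evalAt_evalAt]; rfl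

variable {P} in
theorem smul_one_tmul (u : UAlg R A L) (p : P) :
    u • (URight.of R A L 1 ⊗ₜ[A] p) = URight.of R A L u ⊗ₜ[A] p := by
  rw [TensorProduct.smul_tmul', ← map_smul, smul_eq_mul, mul_one]

variable {P} in
theorem ntmul_evalAt (n : N) (u : UAlg R A L) (p : P) :
    ntmul R (UAlg R A L) (S.of (S.evalAt n (URight.of R A L u))) (URight.of R A L 1 ⊗ₜ[A] p) =
      ntmul R (UAlg R A L) (S.of n) (URight.of R A L u ⊗ₜ[A] p) := by
  rw [← op_smul_eq_evalAt, ntmul_smul, smul_one_tmul]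

/-- The map `N ⊗_A P → N ⊗_U (U ⊗_A P)`. -/
def toNTensor : N ⊗[A] P →ₗ[R] NTensor R (UAlg R A L) S.Carrier (URight R A L ⊗[A] P) :=
  let F : N ⊗[A] P →+ NTensor R (UAlg R A L) S.Carrier (URight R A L ⊗[A] P) :=
    TensorProduct.liftAddHom
      (AddMonoidHom.mk' (fun n => AddMonoidHom.mk'
          (fun p => ntmul R (UAlg R A L) (S.of n) (URight.of R A L 1 ⊗ₜ[A] p))
          (fun p p' => by rw [TensorProduct.tmul_add, ntmul_add]))
        (fun n n' => by
          ext p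
          change ntmul R (UAlg R A L) (S.of (n + n')) (URight.of R A L 1 ⊗ₜ[A] p) = _ + _
          rw [map_add, ntmul, TensorProduct.add_tmul, map_add]; rfl))
      (fun c n p => by
        change ntmul R (UAlg R A L) (S.of (c • n)) (URight.of R A L 1 ⊗ₜ[A] p) =
          ntmul R (UAlg R A L) (S.of n) (URight.of R A L 1 ⊗ₜ[A] (c • p))
        rw [← S.op_ιA_smul, ntmul_smul, ← TensorProduct.smul_tmul, smul_one_tmul, URight.smul_def,
          URight.mulRight_apply, one_mul])
  { F with
    map_smul' := by
      intro r t
      change F (r • t) = r • F t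
      induction t with
      | zero => simp
      | add x y hx hy => rw [smul_add, map_add, hx, hy, map_add, smul_add]
      | tmul n p => rfl }

theorem toNTensor_tmul (n : N) (p : P) :
    S.toNTensor P (n ⊗ₜ p) = ntmul R (UAlg R A L) (S.of n) (URight.of R A L 1 ⊗ₜ[A] p) := rfl

/-- The map `N ⊗_U (U ⊗_A P) → N ⊗_A P`. -/
def ofNTensor : NTensor R (UAlg R A L) S.Carrier (URight R A L ⊗[A] P) →ₗ[R] N ⊗[A] P :=
  let G : S.Carrier ⊗[ℤ] (URight R A L ⊗[A] P) →ₗ[ℤ] N ⊗[A] P :=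
    TensorProduct.lift (AddMonoidHom.toIntLinearMap (AddMonoidHom.mk'
      (fun n => AddMonoidHom.toIntLinearMap ((S.evalAt n).rTensor P).toAddMonoidHom)
      (fun n n' => by
        exact LinearMap.ext fun t => S.rTensor_evalAt_add n n' t)))
  let G' : S.Carrier ⊗[ℤ] (URight R A L ⊗[A] P) →ₗ[R] N ⊗[A] P :=
    { G with
      map_smul' := by
        intro r t
        change G (r • t) = r • G t
        induction t with
        | zero => simp
        | add x y hx hy => rw [smul_add, map_add, hx, hy, map_add, smul_add]
        | tmul n t => exact S.rTensor_evalAt_smul r n t }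
  Submodule.liftQ _ G' (by
    rw [nTensorRel, Submodule.span_le]
    rintro _ ⟨⟨n, u, m⟩, rfl⟩
    refine LinearMap.mem_ker.2 ((map_sub G' _ _).trans (sub_eq_zero.2 ?_))
    exact S.rTensor_evalAt_evalAt n u m)

theorem ofNTensor_ntmul (n : N) (t : URight R A L ⊗[A] P) :
    S.ofNTensor P (ntmul R (UAlg R A L) (S.of n) t) = (S.evalAt n).rTensor P t := rfl

/-- The isomorphism `N ⊗_A P ≅ N ⊗_U (U ⊗_A P)`. -/
def nTensorEquiv : N ⊗[A] P ≃ₗ[R] NTensor R (UAlg R A L) S.Carrier (URight R A L ⊗[A] P) :=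
  LinearEquiv.ofLinearMap (S.toNTensor P) (S.ofNTensor P)
    (by
      refine nTensorMap_ext fun n t => ?_
      change S.toNTensor P ((S.evalAt n).rTensor P t) = ntmul R (UAlg R A L) n t
      induction t with
      | zero => rw [map_zero, map_zero, ntmul_zero]
      | add s t hs ht => rw [map_add, map_add, hs, ht, ntmul_add]
      | tmul u p =>
        exact S.ntmul_evalAt n u p)
    (by
      apply LinearMap.ext; intro t
      change S.ofNTensor P (S.toNTensor P t) = t
      induction t with
      | zero => simp
      | add s t hs ht => rw [map_add, map_add, hs, ht]
      | tmul n p =>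
        rw [toNTensor_tmul, ofNTensor_ntmul, LinearMap.rTensor_tmul, evalAt_one])

theorem nTensorEquiv_symm_ntmul (n : N) (t : URight R A L ⊗[A] P) :
    (S.nTensorEquiv P).symm (ntmul R (UAlg R A L) (S.of n) t) = (S.evalAt n).rTensor P t := rfl

end RightALModule

/-- `⋀^n L` is a direct summand of `⋀ L`, so no flatness of `N` is needed. -/
theorem lTensor_subtype_injective (n : ℕ) :
    Function.Injective ((⋀[A]^n L).subtype.lTensor N) :=
  Function.LeftInverse.injective (g := (extPart A L n).lTensor N) (lTensor_extPart_subtype n)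

/-! ### A common form of the comparison for the total complex and for each degree `p`. -/

section Complex
variable (S : RightALModule R A L N) {W : Type u} [AddCommGroup W] [Module R W] [Module A W]
  [IsScalarTower R A W] (J : N ⊗[A] ExteriorAlgebra A L →ₗ[A] W) (hJ : Function.Injective J)
  (E : ℕ → Submodule A W)
  (hE : ∀ n, LinearMap.range (J ∘ₗ (⋀[A]^n L).subtype.lTensor N) = E n)

theorem lTensor_comp_injective {J : N ⊗[A] ExteriorAlgebra A L →ₗ[A] W}
    (hJ : Function.Injective J) (n : ℕ) :
    Function.Injective (J ∘ₗ (⋀[A]^n L).subtype.lTensor N) :=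
  hJ.comp (lTensor_subtype_injective n)

/-- On `b ⊗ w` the left side evaluates the Rinehart differential of `1 ⊗ w` at `ε' b`. By
`ceOperator_evalAt` this is the operator of `N` applied to `ε' b ⊗ w`. -/
theorem lTensor_nTensorEquiv_symm {ε : S.Carrier →ₗ[(UAlg R A L)ᵐᵒᵖ] S.Carrier} (ε' : N →ₗ[A] N)
    (hε : ∀ x, ε (S.of x) = S.of (ε' x)) (n : ℕ) (t : N ⊗[A] ⋀[A]^(n + 1) L) :
    (⋀[A]^n L).subtype.lTensor N ((S.nTensorEquiv (⋀[A]^n L)).symm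
        (nTensorMap R ε (rinehartD R A L n) (S.nTensorEquiv (⋀[A]^(n + 1) L) t))) =
      S.ceOperator (ε'.rTensor _ ((⋀[A]^(n + 1) L).subtype.lTensor N t)) := by
  induction t with
  | zero => simp only [map_zero]
  | add s t hs ht => simp only [map_add, hs, ht]
  | tmul b w =>
    have h : nTensorMap R ε (rinehartD R A L n) (S.nTensorEquiv (⋀[A]^(n + 1) L) (b ⊗ₜ w)) =
        ntmul R (UAlg R A L) (S.of (ε' b)) (rinehartD R A L n (URight.of R A L 1 ⊗ₜ w)) :=
      congrArg (ntmul R (UAlg R A L) · _) (hε b)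
    have h2 : ∀ s : URight R A L ⊗[A] ⋀[A]^n L,
        (⋀[A]^n L).subtype.lTensor N ((S.evalAt (ε' b)).rTensor _ s) =
          (S.evalAt (ε' b)).rTensor _ (URight.lTensor (⋀[A]^n L).subtype s) := by
      intro s
      rw [URight.lTensor_apply, ← LinearMap.comp_apply, ← LinearMap.comp_apply,
        LinearMap.lTensor_comp_rTensor, LinearMap.rTensor_comp_lTensor]
    rw [h, S.nTensorEquiv_symm_ntmul, h2, incl_rinehartD, ← S.ceOperator_evalAt,
      URight.lTensor_apply, LinearMap.lTensor_tmul, LinearMap.rTensor_tmul, S.evalAt_one]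
    rfl

/-- `N ⊗_A ⋀^n L` as a submodule. -/
def degreeEquiv (n : ℕ) : N ⊗[A] ⋀[A]^n L ≃ₗ[A] E n :=
  (LinearEquiv.ofInjective _ (lTensor_comp_injective hJ n)).trans (LinearEquiv.ofEq _ _ (hE n))

theorem degreeEquiv_apply (n : ℕ) (t : N ⊗[A] ⋀[A]^n L) :
    (degreeEquiv J hJ E hE n t : W) = J ((⋀[A]^n L).subtype.lTensor N t) := rfl

/-- The isomorphism from a complex with underlying modules `N ⊗_A ⋀^n L` and the differential of
`N` to the tensor product of `N` with the Rinehart complex. -/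
def complexIso {D : W →ₗ[R] W} (hD : ∀ n, ∀ x ∈ E (n + 1), D x ∈ E n) (hDD)
    {ε : S.Carrier →ₗ[(UAlg R A L)ᵐᵒᵖ] S.Carrier} (ε' : N →ₗ[A] N) (hε : ∀ x, ε (S.of x) = S.of (ε' x))
    (hJD : ∀ t, D (J t) = J (S.ceOperator (ε'.rTensor _ t))) :
    ChainComplex.of (fun n => ModuleCat.of R (E n))
      (fun n => ModuleCat.ofHom (D.restrict (p := (E (n + 1)).restrictScalars R)
        (q := (E n).restrictScalars R) (hD n))) hDD ≅
      nTensorComplex ε (rinehartComplex R A L) :=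
  HomologicalComplex.Hom.isoOfComponents
    (fun n => LinearEquiv.toModuleIso
      (((degreeEquiv J hJ E hE n).restrictScalars R).symm.trans (S.nTensorEquiv (⋀[A]^n L))))
    (by
      rintro i n rfl
      have h1 := nTensorComplex_d (R := R) ε (rinehartComplex R A L) n
      rw [rinehartComplex_d] at h1
      have h2 := ChainComplex.of_d (fun n => ModuleCat.of R (E n))
        (fun n => ModuleCat.ofHom (D.restrict (p := (E (n + 1)).restrictScalars R)
          (q := (E n).restrictScalars R) (hD n))) n
      rw [h1]
      refine Eq.trans ?_ (congrArg (· ≫ _) h2.symm)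
      apply ModuleCat.hom_ext
      apply LinearMap.ext
      intro x
      change nTensorMap R ε (rinehartD R A L n) (S.nTensorEquiv (⋀[A]^(n + 1) L)
          ((degreeEquiv J hJ E hE (n + 1)).symm x)) =
        S.nTensorEquiv (⋀[A]^n L) ((degreeEquiv J hJ E hE n).symm ⟨D x, hD n x x.2⟩)
      obtain ⟨t, rfl⟩ := (degreeEquiv J hJ E hE (n + 1)).surjective x
      -- The square is carried back to the submodules of `W`, where the differential is the
      -- restriction of `D` and the comparison is an identity between elements of `W`.
      rw [LinearEquiv.symm_apply_apply, ← LinearEquiv.symm_apply_eq, LinearEquiv.eq_symm_apply]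
      apply Subtype.ext
      rw [degreeEquiv_apply, lTensor_nTensorEquiv_symm S ε' hε, ← hJD]
      rfl)

theorem complexIso_apply {D : W →ₗ[R] W} (hD : ∀ n, ∀ x ∈ E (n + 1), D x ∈ E n) (hDD)
    {ε : S.Carrier →ₗ[(UAlg R A L)ᵐᵒᵖ] S.Carrier} (ε' : N →ₗ[A] N) (hε : ∀ x, ε (S.of x) = S.of (ε' x))
    (hJD : ∀ t, D (J t) = J (S.ceOperator (ε'.rTensor _ t))) (n : ℕ) (b : N) (w : ⋀[A]^n L)
    (x : E n) (hx : (x : W) = J (b ⊗ₜ (w : ExteriorAlgebra A L))) :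
    ((complexIso S J hJ E hE hD hDD ε' hε hJD).hom.f n).hom x =
      nTensorTmul ε (rinehartComplex R A L) (S.of b) (rinehartTmul 1 w) := by
  have h : x = degreeEquiv J hJ E hE n (b ⊗ₜ w) := Subtype.ext hx
  change S.nTensorEquiv (⋀[A]^n L) ((degreeEquiv J hJ E hE n).symm x) = _
  rw [h, LinearEquiv.symm_apply_apply]
  rfl

end Complex
end TensorIso

/-! ### An exact generator is the signed Chevalley–Eilenberg operator. -/

section Generator
variable {R A L B : Type u} [CommRing R] [CommRing A] [Algebra R A] [LieRing L] [LieAlgebra R L]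
  [Module A L] [LieRingModule L A] [LieRinehartRing A L] [LieRinehartAlgebra R A L]
  [Ring B] [Algebra A B] [Algebra R B] [IsScalarTower R A B] [LieRingModule L B] [LieModule R L B]
  [LAlgebra A L B] {𝒢 : ℤ → Submodule A B} [GradedAlgebra 𝒢]
  {D : B ⊗[A] ExteriorAlgebra A L →ₗ[R] B ⊗[A] ExteriorAlgebra A L}

/-- When the second argument has degree zero in `B`, the sign rules of product and bracket become
trivial. The generating identity is therefore used below only with second argument `1 ⊗ x`. -/
theorem even_bidegree_zero {q : ℕ} {y : B ⊗[A] ExteriorAlgebra A L} (hy : y ∈ bidegree L 𝒢 0 q) :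
    evenPart L 𝒢 y = y ∧ oddPart L 𝒢 y = 0 := by
  obtain ⟨t, rfl⟩ := hy
  induction t with
  | zero => simp
  | add s t hs ht =>
    rw [map_add, map_add, map_add, hs.1, ht.1, hs.2, ht.2, add_zero]
    exact ⟨rfl, rfl⟩
  | tmul b w =>
    rw [TensorProduct.map_tmul]
    exact ⟨evenPart_tmul b.2 _, oddPart_tmul b.2 _⟩

theorem gmul_eq_mul {q : ℕ} (x : B ⊗[A] ExteriorAlgebra A L) {y : B ⊗[A] ExteriorAlgebra A L}
    (hy : y ∈ bidegree L 𝒢 0 q) : gmul 𝒢 x y = x * y := by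
  rw [gmul, (even_bidegree_zero hy).1, (even_bidegree_zero hy).2, mul_zero, add_zero]

theorem ι_tmul_mul (b : B) (α : L) (y : B ⊗[A] ExteriorAlgebra A L) :
    (b ⊗ₜ ExteriorAlgebra.ι A α) * y = wedgeL A B α ((b ⊗ₜ 1) * y) := by
  induction y with
  | zero => simp
  | add s t hs ht => rw [mul_add, mul_add, hs, ht, map_add]
  | tmul c w => simp

theorem bracket_one_right (b : B) {q : ℕ} {x : ExteriorAlgebra A L} (hx : x ∈ ⋀[A]^q L) :
    bracket R 𝒢 (b ⊗ₜ 1) (1 ⊗ₜ x) = -contrForm R A L B x b := by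
  have hy := even_bidegree_zero (𝒢 := 𝒢) (tmul_mem_bidegree SetLike.GradedOne.one_mem hx)
  rw [bracket, hy.1, hy.2, map_zero, sub_zero, brUnsigned, ← map_one (extProj R A L), descend_tmul]
  simp only [brAux, LinearMap.mk₂_apply, LinearMap.add_apply, brExt_one, mul_zero, zero_add,
    Module.End.mul_apply, LinearMap.mulLeft_apply, brFun_tmul, map_one,
    ← Algebra.TensorProduct.one_def, mul_one, one_mul]

/-- Since `α(1) = 0`, two contributions survive: `α` acts on `x` by the Lie derivative, and the
factors of `x` differentiate `b`. -/
theorem bracket_ι_right (b : B) (α : L) {q : ℕ} {y : ExteriorAlgebra R L}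
    (hx : extProj R A L y ∈ ⋀[A]^q L) :
    bracket R 𝒢 (b ⊗ₜ ExteriorAlgebra.ι A α) (1 ⊗ₜ extProj R A L y) =
      b ⊗ₜ extProj R A L (lieExt R L y α) - wedgeL A B α (contrForm R A L B (extProj R A L y) b) := by
  have hy := even_bidegree_zero (𝒢 := 𝒢) (tmul_mem_bidegree SetLike.GradedOne.one_mem hx)
  rw [bracket, hy.1, hy.2, map_zero, sub_zero, brUnsigned, ← extProj_ι (R := R), descend_tmul]
  have h : brExt R A L B (ExteriorAlgebra.ι R α) (1 ⊗ₜ extProj R A L y) =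
      1 ⊗ₜ extProj R A L (lieExt R L y α) := by
    rw [← mul_one (ExteriorAlgebra.ι R α), brExt_ι_mul, brExt_one, lieE_tmul, lie_one A]
    simp [← Algebra.TensorProduct.one_def]
  simp only [brAux, LinearMap.mk₂_apply, LinearMap.add_apply, Module.End.mul_apply, h,
    LinearMap.mulLeft_apply, brFun_tmul, extProj_ι, mul_neg, ι_tmul_mul]
  simp [← Algebra.TensorProduct.one_def, sub_eq_add_neg]

namespace IsExactGenerator

theorem D_one (hD : IsExactGenerator 𝒢 D) {p : ℤ} {b : B} (hb : b ∈ 𝒢 p) : D (b ⊗ₜ 1) = 0 :=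
  hD.bidegree_zero p _ (tmul_mem_bidegree hb one_mem_ext)

theorem D_one_mem (hD : IsExactGenerator 𝒢 D) {q : ℕ} {x : ExteriorAlgebra A L} (hx : x ∈ ⋀[A]^q L) :
    ∃ q', D (1 ⊗ₜ x) ∈ bidegree L 𝒢 0 q' := by
  have h := tmul_mem_bidegree (𝒢 := 𝒢) SetLike.GradedOne.one_mem hx
  cases q with
  | zero => exact ⟨0, by rw [hD.bidegree_zero _ _ h]; exact zero_mem _⟩
  | succ q => exact ⟨q, hD.mem_bidegree _ _ _ h⟩

/-- The generating identity for `b ⊗ 1` and `1 ⊗ x`, solved for `D (b ⊗ x)`; the term with `D (b ⊗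
1)` is zero. -/
theorem negOnePow_smul_D (hD : IsExactGenerator 𝒢 D) {p : ℤ} {b : B} (hb : b ∈ 𝒢 p) {q : ℕ}
    {x : ExteriorAlgebra A L} (hx : x ∈ ⋀[A]^q L) :
    p.negOnePow • D (b ⊗ₜ x) = (b ⊗ₜ 1) * D (1 ⊗ₜ x) - contrForm R A L B x b := by
  have hy := tmul_mem_bidegree (𝒢 := 𝒢) SetLike.GradedOne.one_mem hx
  have h := hD.generates p 0 0 q _ (tmul_mem_bidegree hb one_mem_ext) _ hy
  obtain ⟨q', hq'⟩ := hD.D_one_mem hx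
  rw [bracket_one_right b hx, gmul_eq_mul _ hy, gmul_eq_mul _ hy, gmul_eq_mul _ hq', hD.D_one hb,
    Algebra.TensorProduct.tmul_mul_tmul, mul_one, one_mul, zero_mul, sub_zero, Nat.cast_zero,
    add_zero, smul_sub, smul_smul, Int.units_mul_self, one_smul] at h
  rw [sub_eq_add_neg, h]; abel

theorem negOnePow_smul_D_ι (hD : IsExactGenerator 𝒢 D) (h𝒢 : IsGradedLAlgebra L 𝒢) {p : ℤ} {b : B}
    (hb : b ∈ 𝒢 p) (α : L) :
    p.negOnePow • D (b ⊗ₜ ExteriorAlgebra.ι A α) = (hD.rightModule h𝒢).act α b ⊗ₜ 1 := by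
  rw [hD.negOnePow_smul_D hb (ι_mem_ext α), hD.D_ι, hD.rightModule_act,
    ← mul_one (ExteriorAlgebra.ι A α), contrForm_ι_mul, contrForm_one, TensorProduct.sub_tmul]
  simp

/-- The generating identity for `b ⊗ α` and `1 ⊗ x` contains `D (b ⊗ α)`, which is the right action,
and `α ∧ (b D(1 ⊗ x))`. The contraction of `x` with `b` in the bracket completes the latter, by
`negOnePow_smul_D`, to `α ∧ D (b ⊗ x)` up to sign. -/
theorem negOnePow_smul_D_wedge (hD : IsExactGenerator 𝒢 D) (h𝒢 : IsGradedLAlgebra L 𝒢) {p : ℤ} {b : B}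
    (hb : b ∈ 𝒢 p) (α : L) {q : ℕ} {y : ExteriorAlgebra R L} (hx : extProj R A L y ∈ ⋀[A]^q L) :
    p.negOnePow • D (b ⊗ₜ (ExteriorAlgebra.ι A α * extProj R A L y)) =
      (hD.rightModule h𝒢).act α b ⊗ₜ extProj R A L y - b ⊗ₜ extProj R A L (lieExt R L y α) -
        wedgeL A B α (p.negOnePow • D (b ⊗ₜ extProj R A L y)) := by
  have hy := tmul_mem_bidegree (𝒢 := 𝒢) SetLike.GradedOne.one_mem hx
  have h := hD.generates p 0 1 q _ (tmul_mem_bidegree hb (ι_mem_ext α)) _ hy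
  obtain ⟨q', hq'⟩ := hD.D_one_mem hx
  have hDα : D (b ⊗ₜ ExteriorAlgebra.ι A α) =
      p.negOnePow • ((hD.rightModule h𝒢).act α b ⊗ₜ 1) := by
    rw [← hD.negOnePow_smul_D_ι h𝒢 hb, smul_smul, Int.units_mul_self, one_smul]
  rw [bracket_ι_right b α hx, gmul_eq_mul _ hy, gmul_eq_mul _ hy, gmul_eq_mul _ hq', hDα,
    Algebra.TensorProduct.tmul_mul_tmul, mul_one, smul_mul_assoc,
    Algebra.TensorProduct.tmul_mul_tmul, mul_one, one_mul, Nat.cast_one, Int.negOnePow_succ,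
    Units.neg_smul, Units.neg_smul, smul_sub, smul_sub, smul_neg, smul_smul, smul_smul,
    Int.units_mul_self, one_smul, one_smul, ι_tmul_mul] at h
  rw [hD.negOnePow_smul_D hb hx, map_sub]
  rw [eq_neg_iff_add_eq_zero] at h
  rw [← sub_eq_zero, ← h]
  abel

/-- Both operators vanish on `b ⊗ 1` and obey the recursion of `negOnePow_smul_D_wedge`, so they
agree by induction on the number of exterior factors. -/
theorem negOnePow_smul_D_eq (hD : IsExactGenerator 𝒢 D) (h𝒢 : IsGradedLAlgebra L 𝒢) {p : ℤ} {b : B}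
    (hb : b ∈ 𝒢 p) (w : ExteriorAlgebra A L) :
    p.negOnePow • D (b ⊗ₜ w) = (hD.rightModule h𝒢).ceOperator (b ⊗ₜ w) := by
  have key : ∀ {b : B}, b ∈ 𝒢 p → ∀ k (v : Fin k → L), p.negOnePow • D (b ⊗ₜ extProj R A L (ExteriorAlgebra.ιMulti R k v)) =
      (hD.rightModule h𝒢).ceOperator (b ⊗ₜ extProj R A L (ExteriorAlgebra.ιMulti R k v)) := by
    intro b hb k
    induction k with
    | zero =>
      intro v
      rw [RightALModule.ceOperator, connDiff_tmul, ExteriorAlgebra.ιMulti_zero_apply, map_one, hD.D_one hb,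
        ceDiff_one, map_zero, smul_zero]
    | succ k ih =>
      intro v
      rw [ExteriorAlgebra.ιMulti_succ_apply, map_mul, extProj_ι, hD.negOnePow_smul_D_wedge h𝒢 hb _
        (extProj_ιMulti_mem _), ih, RightALModule.ceOperator, ← extProj_ι (R := R), ← map_mul,
        connDiff_tmul, connDiff_tmul, ceDiff_ι_mul, map_sub, map_sub, tensProj_ceMul]
      rfl
  induction w using ιMulti_induction generalizing b with
  | h0 => simp
  | hadd x y hx hy => rw [TensorProduct.tmul_add, map_add, map_add, smul_add, hx hb, hy hb]
  | hsmul r x hx => rw [← TensorProduct.smul_tmul, hx ((𝒢 p).smul_mem r hb)]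
  | h k v => rw [← extProj_ιMulti (R := R), key hb]

theorem D_eq (hD : IsExactGenerator 𝒢 D) (h𝒢 : IsGradedLAlgebra L 𝒢)
    (t : B ⊗[A] ExteriorAlgebra A L) :
    D t = (hD.rightModule h𝒢).ceOperator
      ((gradeScale 𝒢 (fun p => (p.negOnePow : ℤ))).rTensor _ t) := by
  induction t with
  | zero => simp
  | add s t hs ht => rw [map_add, map_add, hs, ht, map_add]
  | tmul b w =>
    rw [LinearMap.rTensor_tmul]
    induction b using DirectSum.Decomposition.inductionOn 𝒢 with
    | zero => simp
    | @homogeneous p b =>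
      rw [gradeScale_of_mem 𝒢 _ b.2, ← TensorProduct.smul_tmul', map_zsmul,
        ← hD.negOnePow_smul_D_eq h𝒢 b.2, Units.smul_def, smul_smul, ← Units.val_mul,
        Int.units_mul_self, Units.val_one, one_smul]
    | add b c hb hc =>
      rw [TensorProduct.add_tmul, map_add, hb, hc, map_add, TensorProduct.add_tmul, map_add]

theorem sign_sign (hD : IsExactGenerator 𝒢 D) (h𝒢 : IsGradedLAlgebra L 𝒢)
    (x : (hD.rightModule h𝒢).Carrier) : hD.sign h𝒢 (hD.sign h𝒢 x) = x := by
  change gradeScale 𝒢 (fun p => (p.negOnePow : ℤ)) (gradeScale 𝒢 (fun p => (p.negOnePow : ℤ))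
    (show B from x)) = (show B from x)
  generalize (show B from x) = b
  induction b using DirectSum.Decomposition.inductionOn 𝒢 with
  | zero => simp
  | @homogeneous p b =>
    rw [gradeScale_of_mem 𝒢 _ b.2, map_zsmul, gradeScale_of_mem 𝒢 _ b.2, smul_smul,
      ← Units.val_mul, Int.units_mul_self, Units.val_one, one_smul]
  | add b c hb hc => rw [map_add, map_add, hb, hc]

theorem subtype_ceOperator (hD : IsExactGenerator 𝒢 D) (h𝒢 : IsGradedLAlgebra L 𝒢) (p : ℤ)
    (t : 𝒢 p ⊗[A] ExteriorAlgebra A L) :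
    (hD.rightModule h𝒢).ceOperator ((𝒢 p).subtype.rTensor _ t) =
      (𝒢 p).subtype.rTensor _ ((hD.rightModulePart h𝒢 p).ceOperator t) :=
  connDiff_rTensor _ (hD.rightModulePart h𝒢 p).act_smul (hD.rightModulePart h𝒢 p).act_smul' _ _ _
    (𝒢 p).subtype (fun _ _ => rfl) t

theorem D_subtype (hD : IsExactGenerator 𝒢 D) (h𝒢 : IsGradedLAlgebra L 𝒢) (p : ℤ)
    (t : 𝒢 p ⊗[A] ExteriorAlgebra A L) :
    D ((𝒢 p).subtype.rTensor _ t) = (𝒢 p).subtype.rTensor _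
      ((hD.rightModulePart h𝒢 p).ceOperator
        (((p.negOnePow : ℤ) • (LinearMap.id : 𝒢 p →ₗ[A] 𝒢 p)).rTensor _ t)) := by
  rw [hD.D_eq h𝒢, ← subtype_ceOperator, ← LinearMap.rTensor_comp_apply, ← LinearMap.rTensor_comp_apply]
  congr 3
  apply LinearMap.ext
  intro b
  exact gradeScale_of_mem 𝒢 _ b.2

end IsExactGenerator

/-- The projection `B → 𝒢 p`. -/
def gradeProj (𝒢 : ℤ → Submodule A B) [GradedAlgebra 𝒢] (p : ℤ) : B →ₗ[A] 𝒢 p :=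
  DirectSum.component A ℤ (fun i => 𝒢 i) p ∘ₗ (DirectSum.decomposeLinearEquiv 𝒢).toLinearMap

theorem gradeProj_coe (𝒢 : ℤ → Submodule A B) [GradedAlgebra 𝒢] {p : ℤ} (b : 𝒢 p) :
    gradeProj 𝒢 p b = b := by
  simp only [gradeProj, LinearMap.comp_apply, LinearEquiv.coe_coe,
    DirectSum.decomposeLinearEquiv_apply, DirectSum.decompose_coe]
  exact DirectSum.component.lof_self A (M := fun i => 𝒢 i) p b

/-- `𝒢 p` is a direct summand of `B`, so the injection survives the tensor product. -/
theorem rTensor_subtype_injective (p : ℤ) :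
    Function.Injective ((𝒢 p).subtype.rTensor (ExteriorAlgebra A L)) :=
  Function.LeftInverse.injective (g := (gradeProj 𝒢 p).rTensor _) fun t => by
    rw [← LinearMap.rTensor_comp_apply,
      show gradeProj 𝒢 p ∘ₗ (𝒢 p).subtype = LinearMap.id from LinearMap.ext (gradeProj_coe 𝒢),
      LinearMap.rTensor_id]
    rfl

/-- The isomorphism of `(B ⊗_A ⋀_A L, D)` with the tensor product of `B_D` and the Rinehart
complex. -/
def bvComplexIso (hD : IsExactGenerator 𝒢 D) (h𝒢 : IsGradedLAlgebra L 𝒢) :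
    bvComplex hD ≅ nTensorComplex (hD.sign h𝒢) (rinehartComplex R A L) :=
  complexIso (hD.rightModule h𝒢) LinearMap.id Function.injective_id (extDegree A L B)
    (fun _ => rfl) (fun n _ hx => hD.D_mem n hx)
    (fun _ => ModuleCat.hom_ext (LinearMap.ext fun x => Subtype.ext (hD.exact x.1)))
    (gradeScale 𝒢 (fun p => (p.negOnePow : ℤ)))
    (fun _ => rfl) (hD.D_eq h𝒢)

/-- The part of degree `p` of `bvComplexIso`. -/
def bvComplexPartIso (hD : IsExactGenerator 𝒢 D) (h𝒢 : IsGradedLAlgebra L 𝒢) (p : ℤ) :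
    bvComplexPart hD p ≅
      nTensorComplex (N := (hD.rightModulePart h𝒢 p).Carrier) ((p.negOnePow : ℤ) • LinearMap.id)
        (rinehartComplex R A L) :=
  complexIso (hD.rightModulePart h𝒢 p) ((𝒢 p).subtype.rTensor _) (rTensor_subtype_injective p)
    (bidegree L 𝒢 p) (fun n => by rw [LinearMap.rTensor_comp_lTensor]; rfl)
    (fun n _ hx => hD.mem_bidegree p n _ hx)
    (fun _ => ModuleCat.hom_ext (LinearMap.ext fun x => Subtype.ext (hD.exact x.1)))
    ((p.negOnePow : ℤ) • LinearMap.id)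
    (fun _ => rfl) (hD.D_subtype h𝒢 p)

end Generator

end LRBV

end

theorem theorem7p7 {R A L B : Type u} [CommRing R] [CommRing A] [Algebra R A]
    [LieRing L] [LieAlgebra R L] [Module A L] [LieRingModule L A]
    [LieRinehartRing A L] [LieRinehartAlgebra R A L]
    [Ring B] [Algebra A B] [Algebra R B] [IsScalarTower R A B]
    [LieRingModule L B] [LieModule R L B] [LAlgebra A L B]
    (𝒢 : ℤ → Submodule A B) [GradedAlgebra 𝒢] (h𝒢 : IsGradedLAlgebra L 𝒢)
    (D : B ⊗[A] ExteriorAlgebra A L →ₗ[R] B ⊗[A] ExteriorAlgebra A L)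
    (hD : IsExactGenerator 𝒢 D) :
    (∃ φ : bvComplex hD ≅ nTensorComplex (hD.sign h𝒢) (rinehartComplex R A L),
      ∀ (n : ℕ) (b : B) (w : ⋀[A]^n L),
        (φ.hom.f n).hom (bvTmul hD b w) =
          nTensorTmul (hD.sign h𝒢) (rinehartComplex R A L)
            ((hD.rightModule h𝒢).of b) (rinehartTmul 1 w)) ∧
    (∀ p : ℤ, ∃ φ : bvComplexPart hD p ≅
        nTensorComplex ((p.negOnePow : ℤ) • LinearMap.id) (rinehartComplex R A L),
      ∀ (n : ℕ) (b : 𝒢 p) (w : ⋀[A]^n L),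
        (φ.hom.f n).hom (bvTmulPart hD b w) =
          nTensorTmul ((p.negOnePow : ℤ) • LinearMap.id) (rinehartComplex R A L)
            ((hD.rightModulePart h𝒢 p).of b) (rinehartTmul 1 w)) ∧
    (Module.Projective A L →
      (∀ n : ℕ, Nonempty ((bvComplex hD).homology n ≅
        torModule R (UAlg R A L) (hD.rightModule h𝒢).Carrier n
          (ModuleCat.of (UAlg R A L) (UTriv R A L)))) ∧
      (∀ (p : ℤ) (n : ℕ), Nonempty ((bvComplexPart hD p).homology n ≅
        torModule R (UAlg R A L) (hD.rightModulePart h𝒢 p).Carrier n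
          (ModuleCat.of (UAlg R A L) (UTriv R A L))))) := by
  refine ⟨⟨bvComplexIso hD h𝒢, fun n b w => ?_⟩, fun p => ⟨bvComplexPartIso hD h𝒢 p,
    fun n b w => ?_⟩, fun hL => ⟨fun n => ⟨?_⟩, fun p n => ⟨?_⟩⟩⟩
  · exact complexIso_apply (hD.rightModule h𝒢) LinearMap.id Function.injective_id
      (extDegree A L B) (fun _ => rfl) (fun n _ hx => hD.D_mem n hx) _ _
      (fun _ => rfl) (hD.D_eq h𝒢) n b w _ rfl
  · exact complexIso_apply (hD.rightModulePart h𝒢 p) ((𝒢 p).subtype.rTensor _)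
      (rTensor_subtype_injective p) (bidegree L 𝒢 p) _
      (fun n _ hx => hD.mem_bidegree p n _ hx) _ _
      (fun _ => rfl) (hD.D_subtype h𝒢 p) n b w _ rfl
  · exact (HomologicalComplex.homologyFunctor _ _ n).mapIso (bvComplexIso hD h𝒢) ≪≫
      homologyIsoTor (hD.sign_sign h𝒢) n
  -- On the part of degree `p` the sign operator is the scalar `(-1)^p`, whose square is `1`, as the
  -- comparison with `Tor` requires.
  · refine (HomologicalComplex.homologyFunctor _ _ n).mapIso (bvComplexPartIso hD h𝒢 p) ≪≫
      homologyIsoTor (fun x => ?_) n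
    rw [LinearMap.smul_apply, LinearMap.smul_apply, LinearMap.id_apply, LinearMap.id_apply,
      smul_smul, ← Units.val_mul, Int.units_mul_self, Units.val_one, one_smul]
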